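/- **Setting.** Let $V$ be a real vector space of finite dimension $n$ and $A=S(V^*)$ the algebra of polynomial functions on $V$, graded so that $V^*$ has degree $2$. Let $\Delta$ be a fan in $V$ (a finite set of strictly convex polyhedral cones, not necessarily rational, closed under taking faces, any two of which meet in a common face). For $\sigma\in\Delta$ let $V_\sigma$ be the linear span of $\sigma$ and $A_\sigma=S(V_\sigma^*)$, with the same grading. $\Delta^n$ is the set of $n$-dimensional cones and $\Delta^{\le n-1}$ the subfan of the other cones. The boundary fan $\partial\Delta$ is the subfan generated by the $(n-1)$-cones that are a facet of exactly one $n$-cone. $\Delta$ is *normal* if all its maximal cones have dimension $n$ and, for every $\sigma\in\Delta$, the fan $\Delta/\sigma$ in $V/V_\sigma$ of the images of the cones having $\sigma$ as a face is not the union of two proper subfans whose intersection contains only cones of codimension at least $2$ in $V/V_\sigma$. $\Delta$ is *oriented* if an orientation of each $V_\sigma$ is fixed, the orientations for all $\sigma\in\Delta^n$ being the same orientation of $V$. Consider $\Delta$ as a finite topological space whose open sets are the subfans. A *pure sheaf* $\mathcal F$ on $\Delta$ is a flabby sheaf of $\mathbf Z$-graded modules over the sheaf $\sigma\mapsto A_\sigma$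 whose stalks $F_\sigma$ are finitely generated free $A_\sigma$-modules. $F_\Delta$ denotes its global sections, $F_{(\Delta,\Lambda)}$ those vanishing on the subfan $\Lambda$, and $F_{(\sigma,\partial\sigma)}\subset F_\sigma$ the elements vanishing on all proper faces of $\sigma$. Write $\mathrm{Hom}=\mathrm{Hom}_A$, $\otimes=\otimes_{\mathbf R}$, and let $\det V_\sigma^*=\bigwedge^{\dim\sigma}V_\sigma^*$ be placed in degree $2\dim\sigma$. The *dual sheaf* $\mathcal{DF}$ has stalks $(\mathcal{DF})_\sigma=\mathrm{Hom}(F_{(\sigma,\partial\sigma)},A_\sigma)\otimes\det V_\sigma^*$. For a facet $\tau$ of $\sigma$ choose $h\in V_\sigma^*$ with $h|_\sigma\ge 0$ and $\ker h=V_\tau$. The restriction $(\mathcal{DF})_\sigma\to(\mathcal{DF})_\tau$ is $\varepsilon\cdot\varphi_h\otimes\psi_h$, where $\psi_h(h\wedge\eta)=\eta|_{V_\tau}$; where $\varphi_h(f)(s)=f(h\check s)|_\tau$ for any $\check s\in F_\sigma$ with $\check s|_\tau=s$ that vanishes on all proper faces of $\sigma$ other than $\tau$; and where $\varepsilon=+1$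 if $\psi_h$ maps the orientation of $V_\sigma$ to that of $V_\tau$ and $\varepsilon=-1$ otherwise (this is independent of the choices). Restrictions to faces of higher codimension are the compositions along flags. Let $$\Theta:\bigoplus_{\sigma\in\Delta^n}(\mathcal{DF})_\sigma\longrightarrow \mathrm{Hom}(F_{(\Delta,\Delta^{\le n-1})},A)\otimes\det V^*$$ be the map induced by the decomposition $F_{(\Delta,\Delta^{\le n-1})}=\bigoplus_{\sigma\in\Delta^n}F_{(\sigma,\partial\sigma)}$, i.e. $(f_\sigma\otimes\omega)_\sigma\mapsto f\otimes\omega$ with $f(s)=\sum_\sigma f_\sigma(s|_\sigma)$. **Theorem 2.3.** Let $\mathcal F$ be a pure sheaf on a normal oriented fan $\Delta$. Then $\Theta$ is an isomorphism, the maps from $\mathrm{Hom}(F_{(\Delta,\partial\Delta)},A)\otimes\det V^*$ and $\mathrm{Hom}(F_\Delta,A)\otimes\det V^*$ to $\mathrm{Hom}(F_{(\Delta,\Delta^{\le n-1})},A)\otimes\det V^*$ given by restriction of homomorphisms are injective, and, regarding these modules as submodules in this way, $\Theta$ induces isomorphisms of graded $A$-modules $$(\mathcal{DF})_\Delta\xrightarrow{\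 \cong\ }\mathrm{Hom}(F_{(\Delta,\partial\Delta)},A)\otimes\det V^*,\qquad(\mathcal{DF})_{(\Delta,\partial\Delta)}\xrightarrow{\ \cong\ }\mathrm{Hom}(F_\Delta,A)\otimes\det V^* .$$ That is, there are isomorphisms of $A$-modules, preserving and reflecting homogeneity of each degree, that send a section $\psi$ to the unique element whose restriction is $\Theta\big((\psi_\sigma)_{\sigma\in\Delta^n}\big)$. -/

import Mathlib

universe u w

noncomputable section

open Module TensorProduct

namespace FanDuality

/-! ### Polynomial algebras and determinants of dual spaces -/

/-- The algebra `S(W^*)` of polynomial functions on the real vector space `W`. -/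
def PolyAlg (W : Type u) [AddCommGroup W] [Module ℝ W] : Type u :=
  SymmetricAlgebra ℝ (Dual ℝ W)

instance PolyAlg.commRing (W : Type u) [AddCommGroup W] [Module ℝ W] : CommRing (PolyAlg W) :=
  inferInstanceAs (CommRing (SymmetricAlgebra ℝ (Dual ℝ W)))

instance PolyAlg.algebra (W : Type u) [AddCommGroup W] [Module ℝ W] : Algebra ℝ (PolyAlg W) :=
  inferInstanceAs (Algebra ℝ (SymmetricAlgebra ℝ (Dual ℝ W)))

/-- The inclusion of the linear forms on `W` into `S(W^*)`. -/
def linForm {W : Type u} [AddCommGroup W] [Module ℝ W] : Dual ℝ W →ₗ[ℝ] PolyAlg W :=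
  SymmetricAlgebra.ι ℝ (Dual ℝ W)

/-- Pull-back of polynomial functions along a linear map. -/
def pull {W W' : Type u} [AddCommGroup W] [Module ℝ W] [AddCommGroup W'] [Module ℝ W']
    (f : W →ₗ[ℝ] W') : PolyAlg W' →ₐ[ℝ] PolyAlg W :=
  SymmetricAlgebra.lift (linForm.comp f.dualMap)

theorem pull_linForm {W W' : Type u} [AddCommGroup W] [Module ℝ W] [AddCommGroup W'] [Module ℝ W']
    (f : W →ₗ[ℝ] W') (h : Dual ℝ W') : pull f (linForm h) = linForm (h.comp f) := by
  exact SymmetricAlgebra.lift_ι_apply (linForm.comp f.dualMap) h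

theorem pull_pull {W W' W'' : Type u} [AddCommGroup W] [Module ℝ W] [AddCommGroup W']
    [Module ℝ W'] [AddCommGroup W''] [Module ℝ W'']
    (f : W →ₗ[ℝ] W') (g : W' →ₗ[ℝ] W'') (a : PolyAlg W'') :
    pull f (pull g a) = pull (g.comp f) a := by
  have : (pull f).comp (pull g) = pull (g.comp f) := by
    apply SymmetricAlgebra.algHom_ext
    ext h
    change pull f (pull g (linForm h)) = pull (g.comp f) (linForm h)
    simp only [pull_linForm]
    rfl
  exact DFunLike.congr_fun this a

theorem pull_id {W : Type u} [AddCommGroup W] [Module ℝ W] (a : PolyAlg W) :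
    pull (LinearMap.id : W →ₗ[ℝ] W) a = a := by
  have : pull (LinearMap.id : W →ₗ[ℝ] W) = AlgHom.id ℝ (PolyAlg W) := by
    apply SymmetricAlgebra.algHom_ext
    ext h
    change pull _ (linForm h) = linForm h
    simp only [pull_linForm]
    rfl
  exact DFunLike.congr_fun this a

/-- The even grading of `S(W^*)`: linear forms have degree `2`, so the part of degree `2 m`
is spanned by the `m`-fold products of linear forms, and the other parts are zero. -/
def polyDeg (W : Type u) [AddCommGroup W] [Module ℝ W] (k : ℤ) : Submodule ℝ (PolyAlg W) :=
  ⨆ (m : ℕ) (_ : (2 * m : ℤ) = k), LinearMap.range (linForm (W := W)) ^ m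

/-- `det W^*`, the top exterior power of `W^*`, realised as the space of alternating forms on `W`
in `dim W` variables. -/
abbrev DetDual (W : Type u) [AddCommGroup W] [Module ℝ W] : Type u :=
  W [⋀^Fin (finrank ℝ W)]→ₗ[ℝ] ℝ

/-- The isomorphism `det W^* ≅ det W'^*` given by an isomorphism `W' ≅ W`. -/
def detCongr {W W' : Type u} [AddCommGroup W] [Module ℝ W] [AddCommGroup W'] [Module ℝ W']
    (e : W' ≃ₗ[ℝ] W) : DetDual W ≃ₗ[ℝ] DetDual W' :=
  (AlternatingMap.domDomCongrₗ (R := ℝ) (M := W) (N := ℝ) ℝ (finCongr e.finrank_eq.symm)).trans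
    { toFun := fun ω => ω.compLinearMap e.toLinearMap
      invFun := fun ω => ω.compLinearMap e.symm.toLinearMap
      map_add' := fun _ _ => rfl
      map_smul' := fun _ _ => rfl
      left_inv := fun ω => by ext v; simp
      right_inv := fun ω => by ext v; simp }

/-! ### Fans -/

section Cones

variable {V : Type u} [AddCommGroup V] [Module ℝ V]

/-- The linear span of a cone. -/
abbrev linSpan (σ : PointedCone ℝ V) : Submodule ℝ V := Submodule.span ℝ (σ : Set V)

/-- The dimension of a cone. -/
abbrev coneDim (σ : PointedCone ℝ V) : ℕ := finrank ℝ (linSpan σ)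

theorem exists_sub_of_mem_linSpan (σ : PointedCone ℝ V) {z : V} (hz : z ∈ linSpan σ) :
    ∃ a ∈ σ, ∃ b ∈ σ, z + b = a := by
  induction hz using Submodule.span_induction with
  | mem x hx => exact ⟨x, hx, 0, zero_mem _, by simp⟩
  | zero => exact ⟨0, zero_mem _, 0, zero_mem _, by simp⟩
  | add x y _ _ hx hy =>
    obtain ⟨a, ha, b, hb, h⟩ := hx
    obtain ⟨a', ha', b', hb', h'⟩ := hy
    exact ⟨a + a', add_mem ha ha', b + b', add_mem hb hb', by rw [← h, ← h']; abel⟩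
  | smul c x _ hx =>
    obtain ⟨a, ha, b, hb, h⟩ := hx
    rcases le_total 0 c with hc | hc
    · exact ⟨c • a, σ.smul_mem hc ha, c • b, σ.smul_mem hc hb, by rw [← h]; module⟩
    · have hc' : 0 ≤ -c := by linarith
      exact ⟨(-c) • b, σ.smul_mem hc' hb, (-c) • a, σ.smul_mem hc' ha, by rw [← h]; module⟩

/-- A point of `σ` in the linear span of a face of `σ` lies in that face. -/
theorem mem_face_of_mem_linSpan {τ σ : PointedCone ℝ V} (h : τ.IsFaceOf σ) {z : V} (hz : z ∈ σ)
    (hz' : z ∈ linSpan τ) : z ∈ τ := by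
  obtain ⟨a, ha, b, hb, hab⟩ := exists_sub_of_mem_linSpan τ hz'
  exact h.mem_of_add_mem_left hz (h.le hb) (hab ▸ ha)

/-- A facet is a face of codimension one. -/
structure IsFacet (τ σ : PointedCone ℝ V) : Prop where
  isFaceOf : τ.IsFaceOf σ
  dim_eq : coneDim σ = coneDim τ + 1

/-- For a facet `τ` of `σ`, there are a linear form `h` that is non-negative on `σ` and satisfies
`V_τ = ker (h|V_σ)`, and a vector `v` of `V_σ` with `h v = 1`. -/
theorem IsFacet.exists_form [FiniteDimensional ℝ V] {τ σ : PointedCone ℝ V} (hf : IsFacet τ σ) :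
    ∃ h : Dual ℝ V, (∀ x ∈ σ, 0 ≤ h x) ∧ (∀ x ∈ linSpan σ, h x = 0 ↔ x ∈ linSpan τ) ∧
      ∃ v : linSpan σ, h v = 1 := by
  have hle : linSpan τ ≤ linSpan σ := Submodule.span_mono hf.isFaceOf.le
  have hlt : ∃ w ∈ linSpan σ, w ∉ linSpan τ := by
    by_contra! hc
    have : linSpan τ = linSpan σ := le_antisymm hle hc
    have h1 := hf.dim_eq
    have h2 : coneDim τ = coneDim σ := congrArg (fun S : Submodule ℝ V => finrank ℝ S) this
    omega
  obtain ⟨w, hwσ, hwτ⟩ := hlt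
  obtain ⟨g, hgw, hg⟩ := Submodule.exists_dual_map_eq_bot_of_notMem hwτ inferInstance
  have hgτ : ∀ x ∈ linSpan τ, g x = 0 := fun x hx => by
    have : g x ∈ (linSpan τ).map g := Submodule.mem_map_of_mem hx
    rwa [hg, Submodule.mem_bot] at this
  -- the kernel of `g` in the span of `σ` is the span of `τ`
  have hsup : linSpan τ ⊔ Submodule.span ℝ {w} = linSpan σ := by
    apply Submodule.eq_of_le_of_finrank_le
    · exact sup_le hle (by simpa using hwσ)
    · have hlt : linSpan τ < linSpan τ ⊔ Submodule.span ℝ {w} := by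
        refine lt_of_le_of_ne le_sup_left fun h => hwτ ?_
        rw [h]
        exact Submodule.mem_sup_right (Submodule.mem_span_singleton_self w)
      have h1 := Submodule.finrank_lt_finrank_of_lt hlt
      have h2 := hf.dim_eq
      simp only [coneDim] at h2
      omega
  have hker : ∀ x ∈ linSpan σ, g x = 0 ↔ x ∈ linSpan τ := by
    intro x hx
    refine ⟨fun h0 => ?_, hgτ x⟩
    rw [← hsup, Submodule.mem_sup] at hx
    obtain ⟨y, hy, z, hz, rfl⟩ := hx
    obtain ⟨c, rfl⟩ := Submodule.mem_span_singleton.1 hz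
    rw [map_add, hgτ y hy, map_smul, zero_add, smul_eq_mul] at h0
    have : c = 0 := (mul_eq_zero.1 h0).resolve_right hgw
    simpa [this] using hy
  -- `g` does not change sign on `σ`
  have hsign : ∀ x ∈ σ, ∀ y ∈ σ, 0 < g x → g y < 0 → False := by
    intro x hx y hy hgx hgy
    have hz : (-g y) • x + (g x) • y ∈ σ :=
      add_mem (σ.smul_mem (by linarith) hx) (σ.smul_mem hgx.le hy)
    have hz' : (-g y) • x + (g x) • y ∈ linSpan τ := by
      refine (hker _ (Submodule.subset_span hz)).1 ?_
      simp only [map_add, map_smul, smul_eq_mul]; ring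
    have hzτ := mem_face_of_mem_linSpan hf.isFaceOf hz hz'
    have hxτ := hf.isFaceOf.mem_of_smul_add_smul_mem_left hx hy (by linarith) hgx hzτ
    exact hgx.ne' (hgτ x (Submodule.subset_span hxτ))
  have key : ∀ g' : Dual ℝ V, (∀ x ∈ σ, 0 ≤ g' x) →
      (∀ x ∈ linSpan σ, g' x = 0 ↔ x ∈ linSpan τ) →
      ∃ h : Dual ℝ V, (∀ x ∈ σ, 0 ≤ h x) ∧ (∀ x ∈ linSpan σ, h x = 0 ↔ x ∈ linSpan τ) ∧
        ∃ v : linSpan σ, h v = 1 := by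
    intro g' h1 h2
    refine ⟨g', h1, h2, ⟨(g' w)⁻¹ • w, Submodule.smul_mem _ _ hwσ⟩, ?_⟩
    have : g' w ≠ 0 := fun h => hwτ ((h2 w hwσ).1 h)
    simp [this]
  by_cases hpos : ∀ x ∈ σ, 0 ≤ g x
  · exact key g hpos hker
  · push Not at hpos
    obtain ⟨y, hy, hgy⟩ := hpos
    refine key (-g) (fun x hx => ?_) (fun x hx => by simpa using hker x hx)
    by_contra hc
    exact hsign x hx y hy (by simpa using hc) hgy

/-- A set of cones in `V` is irreducible if it is not the union of two proper subfans whose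
intersection consists of cones of codimension at least two. -/
def IsIrreducible (S : Set (PointedCone ℝ V)) : Prop :=
  ¬ ∃ S₁ S₂ : Set (PointedCone ℝ V),
    (∀ γ ∈ S₁, ∀ δ : PointedCone ℝ V, δ.IsFaceOf γ → δ ∈ S₁) ∧
    (∀ γ ∈ S₂, ∀ δ : PointedCone ℝ V, δ.IsFaceOf γ → δ ∈ S₂) ∧
    S₁ ≠ S ∧ S₂ ≠ S ∧ S₁ ∪ S₂ = S ∧ ∀ γ ∈ S₁ ∩ S₂, coneDim γ + 2 ≤ finrank ℝ V

end Cones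

/-- A (not necessarily rational) fan in `V`: a finite set of strictly convex polyhedral cones,
closed under taking faces, such that any two of them intersect in a common face. -/
structure Fan (V : Type u) [AddCommGroup V] [Module ℝ V] where
  cones : Finset (PointedCone ℝ V)
  polyhedral : ∀ σ ∈ cones, Submodule.FG σ
  strictlyConvex : ∀ σ ∈ cones, (σ : ConvexCone ℝ V).Salient
  face_mem : ∀ σ ∈ cones, ∀ τ : PointedCone ℝ V, τ.IsFaceOf σ → τ ∈ cones
  inter_isFaceOf : ∀ σ ∈ cones, ∀ τ ∈ cones, (σ ⊓ τ).IsFaceOf σ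

namespace Fan

variable {V : Type u} [AddCommGroup V] [Module ℝ V] (Δ : Fan V)

/-- The cones of a fan, ordered by inclusion; by `le_iff_isFaceOf`, this is the face relation.
The open subsets of the fan space, the subfans, are therefore the lower sets. -/
abbrev Cone : Type u := {σ : PointedCone ℝ V // σ ∈ Δ.cones}

variable {Δ}

theorem le_iff_isFaceOf {τ σ : Δ.Cone} : τ ≤ σ ↔ τ.1.IsFaceOf σ.1 := by
  refine ⟨fun h => ?_, fun h => h.le⟩
  have := Δ.inter_isFaceOf σ.1 σ.2 τ.1 τ.2
  rwa [inf_eq_right.2 h] at this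

/-- The linear span `V_σ` of a cone. -/
abbrev span (σ : Δ.Cone) : Submodule ℝ V := linSpan σ.1

/-- The dimension of a cone. -/
abbrev dim (σ : Δ.Cone) : ℕ := coneDim σ.1

theorem span_mono {τ σ : Δ.Cone} (h : τ ≤ σ) : span τ ≤ span σ :=
  Submodule.span_mono h

theorem dim_lt [FiniteDimensional ℝ V] {τ σ : Δ.Cone} (h : τ < σ) : dim τ < dim σ := by
  refine Submodule.finrank_lt_finrank_of_lt (lt_of_le_of_ne (span_mono h.le) fun he => h.not_ge ?_)
  intro x hx
  exact mem_face_of_mem_linSpan (le_iff_isFaceOf.1 h.le) hx (he ▸ Submodule.subset_span hx)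

/-- The algebra `A_σ = S(V_σ^*)` of polynomial functions on `σ`. -/
abbrev Alg (σ : Δ.Cone) : Type u := PolyAlg (span σ)

/-- The restriction `A_σ → A_τ` of polynomial functions to a face. -/
def resAlg {τ σ : Δ.Cone} (h : τ ≤ σ) : Alg σ →ₐ[ℝ] Alg τ :=
  pull (Submodule.inclusion (span_mono h))

/-- `A_σ` is an algebra over `A = S(V^*)` by restriction of functions. -/
instance algebraAlg (σ : Δ.Cone) : Algebra (PolyAlg V) (Alg σ) :=
  (pull (span σ).subtype).toRingHom.toAlgebra

theorem algebraMap_apply (σ : Δ.Cone) (a : PolyAlg V) :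
    algebraMap (PolyAlg V) (Alg σ) a = pull (span σ).subtype a := rfl

instance towerAlg (σ : Δ.Cone) : IsScalarTower ℝ (PolyAlg V) (Alg σ) :=
  IsScalarTower.of_algebraMap_eq fun r => by rw [algebraMap_apply, AlgHom.commutes]

theorem resAlg_algebraMap {τ σ : Δ.Cone} (h : τ ≤ σ) (a : PolyAlg V) :
    resAlg h (algebraMap (PolyAlg V) (Alg σ) a) = algebraMap (PolyAlg V) (Alg τ) a := by
  rw [algebraMap_apply, algebraMap_apply, resAlg, pull_pull]
  rfl

variable (Δ)

/-- A fan is purely `n`-dimensional, `n = dim V`, if its maximal cones have dimension `n`. -/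
def IsPure : Prop := ∀ σ : Δ.Cone, IsMax σ → dim σ = finrank ℝ V

variable {Δ}

/-- The transversal fan `Δ/σ` in `V/V_σ`: the images of the cones of `Δ` that have `σ` as a face. -/
def transversal (σ : Δ.Cone) : Set (PointedCone ℝ (V ⧸ span σ)) :=
  {δ | ∃ γ : Δ.Cone, σ ≤ γ ∧ δ = γ.1.map (span σ).mkQ}

variable (Δ)

/-- A fan is normal if it is purely `n`-dimensional and all its transversal fans are irreducible. -/
def IsNormal : Prop := Δ.IsPure ∧ ∀ σ : Δ.Cone, IsIrreducible (transversal σ)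

/-- The set of the full-dimensional cones of the fan. -/
abbrev TopCone : Type u := {σ : Δ.Cone // dim σ = finrank ℝ V}

/-- The subfan of the cones of dimension at most `n - 1`, `n = dim V`. -/
def lowerSkeleton : Set Δ.Cone := {σ | dim σ < finrank ℝ V}

/-- The boundary subfan, generated by the `(n-1)`-cones that are a facet of exactly one
`n`-cone. -/
def boundary : Set Δ.Cone :=
  {γ | ∃ τ : Δ.Cone, γ ≤ τ ∧ dim τ + 1 = finrank ℝ V ∧
    ∃! σ : Δ.Cone, dim σ = finrank ℝ V ∧ IsFacet τ.1 σ.1}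

theorem boundary_subset [FiniteDimensional ℝ V] : Δ.boundary ⊆ Δ.lowerSkeleton := by
  rintro γ ⟨τ, hγ, hτ, -⟩
  have : dim γ ≤ dim τ := Submodule.finrank_mono (span_mono hγ)
  change dim γ < finrank ℝ V
  omega

variable {Δ}

/-- `V = V_σ` for a full-dimensional cone. -/
def topEquiv [FiniteDimensional ℝ V] (σ : Δ.TopCone) : V ≃ₗ[ℝ] span σ.1 :=
  (LinearEquiv.ofTop _ (Submodule.eq_top_of_finrank_eq σ.2)).symm

theorem subtype_topEquiv [FiniteDimensional ℝ V] (σ : Δ.TopCone) :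
    (span σ.1).subtype.comp (topEquiv σ).toLinearMap = LinearMap.id := by
  ext x
  simp [topEquiv]

/-- The identification `A_σ = A` for a full-dimensional cone. -/
def topAlg [FiniteDimensional ℝ V] (σ : Δ.TopCone) : Alg σ.1 →ₗ[PolyAlg V] PolyAlg V where
  toFun := pull (topEquiv σ).toLinearMap
  map_add' := map_add _
  map_smul' a b := by
    rw [Algebra.smul_def, map_mul, algebraMap_apply, pull_pull, subtype_topEquiv, pull_id]
    rfl

variable (Δ)

/-- An orientation of a fan: an orientation of each `V_σ`, such that the orientations of the
full-dimensional cones coincide as orientations of `V`. -/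
structure Oriented [FiniteDimensional ℝ V] where
  or : ∀ σ : Δ.Cone, Orientation ℝ (span σ) (Fin (dim σ))
  coincide : ∀ σ σ' : Δ.TopCone,
    Module.Ray.map (detCongr (topEquiv σ)) (or σ.1) =
      Module.Ray.map (detCongr (topEquiv σ')) (or σ'.1)

end Fan

open Fan

/-! ### Sheaves on a fan -/

/-- A sheaf of graded modules over the structure sheaf of `Δ`. A sheaf on the fan space is the same
as its stalks `F_σ = F(⟨σ⟩)` with the restriction maps between them; the sections over a subfan are
the compatible families. -/
structure FanSheaf {V : Type u} [AddCommGroup V] [Module ℝ V] (Δ : Fan V) where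
  stalk : Δ.Cone → Type w
  [addCommGroup : ∀ σ, AddCommGroup (stalk σ)]
  [module : ∀ σ, Module (Alg σ) (stalk σ)]
  res : ∀ {τ σ : Δ.Cone} (h : τ ≤ σ), stalk σ →ₛₗ[(resAlg h).toRingHom] stalk τ
  res_self : ∀ (σ : Δ.Cone) (s : stalk σ), res (le_refl σ) s = s
  res_res : ∀ {ρ τ σ : Δ.Cone} (h : ρ ≤ τ) (h' : τ ≤ σ) (s : stalk σ),
    res h (res h' s) = res (h.trans h') s
  deg : ∀ σ : Δ.Cone, ℤ → AddSubgroup (stalk σ)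
  deg_internal : ∀ σ : Δ.Cone, DirectSum.IsInternal (deg σ)
  smul_mem_deg : ∀ (σ : Δ.Cone) (i j : ℤ) (a : Alg σ) (s : stalk σ),
    a ∈ polyDeg (span σ) i → s ∈ deg σ j → a • s ∈ deg σ (i + j)
  res_mem_deg : ∀ {τ σ : Δ.Cone} (h : τ ≤ σ) (i : ℤ) (s : stalk σ),
    s ∈ deg σ i → res h s ∈ deg τ i

attribute [instance] FanSheaf.addCommGroup FanSheaf.module

namespace FanSheaf

variable {V : Type u} [AddCommGroup V] [Module ℝ V] {Δ : Fan V} (F : FanSheaf.{u, w} Δ)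

/-- The stalks are modules over `A = S(V^*)` by restriction of functions. -/
instance moduleStalk (σ : Δ.Cone) : Module (PolyAlg V) (F.stalk σ) :=
  Module.compHom (F.stalk σ) (algebraMap (PolyAlg V) (Alg σ))

theorem smul_def {σ : Δ.Cone} (a : PolyAlg V) (s : F.stalk σ) :
    a • s = algebraMap (PolyAlg V) (Alg σ) a • s := rfl

theorem res_smul {τ σ : Δ.Cone} (h : τ ≤ σ) (a : PolyAlg V) (s : F.stalk σ) :
    F.res h (a • s) = a • F.res h s := by
  rw [smul_def, smul_def, map_smulₛₗ, ← resAlg_algebraMap h a]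
  rfl

/-- A family of germs is compatible on a set of cones. Restricted to a subfan `Λ`, such a family is
a section of the sheaf over `Λ`. -/
def IsSection (Λ : Set Δ.Cone) (s : ∀ σ, F.stalk σ) : Prop :=
  ∀ ⦃τ σ : Δ.Cone⦄ (h : τ ≤ σ), σ ∈ Λ → τ ∈ Λ → F.res h (s σ) = s τ

/-- The module `F_(Δ,Λ)` of the sections over `Δ` that vanish on `Λ`; in particular,
`F_Δ` is obtained for `Λ = ∅`. -/
def sections (Λ : Set Δ.Cone) : Submodule (PolyAlg V) (∀ σ, F.stalk σ) where
  carrier := {s | F.IsSection Set.univ s ∧ ∀ σ ∈ Λ, s σ = 0}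
  add_mem' := by
    rintro s t ⟨hs, hs'⟩ ⟨ht, ht'⟩
    refine ⟨fun τ σ h h1 h2 => ?_, fun σ hσ => ?_⟩
    · rw [Pi.add_apply, Pi.add_apply, map_add, hs h h1 h2, ht h h1 h2]
    · rw [Pi.add_apply, hs' σ hσ, ht' σ hσ, add_zero]
  zero_mem' := ⟨fun τ σ h _ _ => map_zero _, fun _ _ => rfl⟩
  smul_mem' := by
    rintro a s ⟨hs, hs'⟩
    refine ⟨fun τ σ h h1 h2 => ?_, fun σ hσ => ?_⟩
    · rw [Pi.smul_apply, Pi.smul_apply, res_smul, hs h h1 h2]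
    · rw [Pi.smul_apply, hs' σ hσ, smul_zero]

theorem sections_anti {Λ Λ' : Set Δ.Cone} (h : Λ ⊆ Λ') : F.sections Λ' ≤ F.sections Λ :=
  fun _ hs => ⟨hs.1, fun σ hσ => hs.2 σ (h hσ)⟩

/-- The module `F_(σ,∂σ)` of the sections over `⟨σ⟩` that vanish on the proper faces of `σ`. -/
def rel (σ : Δ.Cone) : Submodule (PolyAlg V) (F.stalk σ) where
  carrier := {s | ∀ (τ : Δ.Cone) (h : τ < σ), F.res h.le s = 0}
  add_mem' := fun hs ht τ h => by rw [map_add, hs τ h, ht τ h, add_zero]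
  zero_mem' := fun τ h => map_zero _
  smul_mem' := fun a s hs τ h => by rw [res_smul, hs τ h, smul_zero]

/-- The homogeneous elements of degree `i` of `F_(σ,∂σ)`. -/
def relDeg (σ : Δ.Cone) (i : ℤ) : Set (F.rel σ) := {s | s.1 ∈ F.deg σ i}

/-- The homogeneous elements of degree `i` of `F_(Δ,Λ)`. -/
def sectionsDeg (Λ : Set Δ.Cone) (i : ℤ) : Set (F.sections Λ) := {s | ∀ σ, s.1 σ ∈ F.deg σ i}

/-- The module `(DF)_σ = Hom(F_(σ,∂σ), A_σ) ⊗ det V_σ^*`. -/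
abbrev DualStalk (σ : Δ.Cone) : Type (max u w) :=
  (F.rel σ →ₗ[PolyAlg V] Alg σ) ⊗[ℝ] DetDual (span σ)

/-- The homogeneous part of degree `k` of `(DF)_σ`, where `det V_σ^*` has degree `2 dim σ`, and a
homomorphism is homogeneous of degree `d` if it raises degrees by `d`. -/
def dualStalkDeg (σ : Δ.Cone) (k : ℤ) : Submodule ℝ (F.DualStalk σ) :=
  Submodule.span ℝ {x | ∃ (f : F.rel σ →ₗ[PolyAlg V] Alg σ) (ω : DetDual (span σ)),
    (∀ i : ℤ, ∀ s ∈ F.relDeg σ i, f s ∈ polyDeg (span σ) (i + (k - 2 * dim σ))) ∧ x = f ⊗ₜ ω}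

/-- The module `Hom(F_(Δ,Λ), A) ⊗ det V^*`. -/
abbrev HomDet (Λ : Set Δ.Cone) : Type (max u w) :=
  (F.sections Λ →ₗ[PolyAlg V] PolyAlg V) ⊗[ℝ] DetDual V

/-- The homogeneous part of degree `k` of `Hom(F_(Δ,Λ), A) ⊗ det V^*`, where `det V^*` has degree
`2 dim V`. -/
def homDetDeg (Λ : Set Δ.Cone) (k : ℤ) : Submodule ℝ (F.HomDet Λ) :=
  Submodule.span ℝ {x | ∃ (f : F.sections Λ →ₗ[PolyAlg V] PolyAlg V) (ω : DetDual V),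
    (∀ i : ℤ, ∀ s ∈ F.sectionsDeg Λ i, f s ∈ polyDeg V (i + (k - 2 * finrank ℝ V))) ∧ x = f ⊗ₜ ω}

/-- For `Λ ⊆ Λ'`, the map `Hom(F_(Δ,Λ), A) ⊗ det V^* → Hom(F_(Δ,Λ'), A) ⊗ det V^*` given by the
restriction of homomorphisms to `F_(Δ,Λ') ⊆ F_(Δ,Λ)`. -/
def homRestrict {Λ Λ' : Set Δ.Cone} (h : Λ ⊆ Λ') : F.HomDet Λ →ₗ[PolyAlg V] F.HomDet Λ' :=
  AlgebraTensorModule.map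
    (LinearMap.lcomp (PolyAlg V) (PolyAlg V) (Submodule.inclusion (F.sections_anti h)))
    LinearMap.id

variable [FiniteDimensional ℝ V]

/-- A section that vanishes on the cones of dimension at most `n - 1` restricts to an element of
`F_(σ,∂σ)` on each `n`-cone `σ`. -/
def toRel (σ : Δ.TopCone) : F.sections Δ.lowerSkeleton →ₗ[PolyAlg V] F.rel σ.1 where
  toFun s := ⟨s.1 σ.1, fun τ h => by
    rw [s.2.1 h.le trivial trivial]
    exact s.2.2 τ ((dim_lt h).trans_eq σ.2)⟩
  map_add' _ _ := rfl
  map_smul' _ _ := rfl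

/-- The map `Θ` from the sum of the `(DF)_σ` over the `n`-cones `σ` to
`Hom(F_(Δ,Δ^{≤n-1}), A) ⊗ det V^*`. It is given by the decomposition of `F_(Δ,Δ^{≤n-1})` as the
direct sum of the `F_(σ,∂σ)`: the image of `(f_σ ⊗ ω)` is `f ⊗ ω` with `f(s) = ∑ f_σ(s|σ)`. -/
def theta : (∀ σ : Δ.TopCone, F.DualStalk σ.1) →ₗ[PolyAlg V] F.HomDet Δ.lowerSkeleton :=
  ∑ σ : Δ.TopCone,
    (AlgebraTensorModule.map
      ((LinearMap.lcomp (PolyAlg V) (PolyAlg V) (F.toRel σ)).comp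
        (LinearMap.compRight (PolyAlg V) (topAlg σ)))
      (detCongr (topEquiv σ)).toLinearMap).comp (LinearMap.proj σ)

end FanSheaf

/-- A pure sheaf: a flabby sheaf of graded modules over the structure sheaf, with finitely generated
free stalks. -/
structure PureSheaf {V : Type u} [AddCommGroup V] [Module ℝ V] (Δ : Fan V)
    extends FanSheaf.{u, w} Δ where
  flabby : ∀ Λ : Set Δ.Cone, IsLowerSet Λ → ∀ s, toFanSheaf.IsSection Λ s →
    ∃ t, toFanSheaf.IsSection Set.univ t ∧ ∀ σ ∈ Λ, t σ = s σ
  free : ∀ σ, Module.Free (Alg σ) (stalk σ)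
  finite : ∀ σ, Module.Finite (Alg σ) (stalk σ)

/-! ### The dual sheaf -/

section Facet

variable {V : Type u} [AddCommGroup V] [Module ℝ V] [FiniteDimensional ℝ V]

/-- A linear form `h` with `h|σ ≥ 0` and `V_τ = ker (h|V_σ)`, for a facet `τ` of `σ`. -/
def facetForm {τ σ : PointedCone ℝ V} (hf : IsFacet τ σ) : Dual ℝ V := hf.exists_form.choose

theorem facetForm_nonneg {τ σ : PointedCone ℝ V} (hf : IsFacet τ σ) :
    ∀ x ∈ σ, 0 ≤ facetForm hf x := hf.exists_form.choose_spec.1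

theorem facetForm_eq_zero_iff {τ σ : PointedCone ℝ V} (hf : IsFacet τ σ) :
    ∀ x ∈ linSpan σ, facetForm hf x = 0 ↔ x ∈ linSpan τ := hf.exists_form.choose_spec.2.1

/-- A vector of `V_σ` on which `facetForm` has the value `1`. -/
def facetVec {τ σ : PointedCone ℝ V} (hf : IsFacet τ σ) : linSpan σ :=
  hf.exists_form.choose_spec.2.2.choose

theorem facetForm_facetVec {τ σ : PointedCone ℝ V} (hf : IsFacet τ σ) :
    facetForm hf (facetVec hf) = 1 := hf.exists_form.choose_spec.2.2.choose_spec

/-- The map `ψ_h : det V_σ^* → det V_τ^*`, `h ∧ η ↦ η|V_τ`, for `h = facetForm`. As alternating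
forms, it is the contraction with any vector `v` such that `h v = 1`, followed by the restriction
to `V_τ = ker h`. -/
def facetDet {τ σ : PointedCone ℝ V} (hf : IsFacet τ σ) :
    DetDual (linSpan σ) →ₗ[ℝ] DetDual (linSpan τ) where
  toFun ω := ((ω.domDomCongr (finCongr hf.dim_eq)).curryLeft (facetVec hf)).compLinearMap
    (Submodule.inclusion (Submodule.span_mono hf.isFaceOf.le))
  map_add' _ _ := rfl
  map_smul' _ _ := rfl

end Facet

namespace PureSheaf

variable {V : Type u} [AddCommGroup V] [Module ℝ V] [FiniteDimensional ℝ V] {Δ : Fan V}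
  (F : PureSheaf.{u, w} Δ)

/-- The germ `t` at `σ` extends the section `s` of `F_(τ,∂τ)`, extended by zero to `∂σ`. -/
def IsExtension {τ σ : Δ.Cone} (h : τ ≤ σ) (s : F.rel τ) (t : F.stalk σ) : Prop :=
  F.res h t = s ∧ ∀ (ρ : Δ.Cone) (hρ : ρ < σ), ρ ≠ τ → F.res hρ.le t = 0

theorem exists_extension {τ σ : Δ.Cone} (hf : IsFacet τ.1 σ.1) (s : F.rel τ) :
    ∃ t : F.stalk σ, F.IsExtension (le_iff_isFaceOf.2 hf.isFaceOf) s t := by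
  classical
  have hle : τ ≤ σ := le_iff_isFaceOf.2 hf.isFaceOf
  have hlt : τ < σ := lt_of_le_of_ne hle fun h => by
    have := hf.dim_eq
    rw [h] at this
    omega
  have hcov : ∀ ρ : Δ.Cone, τ < ρ → ρ < σ → False := fun ρ h1 h2 => by
    have h3 := dim_lt h1
    have h4 := dim_lt h2
    have h5 := hf.dim_eq
    simp only [dim] at h3 h4
    omega
  let s' : ∀ ρ, F.stalk ρ := fun ρ => if h : ρ ≤ τ then F.res h s.1 else 0
  have hs' : F.IsSection {ρ | ρ < σ} s' := by
    intro ρ' ρ h hρ hρ'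
    by_cases h1 : ρ ≤ τ
    · simp only [s', dif_pos h1, dif_pos (h.trans h1), F.res_res]
    · by_cases h2 : ρ' ≤ τ
      · have h3 : ρ' < τ := lt_of_le_of_ne h2 fun he => by
          subst he
          exact hcov ρ (lt_of_le_of_ne h fun he => h1 he.ge) hρ
        simp only [s', dif_neg h1, dif_pos h2, map_zero, s.2 ρ' h3]
      · simp only [s', dif_neg h1, dif_neg h2, map_zero]
  obtain ⟨t, ht, ht'⟩ := F.flabby {ρ | ρ < σ} (fun a b hba ha => lt_of_le_of_lt hba ha) s' hs'
  refine ⟨t σ, ?_, fun ρ hρ hne => ?_⟩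
  · rw [ht hle trivial trivial, ht' τ hlt]
    simp only [s', dif_pos le_rfl, F.res_self]
  · rw [ht hρ.le trivial trivial, ht' ρ hρ]
    by_cases h : ρ ≤ τ
    · simp only [s', dif_pos h]
      exact s.2 ρ (lt_of_le_of_ne h hne)
    · simp only [s', dif_neg h]

theorem algebraMap_facetForm {τ σ : Δ.Cone} (hf : IsFacet τ.1 σ.1) :
    algebraMap (PolyAlg V) (Alg τ) (linForm (facetForm hf)) = 0 := by
  rw [Fan.algebraMap_apply, pull_linForm]
  have : (facetForm hf).comp (span τ).subtype = 0 := by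
    ext x
    exact (facetForm_eq_zero_iff hf x.1
      (Submodule.span_mono hf.isFaceOf.le x.2)).2 x.2
  rw [this]
  exact map_zero _

theorem smul_mem_rel {τ σ : Δ.Cone} (hf : IsFacet τ.1 σ.1) {s : F.rel τ} {t : F.stalk σ}
    (ht : F.IsExtension (le_iff_isFaceOf.2 hf.isFaceOf) s t) :
    linForm (facetForm hf) • t ∈ F.rel σ := by
  intro ρ hρ
  rw [F.res_smul]
  by_cases h : ρ = τ
  · subst h
    rw [F.smul_def, algebraMap_facetForm, zero_smul]
  · rw [ht.2 ρ hρ h, smul_zero]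

/-- The value `f(h t)|τ` does not depend on the extension `t` of `s`. -/
theorem extension_unique {τ σ : Δ.Cone} (hf : IsFacet τ.1 σ.1) (f : F.rel σ →ₗ[PolyAlg V] Alg σ)
    {s : F.rel τ} {t t' : F.stalk σ}
    (ht : F.IsExtension (le_iff_isFaceOf.2 hf.isFaceOf) s t)
    (ht' : F.IsExtension (le_iff_isFaceOf.2 hf.isFaceOf) s t') :
    resAlg (le_iff_isFaceOf.2 hf.isFaceOf) (f ⟨_, F.smul_mem_rel hf ht⟩) =
      resAlg (le_iff_isFaceOf.2 hf.isFaceOf) (f ⟨_, F.smul_mem_rel hf ht'⟩) := by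
  have hd : t - t' ∈ F.rel σ := by
    intro ρ hρ
    rw [map_sub]
    by_cases h : ρ = τ
    · subst h
      rw [ht.1, ht'.1, sub_self]
    · rw [ht.2 ρ hρ h, ht'.2 ρ hρ h, sub_zero]
  rw [← sub_eq_zero, ← map_sub, ← map_sub]
  have : (⟨_, F.smul_mem_rel hf ht⟩ - ⟨_, F.smul_mem_rel hf ht'⟩ : F.rel σ) =
      linForm (facetForm hf) • ⟨t - t', hd⟩ := by
    ext
    simp [smul_sub]
  rw [this, map_smul, Algebra.smul_def, map_mul, resAlg_algebraMap, algebraMap_facetForm, zero_mul]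

/-- An extension of `s` as in `IsExtension`. -/
def ext {τ σ : Δ.Cone} (hf : IsFacet τ.1 σ.1) (s : F.rel τ) : F.stalk σ :=
  (F.exists_extension hf s).choose

theorem isExtension_ext {τ σ : Δ.Cone} (hf : IsFacet τ.1 σ.1) (s : F.rel τ) :
    F.IsExtension (le_iff_isFaceOf.2 hf.isFaceOf) s (F.ext hf s) :=
  (F.exists_extension hf s).choose_spec

/-- The map `φ_h : Hom(F_(σ,∂σ), A_σ) → Hom(F_(τ,∂τ), A_τ)` for `h = facetForm`: the image of `f`
sends `s` to `f(h t)|τ`, where `t ∈ F_σ` extends `s` and vanishes on the other facets. -/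
def facetHom {τ σ : Δ.Cone} (hf : IsFacet τ.1 σ.1) :
    (F.rel σ →ₗ[PolyAlg V] Alg σ) →ₗ[PolyAlg V] (F.rel τ →ₗ[PolyAlg V] Alg τ) where
  toFun f :=
    { toFun := fun s => resAlg (le_iff_isFaceOf.2 hf.isFaceOf)
        (f ⟨_, F.smul_mem_rel hf (F.isExtension_ext hf s)⟩)
      map_add' := fun s s' => by
        have h1 := F.isExtension_ext hf s
        have h2 := F.isExtension_ext hf s'
        have h3 : F.IsExtension (le_iff_isFaceOf.2 hf.isFaceOf) (s + s')
            (F.ext hf s + F.ext hf s') :=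
          ⟨by rw [map_add, h1.1, h2.1]; rfl,
            fun ρ hρ h => by rw [map_add, h1.2 ρ hρ h, h2.2 ρ hρ h, add_zero]⟩
        rw [F.extension_unique hf f (F.isExtension_ext hf (s + s')) h3, ← map_add, ← map_add]
        congr 2
        ext
        simp [smul_add]
      map_smul' := fun a s => by
        have h1 := F.isExtension_ext hf s
        have h3 : F.IsExtension (le_iff_isFaceOf.2 hf.isFaceOf) (a • s) (a • F.ext hf s) :=
          ⟨by rw [F.res_smul, h1.1]; rfl,
            fun ρ hρ h => by rw [F.res_smul, h1.2 ρ hρ h, smul_zero]⟩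
        rw [F.extension_unique hf f (F.isExtension_ext hf (a • s)) h3, RingHom.id_apply,
          Algebra.smul_def, ← resAlg_algebraMap (le_iff_isFaceOf.2 hf.isFaceOf), ← map_mul,
          ← Algebra.smul_def, ← map_smul]
        congr 2
        ext
        simp [smul_comm a] }
  map_add' f g := by
    ext s
    simp
  map_smul' a f := by
    ext s
    simp [Algebra.smul_def, resAlg_algebraMap]

variable (o : Δ.Oriented)

/-- The transition coefficient: `1` if `ψ_h` maps the orientation of `σ` to that of the facet `τ`,
and `-1` otherwise. -/
def transition {τ σ : Δ.Cone} (hf : IsFacet τ.1 σ.1) : ℤ :=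
  open Classical in
  if SameRay ℝ (facetDet hf (o.or σ).someVector) (o.or τ).someVector then 1 else -1

/-- The restriction homomorphism `(DF)_σ → (DF)_τ` of the dual sheaf for a facet `τ` of `σ`. -/
def dualRes {τ σ : Δ.Cone} (hf : IsFacet τ.1 σ.1) : F.DualStalk σ →ₗ[PolyAlg V] F.DualStalk τ :=
  transition o hf • AlgebraTensorModule.map (F.facetHom hf) (facetDet hf)

/-- The module `(DF)_(Δ,Λ)` of the sections over `Δ` of the dual sheaf that vanish on `Λ`; in
particular, `(DF)_Δ` is obtained for `Λ = ∅`. The restriction homomorphisms of the dual sheaf are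
the compositions of those for facets along flags, so that a family is compatible if and only if it
is compatible for facets. -/
def dualSections (Λ : Set Δ.Cone) : Submodule (PolyAlg V) (∀ σ, F.DualStalk σ) where
  carrier := {ψ | (∀ (τ σ : Δ.Cone) (hf : IsFacet τ.1 σ.1), F.dualRes o hf (ψ σ) = ψ τ) ∧
    ∀ σ ∈ Λ, ψ σ = 0}
  add_mem' := by
    rintro s t ⟨hs, hs'⟩ ⟨ht, ht'⟩
    refine ⟨fun τ σ hf => ?_, fun σ hσ => ?_⟩
    · rw [Pi.add_apply, Pi.add_apply, map_add, hs τ σ hf, ht τ σ hf]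
    · rw [Pi.add_apply, hs' σ hσ, ht' σ hσ, add_zero]
  zero_mem' := ⟨fun τ σ hf => map_zero _, fun _ _ => rfl⟩
  smul_mem' := by
    rintro a s ⟨hs, hs'⟩
    refine ⟨fun τ σ hf => ?_, fun σ hσ => ?_⟩
    · rw [Pi.smul_apply, Pi.smul_apply, map_smul, hs τ σ hf]
    · rw [Pi.smul_apply, hs' σ hσ, smul_zero]

end PureSheaf

end FanDuality

end

/-! Call the `(n-1)`-cones walls. Choose a volume form on every `V_σ` that represents its
orientation and that is one fixed form of `V` on all `n`-cones (`VolumeForms`). Each determinant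
line then has a generator, and a section of the dual sheaf becomes a family of homomorphisms `g_σ :
F_(σ,∂σ) → A_σ`. Restriction to a facet becomes `s ↦ g_σ(h š)|τ`, where `h` is the facet form
rescaled by a positive factor so that all signs disappear (`dualRes_tmul`). The orientations survive
in two facts: the normalised forms of a wall in its two `n`-cones are opposite (`facetForm_eq_neg`),
and in codimension two they satisfy a relation (`exists_facetForm_eq`) that makes restriction in two
steps independent of the intermediate facet (`redRes_redRes`).

Let `Λ` be `∂Δ` or empty, and let `w` be the product of one linear form for each hyperplane spanned
by a wall. Multiplication by `w` maps `F_(Δ,Λ)` into `F_(Δ,Δ^{≤n-1})`. As `A` is a domain, a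
homomorphism on `F_(Δ,Λ)` is determined by its restriction `f` to the smaller module, and a given
`f` extends exactly when `w` divides `f(w s)` for all `s`. Thus the sections of the dual sheaf and
the homomorphisms on `F_(Δ,Λ)` both embed into `Hom(F_(Δ,Δ^{≤n-1}), A) ⊗ det V^*`, and it has to be
shown that the images agree (`exists_duality_equiv`).

A compatible family gives a homomorphism (`IsCompatible.exists_hom`): the factors of `w` are
pairwise non-associated primes, so divisibility is tested on one hyperplane at a time. There the
contributions of the two `n`-cones at an interior wall are residues that cancel, and the
contribution at a boundary wall is zero because `s` or `g` vanishes on it.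

A homomorphism `φ` gives a compatible family (`exists_isCompatible_of_hom`): a section on a wall `τ
∉ Λ` extends by flabbiness to a section `T` over `Δ` that vanishes on the other cones of dimension
less than `n`. With `h` an equation of `τ`, `φ(h T) = h φ(T)` vanishes on `τ`; this residue formula
(`sum_resAlg_eq_zero`) says that the restrictions from the two sides of an interior wall agree, and
that the restriction to a boundary wall outside `Λ` is zero. The values on the smaller cones are
then forced, and they are well defined since in a normal fan any two covers of a cone of codimension
at least two are linked through cones of one further dimension (`cover_connected`). Degrees are
compared by multiplying with the homogeneous element `w`. -/

noncomputable section

open Module TensorProduct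

namespace FanDuality

/-! ### Polyhedral cones -/

section Polyhedral

variable {V : Type u} [AddCommGroup V] [Module ℝ V]

/-- **The Farkas lemma** for finite families of vectors. -/
theorem farkas {n : ℕ} (v : Fin n → V) (x : V) :
    (∃ c : Fin n → ℝ, (∀ i, 0 ≤ c i) ∧ x = ∑ i, c i • v i) ∨
      ∃ g : Dual ℝ V, (∀ i, 0 ≤ g (v i)) ∧ g x < 0 := by
  induction n generalizing x with
  | zero =>
    by_cases hx : x = 0
    · exact Or.inl ⟨0, fun _ => le_rfl, by simpa using hx⟩
    · right
      obtain ⟨g, hg⟩ : ∃ g : Dual ℝ V, g x ≠ 0 := by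
        by_contra! h
        exact hx ((Module.forall_dual_apply_eq_zero_iff ℝ x).1 h)
      rcases lt_or_gt_of_ne hg with h | h
      · exact ⟨g, fun i => i.elim0, h⟩
      · exact ⟨-g, fun i => i.elim0, by simpa using h⟩
  | succ n ih =>
    rcases ih (fun i => v i.succ) x with ⟨c, hc, hx⟩ | ⟨g, hg, hgx⟩
    · refine Or.inl ⟨Fin.cons 0 c, fun i => ?_, ?_⟩
      · refine Fin.cases ?_ (fun i => ?_) i
        · simp
        · simpa using hc i
      · simp [Fin.sum_univ_succ, hx]
    · by_cases h0 : 0 ≤ g (v 0)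
      · exact Or.inr ⟨g, fun i => Fin.cases h0 hg i, hgx⟩
      · push Not at h0
        -- Both `g x` and `g (v 0)` are negative here. All vectors are projected along `v 0` to the
        -- kernel of `g`. A positive combination there lifts because `x` needs a positive multiple
        -- of `v 0` and the other vectors non-positive ones; a separating form there is composed
        -- with the projection.
        rcases ih (fun i => v i.succ - (g (v i.succ) / g (v 0)) • v 0)
            (x - (g x / g (v 0)) • v 0) with ⟨c, hc, hx⟩ | ⟨g', hg', hgx'⟩
        · left
          refine ⟨Fin.cons (g x / g (v 0) - ∑ i, c i * (g (v i.succ) / g (v 0))) c,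
            fun i => ?_, ?_⟩
          · refine Fin.cases ?_ (fun i => ?_) i
            · have h1 : 0 ≤ g x / g (v 0) := (div_pos_of_neg_of_neg hgx h0).le
              have h2 : ∑ i, c i * (g (v i.succ) / g (v 0)) ≤ 0 :=
                Finset.sum_nonpos fun i _ => mul_nonpos_of_nonneg_of_nonpos (hc i)
                  (div_nonpos_of_nonneg_of_nonpos (hg i) h0.le)
              simp only [Fin.cons_zero]
              linarith
            · simpa using hc i
          · rw [sub_eq_iff_eq_add] at hx
            refine hx.trans ?_
            rw [Fin.sum_univ_succ]
            simp only [Fin.cons_zero, Fin.cons_succ, smul_sub, Finset.sum_sub_distrib, sub_smul,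
              Finset.sum_smul, smul_smul]
            abel
        · right
          refine ⟨g' - (g' (v 0) / g (v 0)) • g, fun i => ?_, ?_⟩
          · refine Fin.cases ?_ (fun i => ?_) i
            · simp [div_mul_cancel₀ _ h0.ne]
            · have := hg' i
              simp only [map_sub, map_smul, smul_eq_mul, LinearMap.sub_apply,
                LinearMap.smul_apply] at this ⊢
              convert this using 2
              ring
          · simp only [map_sub, map_smul, smul_eq_mul, LinearMap.sub_apply,
              LinearMap.smul_apply] at hgx' ⊢
            convert hgx' using 2
            ring

theorem nonneg_of_mem_coneSpan {S : Set V} {g : Dual ℝ V} (hg : ∀ x ∈ S, 0 ≤ g x) {x : V}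
    (hx : x ∈ Submodule.span {c : ℝ // 0 ≤ c} S) : 0 ≤ g x := by
  induction hx using Submodule.span_induction with
  | mem x hx => exact hg x hx
  | zero => simp
  | add x y _ _ hx hy => simpa using add_nonneg hx hy
  | smul c x _ hx =>
    have : g (c • x) = (c : ℝ) * g x := map_smul g (c : ℝ) x
    rw [this]
    exact mul_nonneg c.2 hx

/-- **The Farkas lemma** for polyhedral cones. -/
theorem exists_form_of_notMem {σ : PointedCone ℝ V} (hσ : Submodule.FG σ) {x : V} (hx : x ∉ σ) :
    ∃ g : Dual ℝ V, (∀ y ∈ σ, 0 ≤ g y) ∧ g x < 0 := by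
  obtain ⟨S, rfl⟩ := hσ
  rcases farkas (fun i => (S.equivFin.symm i : V)) x with ⟨c, hc, rfl⟩ | ⟨g, hg, hgx⟩
  · refine absurd (Submodule.sum_mem _ fun i _ => ?_) hx
    exact Submodule.smul_mem (Submodule.span {c : ℝ // 0 ≤ c} (S : Set V)) ⟨c i, hc i⟩
      (Submodule.subset_span (S.equivFin.symm i).2)
  · refine ⟨g, fun y hy => nonneg_of_mem_coneSpan (fun z hz => ?_) hy, hgx⟩
    simpa using hg (S.equivFin ⟨z, hz⟩)

/-- The subcone of a cone on which a linear form vanishes. -/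
def zeroFace (σ : PointedCone ℝ V) (g : Dual ℝ V) : PointedCone ℝ V where
  carrier := {x | x ∈ σ ∧ g x = 0}
  add_mem' := fun hx hy => ⟨add_mem hx.1 hy.1, by rw [map_add, hx.2, hy.2, add_zero]⟩
  zero_mem' := ⟨zero_mem _, map_zero _⟩
  smul_mem' := fun c x hx => ⟨Submodule.smul_mem _ c hx.1, by
    have : g (c • x) = (c : ℝ) * g x := map_smul g (c : ℝ) x
    rw [this, hx.2, mul_zero]⟩

theorem zeroFace_isFaceOf {σ : PointedCone ℝ V} {g : Dual ℝ V} (hg : ∀ x ∈ σ, 0 ≤ g x) :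
    (zeroFace σ g).IsFaceOf σ := by
  refine PointedCone.IsFaceOf.of_mem_of_add_mem_left (fun x hx => hx.1) fun {x y} hx hy hxy => ?_
  refine ⟨hx, ?_⟩
  have h1 := hg x hx
  have h2 := hg y hy
  have h3 : g x + g y = 0 := by rw [← map_add]; exact hxy.2
  linarith

/-- A facet is a proper face. -/
theorem IsFacet.exists_notMem {τ σ : PointedCone ℝ V} (hf : IsFacet τ σ) : ∃ p ∈ σ, p ∉ τ := by
  by_contra! hc
  have h1 : linSpan τ = linSpan σ :=
    le_antisymm (Submodule.span_mono hf.isFaceOf.le) (Submodule.span_mono hc)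
  have h2 := hf.dim_eq
  have h3 : coneDim τ = coneDim σ := congrArg (fun S : Submodule ℝ V => finrank ℝ S) h1
  omega

variable [FiniteDimensional ℝ V]

/-- As `g` is not zero on `V_σ`, its kernel there has codimension one; it contains `V_τ`, so the two
agree. -/
theorem eq_zero_iff_of_codim_one {τ σ : PointedCone ℝ V} {g : Dual ℝ V} {x : V}
    (hle : τ ≤ σ) (hx : x ∈ linSpan σ) (hgx : g x ≠ 0) (hτ : ∀ y ∈ τ, g y = 0)
    (hd : coneDim σ = coneDim τ + 1) :
    ∀ y ∈ linSpan σ, g y = 0 ↔ y ∈ linSpan τ := by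
  have h1 : linSpan τ ≤ LinearMap.ker g := Submodule.span_le.2 hτ
  have h2 : linSpan τ = linSpan σ ⊓ LinearMap.ker g := by
    refine Submodule.eq_of_le_of_finrank_le (le_inf (Submodule.span_mono hle) h1) ?_
    have hlt : linSpan σ ⊓ LinearMap.ker g < linSpan σ :=
      lt_of_le_of_ne inf_le_left fun h => hgx (by
        have : x ∈ linSpan σ ⊓ LinearMap.ker g := by rw [h]; exact hx
        exact this.2)
    have := Submodule.finrank_lt_finrank_of_lt hlt
    simp only [coneDim] at hd
    omega
  intro y hy
  rw [h2]
  exact ⟨fun h => ⟨hy, h⟩, fun h => h.2⟩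

/-- If a linear form is non-negative on a polyhedral cone `σ` and negative at a point `x` of its
linear span, then there is a facet of `σ` that contains the zeros of the form in `σ` and whose
defining form is also negative at `x`. -/
theorem exists_facet_of_form {σ : PointedCone ℝ V} (hσ : Submodule.FG σ) {x : V}
    (hx : x ∈ linSpan σ) {g : Dual ℝ V} (hg : ∀ y ∈ σ, 0 ≤ g y) (hgx : g x < 0) :
    ∃ τ : PointedCone ℝ V, IsFacet τ σ ∧ (∀ y ∈ σ, g y = 0 → y ∈ τ) ∧
      ∃ g' : Dual ℝ V, (∀ y ∈ σ, 0 ≤ g' y) ∧ (∀ y ∈ linSpan σ, g' y = 0 ↔ y ∈ linSpan τ) ∧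
        g' x < 0 := by
  obtain ⟨k, hk⟩ : ∃ k, coneDim σ ≤ coneDim (zeroFace σ g) + k := ⟨coneDim σ, by omega⟩
  induction k generalizing g with
  | zero =>
    exfalso
    have h1 : linSpan (zeroFace σ g) = linSpan σ :=
      Submodule.eq_of_le_of_finrank_le (Submodule.span_mono (zeroFace_isFaceOf hg).le) hk
    have h2 : linSpan (zeroFace σ g) ≤ LinearMap.ker g := Submodule.span_le.2 fun y hy => hy.2
    exact hgx.ne (h2 (h1 ▸ hx))
  | succ k ih =>
    by_cases hd : coneDim σ ≤ coneDim (zeroFace σ g) + 1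
    · have hle := (zeroFace_isFaceOf hg).le
      have hdim : coneDim σ = coneDim (zeroFace σ g) + 1 := by
        refine le_antisymm hd (Submodule.finrank_lt_finrank_of_lt
          (lt_of_le_of_ne (Submodule.span_mono hle) fun h => ?_))
        have h2 : linSpan (zeroFace σ g) ≤ LinearMap.ker g := Submodule.span_le.2 fun y hy => hy.2
        exact hgx.ne (h2 (h ▸ hx))
      exact ⟨zeroFace σ g, ⟨zeroFace_isFaceOf hg, hdim⟩, fun y hy h => ⟨hy, h⟩, g, hg,
        eq_zero_iff_of_codim_one hle hx hgx.ne (fun y hy => hy.2) hdim, hgx⟩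
    push Not at hd
    -- The zero face is too small to be a facet, so `g` is tilted by a form `q` that vanishes on
    -- this face and at `x`: the zeros of `g` are kept, and so is its value at `x`.
    set U := linSpan (zeroFace σ g) ⊔ Submodule.span ℝ {x} with hU
    have hUσ : ∃ v ∈ σ, v ∉ U := by
      by_contra! hc
      have h1 : linSpan σ ≤ U := Submodule.span_le.2 hc
      have h2 := Submodule.finrank_mono h1
      have h3 := Submodule.finrank_add_le_finrank_add_finrank (linSpan (zeroFace σ g))
        (Submodule.span ℝ {x})
      have h4 := finrank_span_le_card (R := ℝ) ({x} : Set V)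
      simp only [Set.toFinset_singleton, Finset.card_singleton] at h4
      rw [← hU] at h3
      simp only [coneDim] at hd
      omega
    obtain ⟨v, hv, hvU⟩ := hUσ
    obtain ⟨q, hqv, hqU⟩ : ∃ q : Dual ℝ V, 0 < q v ∧ ∀ y ∈ U, q y = 0 := by
      obtain ⟨q, hqv, hq⟩ := Submodule.exists_dual_map_eq_bot_of_notMem hvU inferInstance
      have hq' : ∀ y ∈ U, q y = 0 := fun y hy => by
        have : q y ∈ U.map q := Submodule.mem_map_of_mem hy
        rwa [hq, Submodule.mem_bot] at this
      rcases lt_or_gt_of_ne hqv with h | h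
      · exact ⟨-q, by simpa using h, fun y hy => by simpa using hq' y hy⟩
      · exact ⟨q, h, hq'⟩
    obtain ⟨S, hS⟩ := id hσ
    have hSσ : ∀ w ∈ S, w ∈ σ := fun w hw => hS ▸ Submodule.subset_span hw
    have hne : (S.filter fun w => 0 < q w).Nonempty := by
      by_contra hc
      rw [Finset.not_nonempty_iff_eq_empty, Finset.filter_eq_empty_iff] at hc
      have : 0 ≤ (-q) v := nonneg_of_mem_coneSpan (S := (S : Set V))
        (fun w hw => by simpa using hc hw) (hS ▸ hv)
      simp only [LinearMap.neg_apply] at this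
      linarith
    -- The least ratio over the generators with `q > 0` is the largest `t` for which `g - t • q`
    -- stays non-negative on `σ`. The minimiser `w` enters the zero face, whose dimension therefore
    -- grows.
    obtain ⟨w, hw, hmin⟩ := Finset.exists_min_image _ (fun w => g w / q w) hne
    rw [Finset.mem_filter] at hw
    have ht : 0 ≤ g w / q w := div_nonneg (hg w (hSσ w hw.1)) hw.2.le
    set t := g w / q w with htdef
    have hx0 : q x = 0 := hqU x (Submodule.mem_sup_right (Submodule.mem_span_singleton_self x))
    have hz0 : ∀ y ∈ zeroFace σ g, q y = 0 := fun y hy =>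
      hqU y (Submodule.mem_sup_left (Submodule.subset_span hy))
    have hg1 : ∀ y ∈ σ, 0 ≤ (g - t • q) y := by
      intro y hy
      refine nonneg_of_mem_coneSpan (S := (S : Set V)) (fun z hz => ?_) (hS ▸ hy)
      simp only [LinearMap.sub_apply, LinearMap.smul_apply, smul_eq_mul]
      by_cases hqz : 0 < q z
      · have := hmin z (Finset.mem_filter.2 ⟨hz, hqz⟩)
        rw [le_div_iff₀ hqz] at this
        linarith
      · have h1 := hg z (hSσ z hz)
        have h2 : t * q z ≤ 0 := mul_nonpos_of_nonneg_of_nonpos ht (not_lt.1 hqz)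
        linarith
    have hle : zeroFace σ g ≤ zeroFace σ (g - t • q) := fun y hy => ⟨hy.1, by
      simp [hy.2, hz0 y hy]⟩
    have hwm : w ∈ zeroFace σ (g - t • q) := ⟨hSσ w hw.1, by
      simp [htdef, div_mul_cancel₀ _ hw.2.ne']⟩
    have hlt : linSpan (zeroFace σ g) < linSpan (zeroFace σ (g - t • q)) := by
      refine lt_of_le_of_ne (Submodule.span_mono hle) fun h => hw.2.ne' ?_
      exact hqU w (Submodule.mem_sup_left (h ▸ Submodule.subset_span hwm))
    have hlt' := Submodule.finrank_lt_finrank_of_lt hlt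
    obtain ⟨τ, h1, h2, h3⟩ := ih hg1 (by simpa [hx0] using hgx) (by
      simp only [coneDim] at hk ⊢; omega)
    exact ⟨τ, h1, fun y hy h => h2 y hy (hle ⟨hy, h⟩).2, h3⟩

/-- The form defining a facet is unique up to a positive factor. -/
theorem IsFacet.form_unique {τ σ : PointedCone ℝ V} (hf : IsFacet τ σ) {h h' : Dual ℝ V}
    (h1 : ∀ x ∈ σ, 0 ≤ h x) (h2 : ∀ x ∈ linSpan σ, h x = 0 ↔ x ∈ linSpan τ)
    (h1' : ∀ x ∈ σ, 0 ≤ h' x) (h2' : ∀ x ∈ linSpan σ, h' x = 0 ↔ x ∈ linSpan τ) :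
    ∃ c : ℝ, 0 < c ∧ ∀ x ∈ linSpan σ, h' x = c * h x := by
  obtain ⟨p, hp, hpτ⟩ := hf.exists_notMem
  have hpσ : p ∈ linSpan σ := Submodule.subset_span hp
  have hpn : p ∉ linSpan τ := fun h => hpτ (mem_face_of_mem_linSpan hf.isFaceOf hp h)
  have a1 : 0 < h p := lt_of_le_of_ne (h1 p hp) fun h => hpn ((h2 p hpσ).1 h.symm)
  have a2 : 0 < h' p := lt_of_le_of_ne (h1' p hp) fun h => hpn ((h2' p hpσ).1 h.symm)
  refine ⟨h' p / h p, div_pos a2 a1, fun x hx => ?_⟩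
  have hm : x - (h x / h p) • p ∈ linSpan σ :=
    Submodule.sub_mem _ hx (Submodule.smul_mem _ _ hpσ)
  have h0 : h (x - (h x / h p) • p) = 0 := by
    simp [div_mul_cancel₀ _ a1.ne']
  have h0' := (h2' _ hm).2 ((h2 _ hm).1 h0)
  simp only [map_sub, map_smul, smul_eq_mul] at h0'
  rw [sub_eq_zero.1 h0']
  ring

theorem facetForm_pos {τ σ : PointedCone ℝ V} (hf : IsFacet τ σ) {p : V} (hp : p ∈ σ)
    (hpτ : p ∉ τ) : 0 < facetForm hf p :=
  lt_of_le_of_ne (facetForm_nonneg hf p hp) fun h => hpτ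
    (mem_face_of_mem_linSpan hf.isFaceOf hp
      ((facetForm_eq_zero_iff hf p (Submodule.subset_span hp)).1 h.symm))

theorem facetForm_eq_zero {τ σ : PointedCone ℝ V} (hf : IsFacet τ σ) {p : V} (hp : p ∈ linSpan τ) :
    facetForm hf p = 0 :=
  (facetForm_eq_zero_iff hf p (Submodule.span_mono hf.isFaceOf.le hp)).2 hp

/-- A polyhedral cone is cut out in its linear span by the forms defining its facets. -/
theorem mem_of_facetForm_nonneg {σ : PointedCone ℝ V} (hσ : Submodule.FG σ) {x : V}
    (hx : x ∈ linSpan σ) (h : ∀ (τ : PointedCone ℝ V) (hf : IsFacet τ σ), 0 ≤ facetForm hf x) :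
    x ∈ σ := by
  by_contra hc
  obtain ⟨g, hg, hgx⟩ := exists_form_of_notMem hσ hc
  -- A separating form given by the Farkas lemma need not define a facet; tilting yields one that
  -- does, and it is a positive multiple of `facetForm`.
  obtain ⟨τ, hf, -, g', h1, h2, h3⟩ := exists_facet_of_form hσ hx hg hgx
  obtain ⟨c, hc, hg'⟩ := hf.form_unique (facetForm_nonneg hf) (facetForm_eq_zero_iff hf) h1 h2
  rw [hg' x hx] at h3
  exact absurd (mul_nonneg hc.le (h τ hf)) (not_le.2 h3)

/-- A point of a polyhedral cone outside of a face is outside of some facet containing the face. -/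
theorem exists_facet_of_notMem {ρ σ : PointedCone ℝ V} (hσ : Submodule.FG σ)
    (hρ : Submodule.FG ρ) (hf : ρ.IsFaceOf σ) {p : V} (hp : p ∈ σ) (hpρ : p ∉ ρ) :
    ∃ τ : PointedCone ℝ V, IsFacet τ σ ∧ ρ ≤ τ ∧ p ∉ τ := by
  -- Separate `-p` from `σ - ρ`. A form that is non-negative on this cone is non-negative on `σ` and
  -- zero on `ρ`, and here it is positive at `p`.
  have hC : Submodule.FG (σ ⊔ PointedCone.map (-LinearMap.id : V →ₗ[ℝ] V) ρ) :=
    hσ.sup (Submodule.FG.map _ hρ)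
  have hpC : -p ∉ σ ⊔ PointedCone.map (-LinearMap.id : V →ₗ[ℝ] V) ρ := by
    intro h
    obtain ⟨a, ha, b, hb, hab⟩ := Submodule.mem_sup.1 h
    obtain ⟨b, hb, rfl⟩ := PointedCone.mem_map.1 hb
    refine hpρ (hf.mem_of_add_mem_left hp ha ?_)
    have : p + a = b := by
      simp only [LinearMap.neg_apply, LinearMap.id_apply] at hab
      have hp : p = b - a := by rw [← neg_neg p, ← hab]; abel
      rw [hp]; abel
    rwa [this]
  obtain ⟨g, hg, hgx⟩ := exists_form_of_notMem hC hpC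
  have hg1 : ∀ y ∈ σ, 0 ≤ g y := fun y hy => hg y (Submodule.mem_sup_left hy)
  obtain ⟨τ, h1, h2, g', h3, h4, h5⟩ := exists_facet_of_form hσ
    (Submodule.neg_mem _ (Submodule.subset_span hp)) hg1 hgx
  refine ⟨τ, h1, fun y hy => h2 y (hf.le hy) ?_, fun hpτ => ?_⟩
  · have := hg (-y) (Submodule.mem_sup_right (PointedCone.mem_map.2 ⟨y, hy, by simp⟩))
    rw [map_neg] at this
    exact le_antisymm (by linarith) (hg1 y (hf.le hy))
  · rw [map_neg, (h4 p (Submodule.subset_span hp)).2 (Submodule.subset_span hpτ)] at h5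
    simp at h5

end Polyhedral

/-! ### Combinatorics of fans -/

namespace Fan

variable {V : Type u} [AddCommGroup V] [Module ℝ V] [FiniteDimensional ℝ V] {Δ : Fan V}

theorem le_of_isFacet {τ σ : Δ.Cone} (hf : IsFacet τ.1 σ.1) : τ ≤ σ :=
  le_iff_isFaceOf.2 hf.isFaceOf

theorem lt_of_isFacet {τ σ : Δ.Cone} (hf : IsFacet τ.1 σ.1) : τ < σ :=
  lt_of_le_of_ne (le_of_isFacet hf) fun h => by
    have := hf.dim_eq
    rw [h] at this
    omega

theorem isFacet_of_le {τ σ : Δ.Cone} (h : τ ≤ σ) (hd : dim σ = dim τ + 1) : IsFacet τ.1 σ.1 :=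
  ⟨le_iff_isFaceOf.1 h, hd⟩

theorem eq_of_le_of_dim_le {τ σ : Δ.Cone} (h : τ ≤ σ) (hd : dim σ ≤ dim τ) : τ = σ := by
  by_contra hne
  exact absurd (dim_lt (lt_of_le_of_ne h hne)) (not_lt.2 hd)

theorem dim_mono {τ σ : Δ.Cone} (h : τ ≤ σ) : dim τ ≤ dim σ :=
  Submodule.finrank_mono (span_mono h)

theorem mem_of_mem_span {τ σ : Δ.Cone} (h : τ ≤ σ) {x : V} (hx : x ∈ σ.1) (hx' : x ∈ span τ) :
    x ∈ τ.1 :=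
  mem_face_of_mem_linSpan (le_iff_isFaceOf.1 h) hx hx'

theorem eq_of_span_eq {τ τ' σ : Δ.Cone} (h : τ ≤ σ) (h' : τ' ≤ σ) (hs : span τ = span τ') :
    τ = τ' :=
  le_antisymm
    (fun _ hx => mem_of_mem_span h' (h hx) (hs ▸ Submodule.subset_span hx))
    (fun _ hx => mem_of_mem_span h (h' hx) (hs ▸ Submodule.subset_span hx))

/-- The intersection of two cones of a fan. -/
def inter (σ τ : Δ.Cone) : Δ.Cone :=
  ⟨σ.1 ⊓ τ.1, Δ.face_mem σ.1 σ.2 _ (Δ.inter_isFaceOf σ.1 σ.2 τ.1 τ.2)⟩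

theorem inter_le_left (σ τ : Δ.Cone) : inter σ τ ≤ σ := fun _ hx => hx.1

theorem inter_le_right (σ τ : Δ.Cone) : inter σ τ ≤ τ := fun _ hx => hx.2

theorem le_inter {ρ σ τ : Δ.Cone} (h : ρ ≤ σ) (h' : ρ ≤ τ) : ρ ≤ inter σ τ :=
  fun _ hx => ⟨h hx, h' hx⟩

theorem exists_facet_notMem {ρ σ : Δ.Cone} (h : ρ ≤ σ) {p : V} (hp : p ∈ σ.1) (hpρ : p ∉ ρ.1) :
    ∃ τ : Δ.Cone, IsFacet τ.1 σ.1 ∧ ρ ≤ τ ∧ p ∉ τ.1 := by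
  obtain ⟨τ, h1, h2, h3⟩ := exists_facet_of_notMem (Δ.polyhedral σ.1 σ.2) (Δ.polyhedral ρ.1 ρ.2)
    (le_iff_isFaceOf.1 h) hp hpρ
  exact ⟨⟨τ, Δ.face_mem σ.1 σ.2 τ h1.isFaceOf⟩, h1, h2, h3⟩

/-- A proper face lies in a facet. -/
theorem exists_facet_of_lt {ρ σ : Δ.Cone} (h : ρ < σ) : ∃ τ : Δ.Cone, IsFacet τ.1 σ.1 ∧ ρ ≤ τ := by
  obtain ⟨p, hp, hpρ⟩ := Set.exists_of_ssubset (SetLike.coe_ssubset_coe.2 (Subtype.coe_lt_coe.2 h))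
  obtain ⟨τ, h1, h2, -⟩ := exists_facet_notMem h.le hp hpρ
  exact ⟨τ, h1, h2⟩

/-- A proper face of a facet lies in another facet. -/
theorem exists_other_facet {ρ τ σ : Δ.Cone} (h : ρ < τ) (hf : IsFacet τ.1 σ.1) :
    ∃ τ' : Δ.Cone, IsFacet τ'.1 σ.1 ∧ ρ ≤ τ' ∧ τ' ≠ τ := by
  obtain ⟨p, hp, hpρ⟩ := Set.exists_of_ssubset (SetLike.coe_ssubset_coe.2 (Subtype.coe_lt_coe.2 h))
  obtain ⟨τ', h1, h2, h3⟩ := exists_facet_notMem (h.le.trans (le_of_isFacet hf))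
    (le_of_isFacet hf hp) hpρ
  exact ⟨τ', h1, h2, fun he => h3 (he ▸ hp)⟩

/-- Above a proper face of a cone there is a face of the cone of one dimension more. -/
theorem exists_cover_le {ρ δ : Δ.Cone} (h : ρ < δ) : ∃ c : Δ.Cone, IsFacet ρ.1 c.1 ∧ c ≤ δ := by
  induction hd : dim δ using Nat.strong_induction_on generalizing δ with
  | _ d ih =>
    obtain ⟨τ, h1, h2⟩ := exists_facet_of_lt h
    rcases eq_or_lt_of_le h2 with rfl | h3
    · exact ⟨δ, h1, le_rfl⟩
    · obtain ⟨c, h4, h5⟩ := ih (dim τ) (hd ▸ dim_lt (lt_of_isFacet h1)) h3 rfl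
      exact ⟨c, h4, h5.trans (le_of_isFacet h1)⟩

/-- Between a cone and a face of codimension two there are at most two further cones. -/
theorem eq_or_eq_of_between {ρ τ₁ τ₂ γ τ : Δ.Cone} (h₁ : IsFacet ρ.1 τ₁.1) (h₂ : IsFacet ρ.1 τ₂.1)
    (h₁' : IsFacet τ₁.1 γ.1) (h₂' : IsFacet τ₂.1 γ.1) (hne : τ₁ ≠ τ₂) (hρ : ρ < τ) (hγ : τ < γ) :
    τ = τ₁ ∨ τ = τ₂ := by
  have d1 : dim τ₁ = dim ρ + 1 := h₁.dim_eq
  have d2 : dim τ₂ = dim ρ + 1 := h₂.dim_eq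
  have d3 : dim γ = dim τ₁ + 1 := h₁'.dim_eq
  have d4 := dim_lt hρ
  have d5 := dim_lt hγ
  have key : ∀ {τ' : Δ.Cone}, ρ ≤ τ' → dim τ' = dim ρ + 1 → ∀ {x : V}, x ∈ τ.1 → x ∉ ρ.1 →
      x ∈ τ'.1 → τ = τ' := by
    intro τ' hρ' hd x hx hxρ hx'
    have hlt : ρ < inter τ τ' := lt_of_le_of_ne (le_inter hρ.le hρ') fun h => hxρ (by
      rw [h]; exact ⟨hx, hx'⟩)
    have := dim_lt hlt
    have e1 := eq_of_le_of_dim_le (inter_le_left τ τ') (by omega)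
    have e2 := eq_of_le_of_dim_le (inter_le_right τ τ') (by omega)
    exact e1.symm.trans e2
  obtain ⟨w, hw, hwρ⟩ := Set.exists_of_ssubset (SetLike.coe_ssubset_coe.2 (Subtype.coe_lt_coe.2 hρ))
  obtain ⟨w₁, hw₁, hw₁ρ⟩ := h₁.exists_notMem
  obtain ⟨w₂, hw₂, hw₂ρ⟩ := h₂.exists_notMem
  by_contra! hc
  have hwγ := hγ.le hw
  have n1 : w ∉ τ₁.1 := fun h => hc.1 (key (le_of_isFacet h₁) d1 hw hwρ h)
  have n2 : w ∉ τ₂.1 := fun h => hc.2 (key (le_of_isFacet h₂) d2 hw hwρ h)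
  have m12 : w₁ ∉ τ₂.1 := fun h => by
    have hlt : ρ < inter τ₁ τ₂ := lt_of_le_of_ne (le_inter (le_of_isFacet h₁) (le_of_isFacet h₂))
      fun he => hw₁ρ (by rw [he]; exact ⟨hw₁, h⟩)
    have := dim_lt hlt
    exact hne ((eq_of_le_of_dim_le (inter_le_left τ₁ τ₂) (by omega)).symm.trans
      (eq_of_le_of_dim_le (inter_le_right τ₁ τ₂) (by omega)))
  have m21 : w₂ ∉ τ₁.1 := fun h => by
    have hlt : ρ < inter τ₁ τ₂ := lt_of_le_of_ne (le_inter (le_of_isFacet h₁) (le_of_isFacet h₂))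
      fun he => hw₂ρ (by rw [he]; exact ⟨h, hw₂⟩)
    have := dim_lt hlt
    exact hne ((eq_of_le_of_dim_le (inter_le_left τ₁ τ₂) (by omega)).symm.trans
      (eq_of_le_of_dim_le (inter_le_right τ₁ τ₂) (by omega)))
  have p1 := facetForm_pos h₁' hwγ n1
  have p2 := facetForm_pos h₂' hwγ n2
  have p3 := facetForm_pos h₁' (le_of_isFacet h₂' hw₂) m21
  have p4 := facetForm_pos h₂' (le_of_isFacet h₁' hw₁) m12
  have z1 : facetForm h₁' w₁ = 0 := facetForm_eq_zero h₁' (Submodule.subset_span hw₁)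
  have z2 : facetForm h₂' w₂ = 0 := facetForm_eq_zero h₂' (Submodule.subset_span hw₂)
  -- The coefficients make both facet forms of `γ` agree on `w` and `a • w₁ + b • w₂`.
  set a := facetForm h₂' w / facetForm h₂' w₁ with ha
  set b := facetForm h₁' w / facetForm h₁' w₂ with hb
  have ha0 : 0 < a := div_pos p2 p4
  have hb0 : 0 < b := div_pos p1 p3
  -- the difference of `w` and `a w₁ + b w₂` lies in the linear span of `ρ`
  have hz : w - (a • w₁ + b • w₂) ∈ span γ := by
    refine Submodule.sub_mem _ (Submodule.subset_span hwγ) (Submodule.add_mem _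
      (Submodule.smul_mem _ _ (Submodule.subset_span (le_of_isFacet h₁' hw₁)))
      (Submodule.smul_mem _ _ (Submodule.subset_span (le_of_isFacet h₂' hw₂))))
  have hz1 : w - (a • w₁ + b • w₂) ∈ span τ₁ := by
    refine (facetForm_eq_zero_iff h₁' _ hz).1 ?_
    simp [z1, hb, div_mul_cancel₀ _ p3.ne']
  have hz2 : facetForm h₂' (w - (a • w₁ + b • w₂)) = 0 := by
    simp [z2, ha, div_mul_cancel₀ _ p4.ne']
  have hzρ : w - (a • w₁ + b • w₂) ∈ span ρ := by
    refine (eq_zero_iff_of_codim_one (g := facetForm h₂') (x := w₁) (le_of_isFacet h₁)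
      (Submodule.subset_span hw₁) p4.ne' (fun y hy => ?_) h₁.dim_eq _ hz1).1 hz2
    exact facetForm_eq_zero h₂' (Submodule.subset_span (le_of_isFacet h₂ hy))
  obtain ⟨x, hx, y, hy, hxy⟩ := exists_sub_of_mem_linSpan ρ.1 hzρ
  -- Up to elements of `ρ`, `w` is a positive combination of `w₁` and `w₂`. As `τ` is a face of `γ`,
  -- it contains the summand `a • w₁`, a point of `τ₁` outside of `ρ`.
  have hsum : a • w₁ + (b • w₂ + x) ∈ τ.1 := by
    have : a • w₁ + (b • w₂ + x) = w + y := by rw [← hxy]; abel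
    rw [this]
    exact add_mem hw (hρ.le hy)
  have hτγ := le_iff_isFaceOf.1 hγ.le
  have q1 : a • w₁ ∈ τ.1 := hτγ.mem_of_add_mem_left
    (γ.1.smul_mem ha0.le (le_of_isFacet h₁' hw₁))
    (add_mem (γ.1.smul_mem hb0.le (le_of_isFacet h₂' hw₂)) (hρ.le.trans hγ.le hx)) hsum
  refine hc.1 (key (le_of_isFacet h₁) d1 q1 (fun h => hw₁ρ ?_) (τ₁.1.smul_mem ha0.le hw₁))
  have := ρ.1.smul_mem (inv_nonneg.2 ha0.le) h
  rwa [smul_smul, inv_mul_cancel₀ ha0.ne', one_smul] at this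

/-- A face contains a point that lies on no facets but those that contain the face. -/
theorem exists_generic_point {ρ γ : Δ.Cone} (h : ρ ≤ γ) :
    ∃ q ∈ ρ.1, ∀ (τ : Δ.Cone) (hf : IsFacet τ.1 γ.1), ¬ ρ ≤ τ → 0 < facetForm hf q := by
  classical
  have : ∀ τ : Δ.Cone, ∃ q ∈ ρ.1, ¬ ρ ≤ τ → q ∉ τ.1 := fun τ => by
    by_cases hτ : ρ ≤ τ
    · exact ⟨0, zero_mem _, fun h => absurd hτ h⟩
    · obtain ⟨q, hq, hq'⟩ := Set.not_subset.1 hτ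
      exact ⟨q, hq, fun _ => hq'⟩
  choose q hq hq' using this
  refine ⟨∑ τ, q τ, Submodule.sum_mem _ fun τ _ => hq τ, fun τ hf hτ => ?_⟩
  rw [map_sum]
  exact Finset.sum_pos' (fun τ' _ => facetForm_nonneg hf _ (h (hq τ')))
    ⟨τ, Finset.mem_univ _, facetForm_pos hf (h (hq τ)) (hq' τ hτ)⟩

/-- Near a generic point of a face `ρ` of `γ`, the cone `γ` is cut out by the facets that
contain `ρ`. -/
theorem exists_add_smul_mem {ρ γ : Δ.Cone} {q : V} (hq : q ∈ γ.1)
    (hq' : ∀ (τ : Δ.Cone) (hf : IsFacet τ.1 γ.1), ¬ ρ ≤ τ → 0 < facetForm hf q) {y : V}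
    (hy : y ∈ span γ)
    (hy' : ∀ (τ : Δ.Cone) (hf : IsFacet τ.1 γ.1), ρ ≤ τ → 0 ≤ facetForm hf y) :
    ∃ M : ℝ, 0 ≤ M ∧ y + M • q ∈ γ.1 := by
  classical
  -- For a facet that does not contain `ρ`, this is the multiple of `q` that compensates a negative
  -- value at `y`. For the other facets only its non-negativity matters.
  let m : Δ.Cone → ℝ := fun τ =>
    if hf : IsFacet τ.1 γ.1 then |facetForm hf y| / facetForm hf q else 0
  have hm : ∀ τ, 0 ≤ m τ := fun τ => by
    by_cases hf : IsFacet τ.1 γ.1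
    · simp only [m, dif_pos hf]
      exact div_nonneg (abs_nonneg _) (facetForm_nonneg hf q hq)
    · simp only [m, dif_neg hf, le_refl]
  refine ⟨∑ τ, m τ, Finset.sum_nonneg fun τ _ => hm τ, ?_⟩
  refine mem_of_facetForm_nonneg (Δ.polyhedral γ.1 γ.2)
    (Submodule.add_mem _ hy (Submodule.smul_mem _ _ (Submodule.subset_span hq))) fun τ hf => ?_
  let τ' : Δ.Cone := ⟨τ, Δ.face_mem γ.1 γ.2 τ hf.isFaceOf⟩
  have hf' : IsFacet τ'.1 γ.1 := hf
  rw [map_add, map_smul, smul_eq_mul]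
  have hs : m τ' ≤ ∑ τ, m τ := Finset.single_le_sum (fun τ _ => hm τ) (Finset.mem_univ τ')
  by_cases hρ : ρ ≤ τ'
  · exact add_nonneg (hy' τ' hf' hρ) (mul_nonneg ((hm τ').trans hs) (facetForm_nonneg hf q hq))
  · have hpos := hq' τ' hf' hρ
    have h1 : m τ' = |facetForm hf y| / facetForm hf q := dif_pos hf'
    rw [h1, div_le_iff₀ hpos] at hs
    have := neg_abs_le (facetForm hf y)
    linarith

/-- Two full-dimensional cones with a common facet that lie on the same side of it coincide. -/
theorem eq_of_same_side {τ σ σ' : Δ.Cone} (hσ : dim σ = finrank ℝ V)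
    (hf : IsFacet τ.1 σ.1) (hf' : IsFacet τ.1 σ'.1) {x : V} (hx : x ∈ σ'.1)
    (hpos : 0 < facetForm hf x) : σ = σ' := by
  have hσ' : dim σ' = finrank ℝ V := by
    rw [← hσ]; exact hf'.dim_eq.trans hf.dim_eq.symm
  by_contra hne
  have hτ : τ = inter σ σ' := by
    refine eq_of_le_of_dim_le (le_inter (le_of_isFacet hf) (le_of_isFacet hf')) ?_
    have h1 : inter σ σ' < σ := lt_of_le_of_ne (inter_le_left _ _) fun h =>
      hne (eq_of_le_of_dim_le (h ▸ inter_le_right σ σ') (hσ'.trans hσ.symm).le)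
    have h2 := dim_lt h1
    have h3 : dim σ = dim τ + 1 := hf.dim_eq
    omega
  obtain ⟨q, hq, hq'⟩ := exists_generic_point (le_of_isFacet hf)
  have hxs : x ∈ span σ := by
    have : span σ = ⊤ := Submodule.eq_top_of_finrank_eq hσ
    rw [this]; trivial
  -- The only facet of `σ` containing `τ` is `τ`, so adding a large multiple of a generic point of
  -- `τ` moves `x` into `σ`. The new point lies in `σ` and `σ'`, hence in `τ`, although the form of
  -- `τ` is positive there.
  obtain ⟨M, hM, hmem⟩ := exists_add_smul_mem (le_of_isFacet hf hq) hq' hxs fun τ' hf' hle => by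
    have h1 : τ = τ' := eq_of_le_of_dim_le hle (by
      have h1 : dim σ = dim τ + 1 := hf.dim_eq
      have h2 : dim σ = dim τ' + 1 := hf'.dim_eq
      omega)
    subst h1
    exact hpos.le
  have : x + M • q ∈ (inter σ σ').1 :=
    ⟨hmem, add_mem hx (σ'.1.smul_mem hM (le_of_isFacet hf' hq))⟩
  rw [← hτ] at this
  have h0 := facetForm_eq_zero hf (Submodule.subset_span this)
  rw [map_add, map_smul, facetForm_eq_zero hf (Submodule.subset_span hq), smul_zero,
    add_zero] at h0
  exact hpos.ne' h0

end Fan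

/-! ### Connectedness of the faces around a fixed face -/

/-- If two finite classes of linear forms are given and each class attains the maximum of all forms
somewhere outside of a subspace of codimension at least two, then both classes attain the maximum
at the same point outside of the subspace. -/
theorem exists_common_max {E : Type*} [AddCommGroup E] [Module ℝ E] [FiniteDimensional ℝ E]
    (K : Submodule ℝ E) (hK : finrank ℝ K + 2 ≤ finrank ℝ E) {ι : Type*} [Finite ι]
    (a : ι → Dual ℝ E) (P : ι → Prop) {u₁ u₂ : E} (hu₁ : u₁ ∉ K) (hu₂ : u₂ ∉ K)
    (h₁ : ∃ i, P i ∧ ∀ j, a j u₁ ≤ a i u₁) (h₂ : ∃ i, ¬ P i ∧ ∀ j, a j u₂ ≤ a i u₂) :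
    ∃ u ∉ K, (∃ i, P i ∧ ∀ j, a j u ≤ a i u) ∧ ∃ i, ¬ P i ∧ ∀ j, a j u ≤ a i u := by
  classical
  let : TopologicalSpace E := moduleTopology ℝ E
  have : IsModuleTopology ℝ E := ⟨rfl⟩
  have : IsTopologicalAddGroup E := IsModuleTopology.topologicalAddGroup ℝ E
  have hcodim : 1 < Module.rank ℝ (E ⧸ K) := by
    rw [← finrank_eq_rank]
    have := K.finrank_quotient_add_finrank
    have h : 1 < finrank ℝ (E ⧸ K) := by omega
    exact_mod_cast h
  -- The complement of a subspace of codimension at least two is connected, and it is covered by two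
  -- closed sets according to the class in which the maximum is attained.
  have hconn := (isConnected_compl_of_one_lt_codim hcodim).isPreconnected
  have hclosed : ∀ Q : ι → Prop, IsClosed {u : E | ∃ i, Q i ∧ ∀ j, a j u ≤ a i u} := by
    intro Q
    have : {u : E | ∃ i, Q i ∧ ∀ j, a j u ≤ a i u} =
        ⋃ i, ⋃ (_ : Q i), ⋂ j, {u | a j u ≤ a i u} := by
      ext u; simp
    rw [this]
    refine isClosed_iUnion_of_finite fun i => isClosed_iUnion_of_finite fun _ =>
      isClosed_iInter fun j => isClosed_le ?_ ?_
    · exact IsModuleTopology.continuous_of_linearMap (a j)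
    · exact IsModuleTopology.continuous_of_linearMap (a i)
  have : Nonempty ι := h₁.nonempty
  obtain ⟨u, hu, hu'⟩ := isPreconnected_closed_iff.1 hconn _ _ (hclosed P)
    (hclosed fun i => ¬ P i) (fun u _ => by
      obtain ⟨i, hi⟩ := Finite.exists_max fun i => a i u
      by_cases hP : P i
      · exact Or.inl ⟨i, hP, hi⟩
      · exact Or.inr ⟨i, hP, hi⟩)
    ⟨u₁, hu₁, h₁⟩ ⟨u₂, hu₂, h₂⟩
  exact ⟨u, hu, hu'.1, hu'.2⟩

namespace Fan

variable {V : Type u} [AddCommGroup V] [Module ℝ V] [FiniteDimensional ℝ V] {Δ : Fan V}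

/-- A property of the cones above `ρ` of one dimension more that only depends on the cones above
them of one further dimension is constant on the faces of each cone. -/
theorem cover_connected_in_cone {ρ : Δ.Cone} {P : Δ.Cone → Prop}
    (hP : ∀ τ₁ τ₂ γ : Δ.Cone, IsFacet ρ.1 τ₁.1 → IsFacet ρ.1 τ₂.1 → IsFacet τ₁.1 γ.1 →
      IsFacet τ₂.1 γ.1 → P τ₁ → P τ₂)
    {γ a b : Δ.Cone} (ha : IsFacet ρ.1 a.1) (hb : IsFacet ρ.1 b.1) (haγ : a ≤ γ) (hbγ : b ≤ γ)
    (hPa : P a) : P b := by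
  induction hd : dim γ using Nat.strong_induction_on generalizing γ a b with
  | _ d ih =>
  by_contra hPb
  have da : dim a = dim ρ + 1 := ha.dim_eq
  have db : dim b = dim ρ + 1 := hb.dim_eq
  have hab : a ≠ b := fun h => hPb (h ▸ hPa)
  have haγ' : a < γ := lt_of_le_of_ne haγ fun h => hab
    (h.trans (eq_of_le_of_dim_le hbγ (by rw [← h]; omega)).symm)
  have hbγ' : b < γ := lt_of_le_of_ne hbγ fun h => hab
    ((eq_of_le_of_dim_le haγ (by rw [← h]; omega)).trans h.symm)
  have d1 := dim_lt haγ'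
  by_cases d2 : dim γ = dim ρ + 2
  · exact hPb (hP a b γ ha hb (isFacet_of_le haγ (by omega)) (isFacet_of_le hbγ (by omega)) hPa)
  have d3 : dim ρ + 3 ≤ dim γ := by omega
  have hργ : ρ ≤ γ := (le_of_isFacet ha).trans haγ
  -- `p` is a point of `γ` on no facet, and `q` a point of `ρ` that lies only on the facets
  -- containing `ρ`.
  obtain ⟨p, hp, hp'⟩ := exists_generic_point (le_refl γ)
  obtain ⟨q, hq, hq'⟩ := exists_generic_point hργ
  have hpos : ∀ (τ : Δ.Cone) (hf : IsFacet τ.1 γ.1), 0 < facetForm hf p := fun τ hf =>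
    hp' τ hf (lt_of_isFacet hf).not_ge
  let ι := {τ : Δ.Cone // IsFacet τ.1 γ.1 ∧ ρ ≤ τ}
  -- The value at `u` is the number `t` for which `u + t • p` lies on the hyperplane of the facet.
  -- At the maximum over all facets through `ρ`, the point `u + t • p` is in the cone cut out by
  -- them, on exactly those facets that attain the maximum.
  let form : ι → Dual ℝ (span γ) := fun τ =>
    (-(facetForm τ.2.1 p)⁻¹) • (facetForm τ.2.1).comp (span γ).subtype
  have hform : ∀ (τ : ι) (u : span γ), form τ u = -((facetForm τ.2.1 p)⁻¹ * facetForm τ.2.1 u) :=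
    fun τ u => by simp [form]
  let col : ι → Prop := fun τ => ∀ c : Δ.Cone, IsFacet ρ.1 c.1 → c ≤ τ.1 → P c
  -- On `K` all these forms agree, so its points do not distinguish facets. Its codimension is at
  -- least two because `dim γ ≥ dim ρ + 3`.
  let K : Submodule ℝ (span γ) := (span ρ ⊔ Submodule.span ℝ {p}).comap (span γ).subtype
  have hK : finrank ℝ K + 2 ≤ finrank ℝ (span γ) := by
    have h1 : finrank ℝ K ≤ finrank ℝ (span ρ ⊔ Submodule.span ℝ {p} : Submodule ℝ V) := by
      have h2 : finrank ℝ (K.map (span γ).subtype) = finrank ℝ K :=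
        (LinearEquiv.finrank_eq (Submodule.equivMapOfInjective _ (span γ).subtype_injective K)).symm
      rw [← h2]
      exact Submodule.finrank_mono (Submodule.map_comap_le _ _)
    have h3 := Submodule.finrank_add_le_finrank_add_finrank (span ρ) (Submodule.span ℝ {p})
    have h4 := finrank_span_le_card (R := ℝ) ({p} : Set V)
    simp only [Set.toFinset_singleton, Finset.card_singleton] at h4
    have h5 : finrank ℝ (span ρ) + 3 ≤ finrank ℝ (span γ) := d3
    omega
  -- an element of a cover of `ρ` gives a point at which a facet containing it is maximal
  have point : ∀ c : Δ.Cone, IsFacet ρ.1 c.1 → c < γ → ∃ u : span γ, u ∉ K ∧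
      ∃ i : ι, c ≤ i.1 ∧ ∀ j, form j u ≤ form i u := by
    intro c hc hcγ
    obtain ⟨x, hx, hxρ⟩ := hc.exists_notMem
    obtain ⟨τ, hτ, hcτ⟩ := exists_facet_of_lt hcγ
    have h0 : facetForm hτ x = 0 := facetForm_eq_zero hτ (Submodule.subset_span (hcτ hx))
    refine ⟨⟨x, Submodule.subset_span (hcγ.le hx)⟩, fun hxK => ?_,
      ⟨τ, hτ, (le_of_isFacet hc).trans hcτ⟩, hcτ, fun j => ?_⟩
    · obtain ⟨r, hr, y, hy, hxy⟩ := Submodule.mem_sup.1 (show x ∈ _ from hxK)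
      obtain ⟨t, rfl⟩ := Submodule.mem_span_singleton.1 hy
      have hr0 : facetForm hτ r = 0 :=
        facetForm_eq_zero hτ (span_mono ((le_of_isFacet hc).trans hcτ) hr)
      rw [← hxy, map_add, hr0, zero_add, map_smul, smul_eq_mul] at h0
      have ht : t = 0 := (mul_eq_zero.1 h0).resolve_right (hpos τ hτ).ne'
      rw [ht, zero_smul, add_zero] at hxy
      exact hxρ (mem_of_mem_span (le_of_isFacet hc) hx (hxy ▸ hr))
    · rw [hform, hform]
      simp only [h0, mul_zero, neg_zero]
      exact neg_nonpos.2 (mul_nonneg (inv_nonneg.2 (hpos _ j.2.1).le)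
        (facetForm_nonneg j.2.1 _ (hcγ.le hx)))
  obtain ⟨u₁, hu₁, i₁, hi₁, hmax₁⟩ := point a ha haγ'
  obtain ⟨u₂, hu₂, i₂, hi₂, hmax₂⟩ := point b hb hbγ'
  have hcol₁ : col i₁ := fun c hc hci =>
    ih (dim i₁.1) (hd ▸ dim_lt (lt_of_isFacet i₁.2.1)) ha hc hi₁ hci hPa rfl
  have hcol₂ : ¬ col i₂ := fun h => hPb (h b hb hi₂)
  -- By induction `P` is constant on the covers of `ρ` inside one facet, so each facet through `ρ`
  -- has a colour. Connectedness yields a point at which facets of both colours attain the maximum.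
  obtain ⟨u, huK, ⟨i, hi, himax⟩, j, hj, hjmax⟩ := exists_common_max K hK form col hu₁ hu₂
    ⟨i₁, hcol₁, hmax₁⟩ ⟨i₂, hcol₂, hmax₂⟩
  have hval : ∀ k : ι, facetForm k.2.1 ((u : V) + form i u • p) =
      facetForm k.2.1 p * (form i u - form k u) := fun k => by
    rw [map_add, map_smul, smul_eq_mul, hform k u]
    have := (hpos _ k.2.1).ne'
    field_simp
    ring
  have hmem : (u : V) + form i u • p ∈ span γ :=
    Submodule.add_mem _ u.2 (Submodule.smul_mem _ _ (Submodule.subset_span hp))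
  -- A multiple of the generic point `q` takes care of the facets that do not contain `ρ`. The
  -- resulting point of `γ` lies on both facets `i` and `j`.
  obtain ⟨M, hM, hMmem⟩ := exists_add_smul_mem (hργ hq) hq' hmem fun τ hf hρτ => by
    have := hval ⟨τ, hf, hρτ⟩
    rw [this]
    exact mul_nonneg (hpos _ hf).le (sub_nonneg.2 (himax _))
  have hin : ∀ k : ι, form i u = form k u → (u : V) + form i u • p + M • q ∈ k.1.1 := fun k hk => by
    refine mem_of_mem_span (le_of_isFacet k.2.1) hMmem (Submodule.add_mem _ ?_
      (Submodule.smul_mem _ _ (Submodule.subset_span (k.2.2 hq))))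
    refine (facetForm_eq_zero_iff k.2.1 _ hmem).1 ?_
    rw [hval k, hk, sub_self, mul_zero]
  have hi' := hin i rfl
  have hj' := hin j (le_antisymm (hjmax i) (himax j))
  obtain ⟨c, hc, hcj, hPc⟩ : ∃ c : Δ.Cone, IsFacet ρ.1 c.1 ∧ c ≤ j.1 ∧ ¬ P c := by
    simpa [col] using hj
  -- If the facets met only in `ρ`, the common point would put `u` into `K`. Otherwise their
  -- intersection contains a cover of `ρ`, which would have both colours.
  by_cases hint : ρ = inter i.1 j.1
  · have : (u : V) + form i u • p + M • q ∈ ρ.1 := by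
      rw [hint]; exact ⟨hi', hj'⟩
    refine huK (show (u : V) ∈ span ρ ⊔ Submodule.span ℝ {p} from ?_)
    have e : (u : V) = ((u : V) + form i u • p + M • q - M • q) + (-form i u) • p := by
      rw [neg_smul]; abel
    rw [e]
    exact Submodule.add_mem_sup
      (Submodule.sub_mem _ (Submodule.subset_span this)
        (Submodule.smul_mem _ _ (Submodule.subset_span hq)))
      (Submodule.smul_mem _ _ (Submodule.mem_span_singleton_self p))
  · obtain ⟨c', hc', hle⟩ := exists_cover_le (lt_of_le_of_ne (le_inter i.2.2 j.2.2) hint)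
    have hPc' : P c' := hi c' hc' (hle.trans (inter_le_left _ _))
    exact hPc (ih (dim j.1) (hd ▸ dim_lt (lt_of_isFacet j.2.1)) hc' hc
      (hle.trans (inter_le_right _ _)) hcj hPc' rfl)

/-! ### Normal fans -/

/-- If `x ∈ γ` and `y ∈ γ'` have the same image, then `x + b = y + a` with `a` and `b` in `ρ`. This
point lies in `γ ∩ γ'`, a face of `γ`, so its summand `x` does too. -/
theorem le_of_map_mkQ_le {ρ γ γ' : Δ.Cone} (h : ρ ≤ γ) (h' : ρ ≤ γ')
    (hle : γ.1.map (span ρ).mkQ ≤ γ'.1.map (span ρ).mkQ) : γ ≤ γ' := by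
  intro x hx
  obtain ⟨y, hy, hxy⟩ := PointedCone.mem_map.1 (hle (PointedCone.mem_map.2 ⟨x, hx, rfl⟩))
  have hmem : x - y ∈ span ρ := by
    rw [← Submodule.Quotient.mk_eq_zero, Submodule.Quotient.mk_sub, sub_eq_zero]
    exact hxy.symm
  obtain ⟨a, ha, b, hb, hab⟩ := exists_sub_of_mem_linSpan ρ.1 hmem
  have hsum : x + b = y + a := by rw [← hab]; abel
  have hm : x + b ∈ (inter γ γ').1 := ⟨add_mem hx (h hb), by
    rw [hsum]; exact add_mem hy (h' ha)⟩
  exact ((le_iff_isFaceOf.1 (inter_le_left γ γ')).mem_of_add_mem_left hx (h hb) hm).2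

theorem eq_of_map_mkQ_eq {ρ γ γ' : Δ.Cone} (h : ρ ≤ γ) (h' : ρ ≤ γ')
    (he : γ.1.map (span ρ).mkQ = γ'.1.map (span ρ).mkQ) : γ = γ' :=
  le_antisymm (le_of_map_mkQ_le h h' he.le) (le_of_map_mkQ_le h' h he.ge)

/-- The faces of the image of `γ` in `V/V_ρ` are the images of the faces of `γ` that
contain `ρ`. -/
theorem exists_eq_map_of_isFaceOf {ρ γ : Δ.Cone} (h : ρ ≤ γ)
    {δ : PointedCone ℝ (V ⧸ span ρ)} (hδ : δ.IsFaceOf (γ.1.map (span ρ).mkQ)) :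
    ∃ γ' : Δ.Cone, ρ ≤ γ' ∧ γ' ≤ γ ∧ δ = γ'.1.map (span ρ).mkQ := by
  have hle : ∀ x ∈ γ.1, (span ρ).mkQ x ∈ γ.1.map (span ρ).mkQ := fun x hx =>
    PointedCone.mem_map.2 ⟨x, hx, rfl⟩
  -- The preimage of `δ` in `γ` is a face of `γ`, hence a cone of the fan, and it contains `ρ`
  -- because `ρ` maps to zero.
  have hface : (γ.1 ⊓ δ.comap (span ρ).mkQ).IsFaceOf γ.1 := by
    refine PointedCone.IsFaceOf.of_mem_of_add_mem_left (fun x hx => hx.1)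
      fun {x y} hx hy hxy => ⟨hx, ?_⟩
    refine PointedCone.mem_comap.2 (hδ.mem_of_add_mem_left (hle x hx) (hle y hy) ?_)
    rw [← map_add]
    exact PointedCone.mem_comap.1 hxy.2
  refine ⟨⟨_, Δ.face_mem γ.1 γ.2 _ hface⟩, fun x hx => ⟨h hx, ?_⟩, fun x hx => hx.1, ?_⟩
  · refine PointedCone.mem_comap.2 ?_
    have : (span ρ).mkQ x = 0 := (Submodule.Quotient.mk_eq_zero _).2 (Submodule.subset_span hx)
    rw [this]
    exact zero_mem _
  · refine le_antisymm (fun z hz => ?_) fun z hz => ?_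
    · obtain ⟨x, hx, rfl⟩ := PointedCone.mem_map.1 (hδ.le hz)
      exact PointedCone.mem_map.2 ⟨x, ⟨hx, PointedCone.mem_comap.2 hz⟩, rfl⟩
    · obtain ⟨x, hx, rfl⟩ := PointedCone.mem_map.1 hz
      exact PointedCone.mem_comap.1 hx.2

/-- In a normal fan, a property of the cones above `ρ` of one dimension more is constant if it is
the same for any two such cones that are facets of the same cone. -/
theorem cover_connected (hΔ : Δ.IsNormal) {ρ : Δ.Cone} (hρ : dim ρ + 2 ≤ finrank ℝ V)
    {P : Δ.Cone → Prop}
    (hP : ∀ τ₁ τ₂ γ : Δ.Cone, IsFacet ρ.1 τ₁.1 → IsFacet ρ.1 τ₂.1 → IsFacet τ₁.1 γ.1 →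
      IsFacet τ₂.1 γ.1 → P τ₁ → P τ₂)
    {a b : Δ.Cone} (ha : IsFacet ρ.1 a.1) (hb : IsFacet ρ.1 b.1) (hPa : P a) : P b := by
  by_contra hPb
  let S : (Δ.Cone → Prop) → Set (PointedCone ℝ (V ⧸ span ρ)) := fun Q =>
    {δ | ∃ γ : Δ.Cone, ρ ≤ γ ∧ (∀ c : Δ.Cone, IsFacet ρ.1 c.1 → c ≤ γ → Q c) ∧
      δ = γ.1.map (span ρ).mkQ}
  have hface : ∀ Q, ∀ γ ∈ S Q, ∀ δ : PointedCone ℝ (V ⧸ span ρ), δ.IsFaceOf γ → δ ∈ S Q := by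
    rintro Q _ ⟨γ, h1, h2, rfl⟩ δ hδ
    obtain ⟨γ', h3, h4, rfl⟩ := exists_eq_map_of_isFaceOf h1 hδ
    exact ⟨γ', h3, fun c hc hcγ => h2 c hc (hcγ.trans h4), rfl⟩
  have hproper : ∀ (Q : Δ.Cone → Prop) (c : Δ.Cone), IsFacet ρ.1 c.1 → ¬ Q c →
      S Q ≠ transversal ρ := by
    intro Q c hc hQ he
    have : c.1.map (span ρ).mkQ ∈ S Q := by
      rw [he]
      exact ⟨c, le_of_isFacet hc, rfl⟩
    obtain ⟨γ, h1, h2, h3⟩ := this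
    have := eq_of_map_mkQ_eq (le_of_isFacet hc) h1 h3
    exact hQ (h2 c hc this.le)
  -- The images of the cones whose covers of `ρ` all satisfy `P`, and of those for which none does,
  -- form two proper subfans. They exhaust `Δ/ρ` because `P` is constant inside each cone.
  refine hΔ.2 ρ ⟨S P, S fun c => ¬ P c, hface _, hface _, hproper _ b hb hPb,
    hproper _ a ha (fun h => h hPa), ?_, ?_⟩
  · ext δ
    constructor
    · rintro (⟨γ, h1, -, rfl⟩ | ⟨γ, h1, -, rfl⟩) <;> exact ⟨γ, h1, rfl⟩
    · rintro ⟨γ, h1, rfl⟩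
      by_cases hc : ∃ c : Δ.Cone, IsFacet ρ.1 c.1 ∧ c ≤ γ ∧ P c
      · obtain ⟨c, hc, hcγ, hPc⟩ := hc
        exact Or.inl ⟨γ, h1, fun c' hc' hcγ' => cover_connected_in_cone hP hc hc' hcγ hcγ' hPc, rfl⟩
      · push Not at hc
        exact Or.inr ⟨γ, h1, hc, rfl⟩
  · rintro _ ⟨⟨γ, h1, h2, rfl⟩, γ', h1', h2', he⟩
    have := eq_of_map_mkQ_eq h1 h1' he
    subst this
    -- A cone in both parts has no cover of `ρ` as a face, so it is `ρ`, whose image is the origin;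
    -- its codimension is at least two by `hρ`.
    have hγ : ρ = γ := by
      by_contra hne
      obtain ⟨c, hc, hcγ⟩ := exists_cover_le (lt_of_le_of_ne h1 hne)
      exact h2' c hc hcγ (h2 c hc hcγ)
    subst hγ
    have h0 : linSpan (ρ.1.map (span ρ).mkQ) = ⊥ := by
      rw [eq_bot_iff, Submodule.span_le]
      intro z hz
      obtain ⟨x, hx, rfl⟩ := PointedCone.mem_map.1 hz
      exact (Submodule.Quotient.mk_eq_zero _).2 (Submodule.subset_span hx)
    have h1 : coneDim (ρ.1.map (span ρ).mkQ) = 0 := by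
      simp only [coneDim]
      rw [h0, finrank_bot]
    have h2 := (span ρ).finrank_quotient_add_finrank
    have h3 : finrank ℝ (span ρ) + 2 ≤ finrank ℝ V := hρ
    rw [h1]
    omega

end Fan

/-! ### The algebra of polynomial functions -/

section PolyAlg

variable {W W₂ : Type u} [AddCommGroup W] [Module ℝ W] [AddCommGroup W₂] [Module ℝ W₂]

/-- Coordinates on `S(W^*)` given by a basis of `W^*`. -/
def polyEquiv (W : Type u) [AddCommGroup W] [Module ℝ W] :
    PolyAlg W ≃ₐ[ℝ] MvPolynomial (Free.ChooseBasisIndex ℝ (Dual ℝ W)) ℝ :=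
  SymmetricAlgebra.equivMvPolynomial (Free.chooseBasis ℝ (Dual ℝ W))

instance PolyAlg.isDomain : IsDomain (PolyAlg W) :=
  (polyEquiv W).toMulEquiv.isDomain

theorem polyEquiv_linForm_basis (i : Free.ChooseBasisIndex ℝ (Dual ℝ W)) :
    polyEquiv W (linForm (Free.chooseBasis ℝ (Dual ℝ W) i)) = MvPolynomial.X i :=
  SymmetricAlgebra.equivMvPolynomial_ι_apply _ i

theorem linForm_injective : Function.Injective (linForm (W := W)) := by
  have h1 : LinearIndependent ℝ
      (fun i : Free.ChooseBasisIndex ℝ (Dual ℝ W) => (MvPolynomial.X i : MvPolynomial _ ℝ)) :=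
    MvPolynomial.linearIndependent_X _ _
  have h2 : LinearIndependent ℝ
      (((polyEquiv W).toLinearMap ∘ₗ linForm (W := W)) ∘ Free.chooseBasis ℝ (Dual ℝ W)) := by
    convert h1 using 1
    funext i
    exact polyEquiv_linForm_basis i
  have h3 : Function.Injective ((polyEquiv W).toLinearMap ∘ₗ linForm (W := W)) :=
    LinearMap.injective_of_linearIndependent (Free.chooseBasis ℝ (Dual ℝ W)).span_eq h2
  exact fun x y h => h3 (congrArg (polyEquiv W) h)

theorem algHom_eq_of_linForm {B : Type*} [CommRing B] [Algebra ℝ B] {f g : PolyAlg W →ₐ[ℝ] B}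
    (h : ∀ ℓ, f (linForm ℓ) = g (linForm ℓ)) (a : PolyAlg W) : f a = g a := by
  have : f = g := SymmetricAlgebra.algHom_ext (LinearMap.ext h)
  rw [this]

/-- The polynomial functions that vanish on a hyperplane are the multiples of the linear form
defining it. -/
theorem linForm_dvd_iff {U : Submodule ℝ W} {h : Dual ℝ W} (hU : ∀ x, h x = 0 ↔ x ∈ U)
    (a : PolyAlg W) : linForm h ∣ a ↔ pull U.subtype a = 0 := by
  have h0 : pull U.subtype (linForm h) = 0 := by
    rw [pull_linForm]
    have : h.comp U.subtype = 0 := by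
      ext x
      exact (hU x).2 x.2
    rw [this, map_zero]
  constructor
  · rintro ⟨b, rfl⟩
    rw [map_mul, h0, zero_mul]
  intro ha
  -- In this case `U` is the whole space, and the identity factors through its inclusion.
  by_cases hh : h = 0
  · have hs : (U.subtype).comp ((LinearMap.id : W →ₗ[ℝ] W).codRestrict U
        fun x => (hU x).1 (by simp [hh])) = LinearMap.id := by ext; simp
    have := congrArg (pull ((LinearMap.id : W →ₗ[ℝ] W).codRestrict U
      fun x => (hU x).1 (by simp [hh]))) ha
    rw [pull_pull, hs, pull_id, map_zero] at this
    rw [this]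
    exact dvd_zero _
  obtain ⟨v, hv⟩ : ∃ v, h v = 1 := by
    obtain ⟨w, hw⟩ : ∃ w, h w ≠ 0 := by
      by_contra! hc
      exact hh (LinearMap.ext hc)
    exact ⟨(h w)⁻¹ • w, by simp [hw]⟩
  -- Modulo `h`, every polynomial equals its pull-back along the projection to `U`; it suffices to
  -- check linear forms, where `ℓ - ℓ ∘ π = ℓ(v) h`.
  let π : W →ₗ[ℝ] U := (LinearMap.id - h.smulRight v).codRestrict U fun x => (hU _).1 (by simp [hv])
  let q := Ideal.Quotient.mkₐ ℝ (Ideal.span {linForm h})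
  have key : ∀ b, q b = (q.comp (pull (U.subtype.comp π))) b := by
    intro b
    refine algHom_eq_of_linForm (fun ℓ => ?_) b
    change q _ = q (pull _ _)
    rw [pull_linForm, ← sub_eq_zero, ← map_sub]
    refine Ideal.Quotient.eq_zero_iff_mem.2 (Ideal.mem_span_singleton.2 ?_)
    have : linForm ℓ - linForm (ℓ.comp (U.subtype.comp π)) = ℓ v • linForm h := by
      rw [← map_sub, ← map_smul]
      congr 1
      ext x
      simp [π, mul_comm]
    rw [this, Algebra.smul_def]
    exact dvd_mul_left _ _
  have h1 := key a
  change q a = q (pull _ a) at h1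
  rw [← pull_pull, ha, map_zero, map_zero] at h1
  exact Ideal.mem_span_singleton.1 (Ideal.Quotient.eq_zero_iff_mem.1 h1)

theorem linForm_ne_zero {h : Dual ℝ W} (hh : h ≠ 0) : linForm h ≠ 0 := fun h0 =>
  hh (linForm_injective (h0.trans (map_zero _).symm))

/-- The kernel of restriction to the hyperplane is generated by the form, and the target of the
restriction is a domain. -/
theorem linForm_prime {h : Dual ℝ W} (hh : h ≠ 0) : Prime (linForm h) := by
  have key := fun a => linForm_dvd_iff (U := LinearMap.ker h) (h := h) (fun x => Iff.rfl) a
  refine ⟨linForm_ne_zero hh, fun hu => ?_, fun a b hab => ?_⟩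
  · have := (key 1).1 (isUnit_iff_dvd_one.1 hu)
    rw [map_one] at this
    exact one_ne_zero this
  · rw [key, map_mul] at hab
    rcases mul_eq_zero.1 hab with h | h
    · exact Or.inl ((key a).2 h)
    · exact Or.inr ((key b).2 h)

/-- A linear form whose kernel is a given hyperplane. -/
def hyperForm (H : Submodule ℝ W) : Dual ℝ W :=
  open Classical in if h : ∃ h : Dual ℝ W, ∀ x, h x = 0 ↔ x ∈ H then h.choose else 0

theorem hyperForm_eq_zero_iff [FiniteDimensional ℝ W] {H : Submodule ℝ W}
    (hH : finrank ℝ H + 1 = finrank ℝ W) (x : W) : hyperForm H x = 0 ↔ x ∈ H := by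
  have hex : ∃ h : Dual ℝ W, ∀ x, h x = 0 ↔ x ∈ H := by
    obtain ⟨v, hv⟩ : ∃ v, v ∉ H := by
      by_contra! hc
      have : H = ⊤ := eq_top_iff.2 fun x _ => hc x
      rw [this, finrank_top] at hH
      omega
    obtain ⟨h, hhv, hh⟩ := Submodule.exists_dual_map_eq_bot_of_notMem hv inferInstance
    have h1 : H ≤ LinearMap.ker h := by
      rw [LinearMap.le_ker_iff_map, hh]
    have h2 : H = LinearMap.ker h := by
      refine Submodule.eq_of_le_of_finrank_le h1 ?_
      have hlt : LinearMap.ker h < ⊤ := lt_top_iff_ne_top.2 fun ht => hhv (by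
        have : v ∈ LinearMap.ker h := ht ▸ Submodule.mem_top
        exact this)
      have := Submodule.finrank_lt_finrank_of_lt hlt
      rw [finrank_top] at this
      omega
    exact ⟨h, fun x => by rw [h2]; rfl⟩
  rw [hyperForm, dif_pos hex]
  exact hex.choose_spec x

theorem hyperForm_ne_zero [FiniteDimensional ℝ W] {H : Submodule ℝ W}
    (hH : finrank ℝ H + 1 = finrank ℝ W) : hyperForm H ≠ 0 := by
  intro h0
  have : H = ⊤ := eq_top_iff.2 fun x _ => (hyperForm_eq_zero_iff hH x).1 (by simp [h0])
  rw [this, finrank_top] at hH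
  omega

/-- Restricting to `H` shows that the form of `H'` vanishes on `H`. Hence distinct hyperplanes give
non-associated primes. -/
theorem eq_of_linForm_hyperForm_dvd [FiniteDimensional ℝ W] {H H' : Submodule ℝ W}
    (hH : finrank ℝ H + 1 = finrank ℝ W) (hH' : finrank ℝ H' + 1 = finrank ℝ W)
    (h : linForm (hyperForm H) ∣ linForm (hyperForm H')) : H = H' := by
  rw [linForm_dvd_iff (hyperForm_eq_zero_iff hH), pull_linForm, ← map_zero linForm] at h
  refine Submodule.eq_of_le_of_finrank_eq (fun x hx => ?_) (by omega)
  exact (hyperForm_eq_zero_iff hH' x).1 (LinearMap.congr_fun (linForm_injective h) ⟨x, hx⟩)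

/-- After one prime has been divided out of `a`, the remaining ones still divide the quotient, since
none of them divides the removed prime. -/
theorem prod_dvd_of_prime {R ι : Type*} [CommRing R] [IsDomain R] (s : Finset ι) (p : ι → R)
    (hp : ∀ i ∈ s, Prime (p i)) (hne : ∀ i ∈ s, ∀ j ∈ s, p i ∣ p j → i = j) {a : R}
    (ha : ∀ i ∈ s, p i ∣ a) : ∏ i ∈ s, p i ∣ a := by
  classical
  induction s using Finset.induction_on generalizing a with
  | empty => simp
  | insert i s hi ih =>
    obtain ⟨b, rfl⟩ := ha i (Finset.mem_insert_self i s)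
    rw [Finset.prod_insert hi]
    refine mul_dvd_mul_left _ (ih (fun j hj => hp j (Finset.mem_insert_of_mem hj))
      (fun j hj k hk => hne j (Finset.mem_insert_of_mem hj) k (Finset.mem_insert_of_mem hk))
      fun j hj => ?_)
    refine ((hp j (Finset.mem_insert_of_mem hj)).dvd_or_dvd
      (ha j (Finset.mem_insert_of_mem hj))).resolve_left fun h => hi ?_
    rw [← hne j (Finset.mem_insert_of_mem hj) i (Finset.mem_insert_self i s) h]
    exact hj

/-! ### The grading of the algebra of polynomial functions -/

theorem polyDeg_two_mul (m : ℕ) :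
    polyDeg W (2 * m) = LinearMap.range (linForm (W := W)) ^ m := by
  refine le_antisymm (iSup₂_le fun m' h => ?_) (le_iSup₂_of_le m rfl le_rfl)
  have : m' = m := by omega
  rw [this]

theorem exists_of_mem_polyDeg {k : ℤ} {a : PolyAlg W} (ha : a ∈ polyDeg W k) (h0 : a ≠ 0) :
    ∃ m : ℕ, (2 * m : ℤ) = k := by
  by_contra! hc
  have : polyDeg W k = ⊥ := eq_bot_iff.2 (iSup₂_le fun m h => absurd h (hc m))
  rw [this, Submodule.mem_bot] at ha
  exact h0 ha

theorem mul_mem_polyDeg {i j : ℤ} {a b : PolyAlg W} (ha : a ∈ polyDeg W i) (hb : b ∈ polyDeg W j) :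
    a * b ∈ polyDeg W (i + j) := by
  by_cases ha0 : a = 0
  · simp [ha0]
  by_cases hb0 : b = 0
  · simp [hb0]
  obtain ⟨m, rfl⟩ := exists_of_mem_polyDeg ha ha0
  obtain ⟨m', rfl⟩ := exists_of_mem_polyDeg hb hb0
  rw [polyDeg_two_mul] at ha hb
  rw [← mul_add, ← Nat.cast_add, polyDeg_two_mul, pow_add]
  exact Submodule.mul_mem_mul ha hb

theorem linForm_mem_polyDeg (h : Dual ℝ W) : linForm h ∈ polyDeg W 2 := by
  have := polyDeg_two_mul (W := W) 1
  rw [Nat.cast_one, mul_one, pow_one] at this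
  rw [this]
  exact LinearMap.mem_range_self _ h

theorem one_mem_polyDeg : (1 : PolyAlg W) ∈ polyDeg W 0 := by
  have := polyDeg_two_mul (W := W) 0
  rw [Nat.cast_zero, mul_zero, pow_zero] at this
  rw [this]
  exact Submodule.one_le.1 le_rfl

theorem prod_linForm_mem_polyDeg {ι : Type*} (s : Finset ι) (h : ι → Dual ℝ W) :
    ∏ i ∈ s, linForm (h i) ∈ polyDeg W (2 * s.card) := by
  classical
  induction s using Finset.induction_on with
  | empty => simpa using one_mem_polyDeg
  | insert i s hi ih =>
    rw [Finset.prod_insert hi, Finset.card_insert_of_notMem hi]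
    have := mul_mem_polyDeg (linForm_mem_polyDeg (h i)) ih
    convert this using 2
    push_cast
    ring

theorem pull_mem_polyDeg (f : W →ₗ[ℝ] W₂) {k : ℤ} {a : PolyAlg W₂} (ha : a ∈ polyDeg W₂ k) :
    pull f a ∈ polyDeg W k := by
  by_cases h0 : a = 0
  · simp [h0]
  obtain ⟨m, rfl⟩ := exists_of_mem_polyDeg ha h0
  rw [polyDeg_two_mul] at ha ⊢
  have h1 : (LinearMap.range (linForm (W := W₂)) ^ m).map (pull f).toLinearMap ≤
      LinearMap.range (linForm (W := W)) ^ m := by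
    rw [Submodule.map_pow]
    refine pow_le_pow_left' ?_ m
    rintro _ ⟨_, ⟨ℓ, rfl⟩, rfl⟩
    exact ⟨ℓ.comp f, (pull_linForm f ℓ).symm⟩
  exact h1 (Submodule.mem_map_of_mem ha)

/-- Both gradings are given by the powers of the space of linear forms. This makes homogeneous
components of polynomials available. -/
theorem mem_polyDeg_iff_isHomogeneous (m : ℕ) (a : PolyAlg W) :
    a ∈ polyDeg W (2 * m) ↔ (polyEquiv W a).IsHomogeneous m := by
  rw [polyDeg_two_mul, ← MvPolynomial.mem_homogeneousSubmodule,
    ← MvPolynomial.homogeneousSubmodule_one_pow, MvPolynomial.homogeneousSubmodule_one_eq_span_X]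
  have h1 : (LinearMap.range (linForm (W := W))).map (polyEquiv W).toLinearMap =
      Submodule.span ℝ (Set.range MvPolynomial.X) := by
    rw [LinearMap.range_eq_map, ← (Free.chooseBasis ℝ (Dual ℝ W)).span_eq, Submodule.map_span,
      Submodule.map_span]
    congr 1
    rw [← Set.range_comp, ← Set.range_comp]
    congr 1
    funext i
    exact polyEquiv_linForm_basis i
  have h2 : Submodule.map (polyEquiv W).toLinearMap (LinearMap.range (linForm (W := W)) ^ m) =
      Submodule.span ℝ (Set.range MvPolynomial.X) ^ m := by
    rw [← h1]
    exact Submodule.map_pow _ (polyEquiv W).toAlgHom m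
  rw [← h2]
  refine ⟨fun h => Submodule.mem_map_of_mem h, ?_⟩
  rintro ⟨b, hb, hab⟩
  rwa [← (polyEquiv W).injective hab]

/-- Multiplication by `q` shifts homogeneous components by `N`, so a component of `p` in a wrong
degree is annihilated by `q` and vanishes. -/
theorem isHomogeneous_of_mul {κ : Type*} {q p : MvPolynomial κ ℝ} {N D : ℕ}
    (hq : q.IsHomogeneous N) (hq0 : q ≠ 0) (hqp : (q * p).IsHomogeneous D) (hp0 : p ≠ 0) :
    ∃ j, N + j = D ∧ p.IsHomogeneous j := by
  have key : ∀ j, MvPolynomial.homogeneousComponent (N + j) (q * p) =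
      q * MvPolynomial.homogeneousComponent j p := by
    intro j
    conv_lhs => rw [← MvPolynomial.sum_homogeneousComponent p, Finset.mul_sum, map_sum]
    have : ∀ i, MvPolynomial.homogeneousComponent (N + j)
        (q * MvPolynomial.homogeneousComponent i p) =
        if i = j then q * MvPolynomial.homogeneousComponent j p else 0 := by
      intro i
      rw [MvPolynomial.homogeneousComponent_of_mem
        (hq.mul (MvPolynomial.homogeneousComponent_isHomogeneous i p))]
      by_cases hij : i = j
      · simp [hij]
      · simp [hij, Ne.symm hij]
    simp only [this, Finset.sum_ite_eq', Finset.mem_range]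
    split_ifs with h
    · rfl
    · rw [MvPolynomial.homogeneousComponent_eq_zero _ _ (by omega), mul_zero]
  have hcomp : ∀ j, N + j ≠ D → MvPolynomial.homogeneousComponent j p = 0 := by
    intro j hj
    have h1 := key j
    rw [MvPolynomial.homogeneousComponent_of_mem hqp, if_neg hj] at h1
    exact (mul_eq_zero.1 h1.symm).resolve_left hq0
  obtain ⟨j, hj⟩ : ∃ j, N + j = D := by
    by_contra! hc
    apply hp0
    rw [← MvPolynomial.sum_homogeneousComponent p]
    exact Finset.sum_eq_zero fun i _ => hcomp i (hc i)
  refine ⟨j, hj, ?_⟩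
  rw [← MvPolynomial.sum_homogeneousComponent p]
  refine MvPolynomial.IsHomogeneous.sum _ _ _ fun i _ => ?_
  by_cases hij : i = j
  · exact hij ▸ MvPolynomial.homogeneousComponent_isHomogeneous i p
  · rw [hcomp i (by omega)]
    exact MvPolynomial.isHomogeneous_zero _ _ _

/-- Homogeneity can be tested after multiplication by a homogeneous element. -/
theorem mem_polyDeg_of_mul_mem {N : ℕ} {k : ℤ} {g a : PolyAlg W} (hg : g ∈ polyDeg W (2 * N))
    (hg0 : g ≠ 0) (h : g * a ∈ polyDeg W (2 * N + k)) : a ∈ polyDeg W k := by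
  by_cases ha : a = 0
  · simp [ha]
  obtain ⟨D, hD⟩ := exists_of_mem_polyDeg h (mul_ne_zero hg0 ha)
  rw [← hD, mem_polyDeg_iff_isHomogeneous, map_mul] at h
  rw [mem_polyDeg_iff_isHomogeneous] at hg
  obtain ⟨j, hj, hj'⟩ := isHomogeneous_of_mul hg (by simpa using hg0) h (by simpa using ha)
  have : k = 2 * j := by rw [← hj] at hD; push_cast at hD; linarith
  rwa [this, mem_polyDeg_iff_isHomogeneous]

end PolyAlg

open Fan

/-! ### Determinants -/

section Det

variable {W : Type u} [AddCommGroup W] [Module ℝ W] [FiniteDimensional ℝ W]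

/-- The coordinate on the line `det W^*` given by a non-zero element. -/
def detCoord (ω : DetDual W) : DetDual W →ₗ[ℝ] ℝ where
  toFun ω' := ω' (finBasis ℝ W) / ω (finBasis ℝ W)
  map_add' _ _ := add_div _ _ _
  map_smul' _ _ := mul_div_assoc _ _ _

theorem detCoord_self {ω : DetDual W} (hω : ω ≠ 0) : detCoord ω ω = 1 :=
  div_self ((ω.map_basis_ne_zero_iff (finBasis ℝ W)).2 hω)

theorem detCoord_smul {ω : DetDual W} (hω : ω ≠ 0) (ω' : DetDual W) : detCoord ω ω' • ω = ω' := by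
  refine AlternatingMap.ext fun v => ?_
  have h0 := (ω.map_basis_ne_zero_iff (finBasis ℝ W)).2 hω
  rw [AlternatingMap.smul_apply, ω.eq_smul_basis_det (finBasis ℝ W),
    ω'.eq_smul_basis_det (finBasis ℝ W)]
  simp only [detCoord, LinearMap.coe_mk, AddHom.coe_mk, AlternatingMap.smul_apply, smul_eq_mul,
    Basis.det_self, mul_one]
  field_simp

theorem exists_detDual_ne_zero (W : Type u) [AddCommGroup W] [Module ℝ W]
    [FiniteDimensional ℝ W] : ∃ ω : DetDual W, ω ≠ 0 :=
  ⟨(finBasis ℝ W).det, (finBasis ℝ W).det_ne_zero⟩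

theorem apply_ne_zero_of_linearIndependent {ω : DetDual W} (hω : ω ≠ 0)
    {x : Fin (finrank ℝ W) → W} (hx : LinearIndependent ℝ x) : ω x ≠ 0 := by
  have := (ω.map_basis_ne_zero_iff (basisOfLinearIndependentOfCardEqFinrank' x hx (by simp))).2 hω
  rwa [coe_basisOfLinearIndependentOfCardEqFinrank'] at this

variable {H : Type*} [AddCommGroup H] [Module ℝ H]

/-- `det W^*` is a line; a fixed generator thus removes the determinant factor from all tensor
products. -/
theorem exists_eq_tmul {ω : DetDual W} (hω : ω ≠ 0) (x : H ⊗[ℝ] DetDual W) :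
    ∃ f : H, x = f ⊗ₜ ω := by
  induction x using TensorProduct.induction_on with
  | zero => exact ⟨0, (TensorProduct.zero_tmul _ _).symm⟩
  | tmul f ω' =>
    refine ⟨detCoord ω ω' • f, ?_⟩
    rw [TensorProduct.smul_tmul, detCoord_smul hω]
  | add x y hx hy =>
    obtain ⟨f, rfl⟩ := hx
    obtain ⟨g, rfl⟩ := hy
    exact ⟨f + g, (TensorProduct.add_tmul _ _ _).symm⟩

theorem tmul_injective {ω : DetDual W} (hω : ω ≠ 0) {f g : H} (h : f ⊗ₜ[ℝ] ω = g ⊗ₜ ω) :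
    f = g := by
  have := congrArg (fun z => TensorProduct.rid ℝ H (TensorProduct.map LinearMap.id (detCoord ω) z)) h
  simpa [detCoord_self hω] using this

theorem tmul_eq_zero_iff {ω : DetDual W} (hω : ω ≠ 0) {f : H} : f ⊗ₜ[ℝ] ω = 0 ↔ f = 0 :=
  ⟨fun h => tmul_injective hω (by rw [h, TensorProduct.zero_tmul]), fun h => by
    rw [h, TensorProduct.zero_tmul]⟩

/-- Membership in the span of the pure tensors over a subspace of the first factor. -/
theorem tmul_mem_span_iff {ω : DetDual W} (hω : ω ≠ 0) (S : Submodule ℝ H) {f : H} :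
    f ⊗ₜ ω ∈ Submodule.span ℝ {x : H ⊗[ℝ] DetDual W | ∃ g ω', g ∈ S ∧ x = g ⊗ₜ ω'} ↔ f ∈ S := by
  refine ⟨fun h => ?_, fun h => Submodule.subset_span ⟨f, ω, h, rfl⟩⟩
  have key : Submodule.span ℝ {x : H ⊗[ℝ] DetDual W | ∃ g ω', g ∈ S ∧ x = g ⊗ₜ ω'} ≤
      S.comap ((TensorProduct.rid ℝ H).toLinearMap.comp
        (TensorProduct.map LinearMap.id (detCoord ω))) := by
    rw [Submodule.span_le]
    rintro _ ⟨g, ω', hg, rfl⟩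
    simpa using S.smul_mem _ hg
  simpa [detCoord_self hω] using key h

end Det

section FacetDet

variable {V : Type u} [AddCommGroup V] [Module ℝ V] [FiniteDimensional ℝ V]

/-- This is `ω = h ∧ ψ_h(ω)` on vectors: the contraction depends on `v` only through `h v`, because
`v - h(v) v₀` lies in `V_τ` if `h v₀ = 1`. -/
theorem domDomCongr_cons_eq {τ σ : PointedCone ℝ V} (hf : IsFacet τ σ) (ω : DetDual (linSpan σ))
    (v : linSpan σ) (x : Fin (coneDim τ) → linSpan τ) :
    ω.domDomCongr (finCongr hf.dim_eq) (Fin.cons v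
      (Submodule.inclusion (Submodule.span_mono hf.isFaceOf.le) ∘ x)) =
      facetForm hf v * facetDet hf ω x := by
  set i := Submodule.inclusion (Submodule.span_mono hf.isFaceOf.le : linSpan τ ≤ linSpan σ) with hi
  have h1 : ∀ v' : linSpan σ, ω.domDomCongr (finCongr hf.dim_eq) (Fin.cons v' (i ∘ x)) =
      (ω.domDomCongr (finCongr hf.dim_eq)).curryLeft v' (i ∘ x) := fun v' => rfl
  have h2 : facetDet hf ω x =
      (ω.domDomCongr (finCongr hf.dim_eq)).curryLeft (facetVec hf) (i ∘ x) := rfl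
  rw [h2, h1]
  have hw : ∃ w : linSpan τ, i w = v - facetForm hf v • facetVec hf := by
    have hmem : ((v - facetForm hf v • facetVec hf : linSpan σ) : V) ∈ linSpan τ := by
      refine (facetForm_eq_zero_iff hf _ (Subtype.coe_prop _)).1 ?_
      simp [facetForm_facetVec hf]
    exact ⟨⟨_, hmem⟩, rfl⟩
  obtain ⟨w, hw⟩ := hw
  -- There are `dim τ + 1` arguments in `V_τ`, so they are linearly dependent.
  have h3 : (ω.domDomCongr (finCongr hf.dim_eq)).curryLeft (i w) (i ∘ x) = 0 := by
    rw [← h1, ← Fin.comp_cons]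
    have h4 : ((ω.domDomCongr (finCongr hf.dim_eq)).compLinearMap i)
        (Fin.cons w x : Fin (coneDim τ + 1) → linSpan τ) = 0 := by
      refine AlternatingMap.map_linearDependent _ _ fun hli => ?_
      have := hli.fintype_card_le_finrank
      simp at this
    exact h4
  have h4 : v = i w + facetForm hf v • facetVec hf := by rw [hw]; abel
  conv_lhs => rw [h4]
  rw [map_add, map_smul, AlternatingMap.add_apply, h3, zero_add]
  rfl

/-- A vector outside of the hyperplane `V_τ` together with a basis of `V_τ` is a basis of `V_σ`, on
which `ω` cannot vanish. -/
theorem facetDet_ne_zero {τ σ : PointedCone ℝ V} (hf : IsFacet τ σ) {ω : DetDual (linSpan σ)}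
    (hω : ω ≠ 0) : facetDet hf ω ≠ 0 := by
  intro h0
  have h1 := domDomCongr_cons_eq hf ω (facetVec hf) (finBasis ℝ (linSpan τ))
  rw [h0, AlternatingMap.zero_apply, mul_zero] at h1
  set i := Submodule.inclusion (Submodule.span_mono hf.isFaceOf.le : linSpan τ ≤ linSpan σ) with hi
  have hli : LinearIndependent ℝ (Fin.cons (facetVec hf) (i ∘ finBasis ℝ (linSpan τ)) :
      Fin (coneDim τ + 1) → linSpan σ) := by
    rw [linearIndependent_finCons]
    refine ⟨(finBasis ℝ (linSpan τ)).linearIndependent.map' i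
      (LinearMap.ker_eq_bot.2 (Submodule.inclusion_injective _)), fun h => ?_⟩
    have h2 : facetVec hf ∈ LinearMap.range i := by
      refine Submodule.span_le.2 ?_ h
      rintro _ ⟨j, rfl⟩
      exact ⟨_, rfl⟩
    obtain ⟨w, hw⟩ := h2
    have h3 := facetForm_facetVec hf
    rw [← hw, facetForm_eq_zero hf (show ((i w : linSpan σ) : V) ∈ linSpan τ from w.2)] at h3
    exact zero_ne_one h3
  exact apply_ne_zero_of_linearIndependent hω
    (hli.comp (finCongr hf.dim_eq) (finCongr hf.dim_eq).injective) h1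

end FacetDet

/-! ### Volume forms -/

section Volume

variable {V : Type u} [AddCommGroup V] [Module ℝ V] [FiniteDimensional ℝ V] {Δ : Fan V}

/-- Volume forms on the spans of the cones of an oriented fan that represent the orientations and
coincide on the full-dimensional cones. -/
structure VolumeForms (o : Δ.Oriented) where
  form : ∀ σ : Δ.Cone, DetDual (span σ)
  ne_zero : ∀ σ, form σ ≠ 0
  sameRay : ∀ σ, SameRay ℝ (form σ) (o.or σ).someVector
  top : DetDual V
  top_ne_zero : top ≠ 0
  detCongr_form : ∀ σ : Δ.TopCone, detCongr (topEquiv σ) (form σ.1) = top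

/-- The orientations of the `n`-cones define one ray in `det V^*`. A representative is pulled back
to all `n`-cones; on the other cones any representative serves. -/
theorem VolumeForms.exists (o : Δ.Oriented) : Nonempty (VolumeForms o) := by
  classical
  obtain ⟨ω, hω, hray⟩ : ∃ (ω : DetDual V) (hω : ω ≠ 0), ∀ σ : Δ.TopCone,
      Module.Ray.map (detCongr (topEquiv σ)) (o.or σ.1) = rayOfNeZero ℝ ω hω := by
    by_cases h : Nonempty Δ.TopCone
    · obtain ⟨σ₀⟩ := h
      refine ⟨detCongr (topEquiv σ₀) (o.or σ₀.1).someVector,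
        (LinearEquiv.map_ne_zero_iff _).2 (Module.Ray.someVector_ne_zero _), fun σ => ?_⟩
      rw [o.coincide σ σ₀, ← Module.Ray.map_apply _ _ (Module.Ray.someVector_ne_zero _),
        Module.Ray.someVector_ray]
    · obtain ⟨ω, hω⟩ := exists_detDual_ne_zero V
      exact ⟨ω, hω, fun σ => absurd ⟨σ⟩ h⟩
  refine ⟨{
    form := fun σ => if h : dim σ = finrank ℝ V then (detCongr (topEquiv ⟨σ, h⟩)).symm ω
      else (o.or σ).someVector
    ne_zero := fun σ => ?_
    sameRay := fun σ => ?_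
    top := ω
    top_ne_zero := hω
    detCongr_form := fun σ => ?_ }⟩
  · by_cases h : dim σ = finrank ℝ V
    · rw [dif_pos h]
      exact (LinearEquiv.map_ne_zero_iff _).2 hω
    · rw [dif_neg h]
      exact Module.Ray.someVector_ne_zero _
  · by_cases h : dim σ = finrank ℝ V
    · rw [dif_pos h]
      have h1 := hray ⟨σ, h⟩
      have h2 := Module.Ray.someVector_ray (o.or σ)
      rw [← h2, Module.Ray.map_apply, ray_eq_iff] at h1
      rw [← SameRay.sameRay_map_iff (detCongr (topEquiv ⟨σ, h⟩)), LinearEquiv.apply_symm_apply]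
      exact h1.symm
    · rw [dif_neg h]
  · rw [dif_pos σ.2, LinearEquiv.apply_symm_apply]

variable {o : Δ.Oriented} (vol : VolumeForms o)

namespace VolumeForms

/-- The sign in the restriction maps of the dual sheaf is made to correct the orientation, so only a
positive factor relates the two volume forms. -/
theorem exists_transition {τ σ : Δ.Cone} (hf : IsFacet τ.1 σ.1) :
    ∃ c : ℝ, 0 < c ∧ PureSheaf.transition o hf • facetDet hf (vol.form σ) = c • vol.form τ := by
  set d := detCoord (vol.form τ) (facetDet hf (o.or σ).someVector) with hd
  have h1 : d • vol.form τ = facetDet hf (o.or σ).someVector := detCoord_smul (vol.ne_zero τ) _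
  have hd0 : d ≠ 0 := fun h => by
    rw [h, zero_smul] at h1
    exact facetDet_ne_zero hf (Module.Ray.someVector_ne_zero _) h1.symm
  obtain ⟨r, hr, hr'⟩ := (vol.sameRay σ).exists_pos_right (vol.ne_zero σ)
    (Module.Ray.someVector_ne_zero _)
  have h2 : facetDet hf (vol.form σ) = (r * d) • vol.form τ := by
    rw [hr', map_smul, ← h1, smul_smul]
  have h3 : SameRay ℝ (facetDet hf (o.or σ).someVector) (o.or τ).someVector ↔ 0 < d := by
    rw [← h1, ← sameRay_smul_left_iff_of_ne (vol.ne_zero τ) hd0]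
    exact ⟨fun h => h.trans (vol.sameRay τ).symm
        fun h0 => absurd h0 (Module.Ray.someVector_ne_zero _),
      fun h => h.trans (vol.sameRay τ) fun h0 => absurd h0 (vol.ne_zero τ)⟩
  rw [PureSheaf.transition]
  split_ifs with h
  · exact ⟨r * d, mul_pos hr (h3.1 h), by rw [one_smul, h2]⟩
  · have : d < 0 := lt_of_le_of_ne (not_lt.1 fun h' => h (h3.2 h')) hd0
    exact ⟨-(r * d), neg_pos.2 (mul_neg_of_pos_of_neg hr this), by
      rw [h2, neg_one_smul]; exact (neg_smul _ _).symm⟩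

/-- The positive factor relating the volume forms of a cone and a facet. -/
def factor {τ σ : Δ.Cone} (hf : IsFacet τ.1 σ.1) : ℝ := (vol.exists_transition hf).choose

theorem factor_pos {τ σ : Δ.Cone} (hf : IsFacet τ.1 σ.1) : 0 < vol.factor hf :=
  (vol.exists_transition hf).choose_spec.1

theorem transition_smul_facetDet {τ σ : Δ.Cone} (hf : IsFacet τ.1 σ.1) :
    PureSheaf.transition o hf • facetDet hf (vol.form σ) = vol.factor hf • vol.form τ :=
  (vol.exists_transition hf).choose_spec.2

/-- The form defining a facet, normalised by the volume forms. -/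
def facetForm {τ σ : Δ.Cone} (hf : IsFacet τ.1 σ.1) : Dual ℝ V :=
  vol.factor hf • FanDuality.facetForm hf

theorem facetForm_apply {τ σ : Δ.Cone} (hf : IsFacet τ.1 σ.1) (x : V) :
    vol.facetForm hf x = vol.factor hf * FanDuality.facetForm hf x := rfl

theorem facetForm_eq_zero_iff {τ σ : Δ.Cone} (hf : IsFacet τ.1 σ.1) {x : V} (hx : x ∈ span σ) :
    vol.facetForm hf x = 0 ↔ x ∈ span τ := by
  rw [facetForm_apply, mul_eq_zero, or_iff_right (vol.factor_pos hf).ne']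
  exact FanDuality.facetForm_eq_zero_iff hf x hx

theorem facetForm_eq_zero {τ σ : Δ.Cone} (hf : IsFacet τ.1 σ.1) {x : V} (hx : x ∈ span τ) :
    vol.facetForm hf x = 0 :=
  (vol.facetForm_eq_zero_iff hf (span_mono (le_of_isFacet hf) hx)).2 hx

theorem facetForm_pos {τ σ : Δ.Cone} (hf : IsFacet τ.1 σ.1) {x : V} (hx : x ∈ σ.1)
    (hxτ : x ∉ τ.1) : 0 < vol.facetForm hf x :=
  mul_pos (vol.factor_pos hf) (FanDuality.facetForm_pos hf hx hxτ)

/-- Up to sign, the volume form of `σ` is the wedge of the normalised facet form with the volume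
form of `τ`. Absolute values discard the transition sign, and the free index `m` allows the formula
to be applied twice in a row. -/
theorem abs_form_cons {τ σ : Δ.Cone} (hf : IsFacet τ.1 σ.1) {m : ℕ} (hm : dim τ = m)
    (hm' : dim σ = m + 1) (v : span σ) (x : Fin m → span τ) :
    |(vol.form σ).domDomCongr (finCongr hm') (Fin.cons v
      (Submodule.inclusion (span_mono (le_of_isFacet hf)) ∘ x))| =
      |vol.facetForm hf v| * |(vol.form τ).domDomCongr (finCongr hm) x| := by
  subst hm
  have h1 := domDomCongr_cons_eq hf (vol.form σ) v x
  have h2 : |facetDet hf (vol.form σ) x| = |vol.factor hf * vol.form τ x| := by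
    have := congrArg (fun ω : DetDual (span τ) => |ω x|) (vol.transition_smul_facetDet hf)
    simp only [AlternatingMap.smul_apply, smul_eq_mul] at this
    rw [← this, PureSheaf.transition]
    split_ifs <;> simp
  have h3 : (vol.form σ).domDomCongr (finCongr hm') (Fin.cons v
      (Submodule.inclusion (span_mono (le_of_isFacet hf)) ∘ x)) = _ := h1
  have h4 : (vol.form τ).domDomCongr (finCongr rfl) x = vol.form τ x := rfl
  rw [h3, h4, abs_mul, h2, facetForm_apply, abs_mul, abs_mul]
  ring

end VolumeForms

theorem apply_cons_cons_swap {W : Type*} [AddCommGroup W] [Module ℝ W] {m : ℕ}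
    (ω : W [⋀^Fin (m + 2)]→ₗ[ℝ] ℝ) (a b : W) (x : Fin m → W) :
    ω (Fin.cons a (Fin.cons b x)) = -ω (Fin.cons b (Fin.cons a x)) := by
  rw [← AlternatingMap.map_swap ω _ (Fin.zero_ne_one : (0 : Fin (m + 2)) ≠ 1)]
  congr 1
  funext j
  refine Fin.cases ?_ (fun j => ?_) j
  · simp
  · refine Fin.cases ?_ (fun j => ?_) j
    · simp
    · have h1 : (j.succ.succ : Fin (m + 2)) ≠ 0 := Fin.succ_ne_zero _
      have h2 : (j.succ.succ : Fin (m + 2)) ≠ 1 := fun h =>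
        Fin.succ_ne_zero j (Fin.succ_injective _ h)
      simp [Equiv.swap_apply_of_ne_of_ne h1 h2]

namespace VolumeForms

variable {o : Δ.Oriented} (vol : VolumeForms o)

/-- For a face `ρ` of `γ` of codimension two, contained in the facets `τ₁` and `τ₂`, the normalised
forms of `ρ` in `τ₁` and `τ₂` are obtained from those of `τ₂` and `τ₁` in `γ` with the same
factor. -/
theorem exists_facetForm_eq {ρ τ₁ τ₂ γ : Δ.Cone} (h₁ : IsFacet ρ.1 τ₁.1) (h₂ : IsFacet ρ.1 τ₂.1)
    (h₁' : IsFacet τ₁.1 γ.1) (h₂' : IsFacet τ₂.1 γ.1) (hne : τ₁ ≠ τ₂) :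
    ∃ a : ℝ, (∀ x ∈ span τ₁, vol.facetForm h₁ x = a * vol.facetForm h₂' x) ∧
      ∀ x ∈ span τ₂, vol.facetForm h₂ x = a * vol.facetForm h₁' x := by
  have d1 : dim τ₁ = dim ρ + 1 := h₁.dim_eq
  have d2 : dim τ₂ = dim ρ + 1 := h₂.dim_eq
  have d3 : dim γ = dim ρ + 2 := by have : dim γ = dim τ₁ + 1 := h₁'.dim_eq; omega
  obtain ⟨w₁, hw₁, hw₁ρ⟩ := h₁.exists_notMem
  obtain ⟨w₂, hw₂, hw₂ρ⟩ := h₂.exists_notMem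
  have hint : inter τ₁ τ₂ = ρ := by
    refine (eq_of_le_of_dim_le (le_inter (le_of_isFacet h₁) (le_of_isFacet h₂)) ?_).symm
    have hlt : inter τ₁ τ₂ < τ₁ := lt_of_le_of_ne (inter_le_left _ _) fun h =>
      hne (eq_of_le_of_dim_le (h ▸ inter_le_right τ₁ τ₂) (by omega))
    have := dim_lt hlt
    omega
  have m12 : w₁ ∉ τ₂.1 := fun h => hw₁ρ (by rw [← hint]; exact ⟨hw₁, h⟩)
  have m21 : w₂ ∉ τ₁.1 := fun h => hw₂ρ (by rw [← hint]; exact ⟨h, hw₂⟩)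
  have q1 := vol.facetForm_pos h₁ hw₁ hw₁ρ
  have q2 := vol.facetForm_pos h₂ hw₂ hw₂ρ
  have p1 := vol.facetForm_pos h₁' (le_of_isFacet h₂' hw₂) m21
  have p2 := vol.facetForm_pos h₂' (le_of_isFacet h₁' hw₁) m12
  let u₁ : span τ₁ := ⟨w₁, Submodule.subset_span hw₁⟩
  let u₂ : span τ₂ := ⟨w₂, Submodule.subset_span hw₂⟩
  let i₁ := Submodule.inclusion (span_mono (le_of_isFacet h₁'))
  let i₂ := Submodule.inclusion (span_mono (le_of_isFacet h₂'))
  let j₁ := Submodule.inclusion (span_mono (le_of_isFacet h₁))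
  let j₂ := Submodule.inclusion (span_mono (le_of_isFacet h₂))
  let x := finBasis ℝ (span ρ)
  -- The volume form of `γ` is expanded through `τ₁` and through `τ₂`. The arguments differ by a
  -- transposition, so the absolute values agree and the products of the two normalised forms along
  -- both flags coincide.
  have e1 := vol.abs_form_cons h₁' d1 d3 (i₂ u₂) (Fin.cons u₁ (j₁ ∘ x))
  have e2 := vol.abs_form_cons h₂' d2 d3 (i₁ u₁) (Fin.cons u₂ (j₂ ∘ x))
  have e3 := vol.abs_form_cons h₁ rfl d1 u₁ x
  have e4 := vol.abs_form_cons h₂ rfl d2 u₂ x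
  have hx : |(vol.form ρ).domDomCongr (finCongr rfl) x| ≠ 0 :=
    abs_ne_zero.2 (((vol.form ρ).map_basis_ne_zero_iff x).2 (vol.ne_zero ρ))
  rw [e3] at e1
  rw [e4] at e2
  have c1 : (Submodule.inclusion (span_mono (le_of_isFacet h₁')) ∘
      (Fin.cons u₁ (j₁ ∘ x) : Fin (dim ρ + 1) → span τ₁)) =
      Fin.cons (i₁ u₁) ((i₁ ∘ j₁) ∘ x) := Fin.comp_cons _ _ _
  have c2 : (Submodule.inclusion (span_mono (le_of_isFacet h₂')) ∘
      (Fin.cons u₂ (j₂ ∘ x) : Fin (dim ρ + 1) → span τ₂)) =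
      Fin.cons (i₂ u₂) ((i₁ ∘ j₁) ∘ x) := Fin.comp_cons _ _ _
  rw [c1] at e1
  rw [c2, apply_cons_cons_swap, abs_neg, e1, ← mul_assoc, ← mul_assoc] at e2
  have e5 := mul_right_cancel₀ hx e2
  have v1 : |vol.facetForm h₁' (i₂ u₂)| = vol.facetForm h₁' w₂ := abs_of_pos p1
  have v2 : |vol.facetForm h₂' (i₁ u₁)| = vol.facetForm h₂' w₁ := abs_of_pos p2
  have v3 : |vol.facetForm h₁ u₁| = vol.facetForm h₁ w₁ := abs_of_pos q1
  have v4 : |vol.facetForm h₂ u₂| = vol.facetForm h₂ w₂ := abs_of_pos q2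
  rw [v1, v2, v3, v4] at e5
  -- Two forms that vanish on the hyperplane `V_ρ` of `V_τ` are proportional on `V_τ`.
  have prop : ∀ {τ : Δ.Cone} (h : IsFacet ρ.1 τ.1) {g : Dual ℝ V} {w : V} (_ : w ∈ τ.1)
      (_ : ∀ y ∈ span ρ, g y = 0) (_ : vol.facetForm h w ≠ 0), ∀ y ∈ span τ,
      vol.facetForm h w * g y = g w * vol.facetForm h y := by
    intro τ h g w hw hg hne y hy
    have hm : y - (vol.facetForm h y / vol.facetForm h w) • w ∈ span ρ := by
      refine (vol.facetForm_eq_zero_iff h (Submodule.sub_mem _ hy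
        (Submodule.smul_mem _ _ (Submodule.subset_span hw)))).1 ?_
      simp [div_mul_cancel₀ _ hne]
    have := hg _ hm
    rw [map_sub, map_smul, smul_eq_mul, sub_eq_zero] at this
    rw [this]
    field_simp
  refine ⟨vol.facetForm h₁ w₁ / vol.facetForm h₂' w₁, fun y hy => ?_, fun y hy => ?_⟩
  · have := prop h₁ (g := vol.facetForm h₂') hw₁
      (fun y hy => vol.facetForm_eq_zero h₂' (span_mono (le_of_isFacet h₂) hy)) q1.ne' y hy
    field_simp
    linarith
  · have := prop h₂ (g := vol.facetForm h₁') hw₂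
      (fun y hy => vol.facetForm_eq_zero h₁' (span_mono (le_of_isFacet h₁) hy)) q2.ne' y hy
    field_simp
    refine mul_left_cancel₀ p1.ne' ?_
    linear_combination -vol.facetForm h₂' w₁ * this - vol.facetForm h₁' y * e5

/-- The normalised forms of a common facet of two full-dimensional cones are opposite. -/
theorem facetForm_eq_neg {τ σ σ' : Δ.Cone} (hσ : dim σ = finrank ℝ V) (hσ' : dim σ' = finrank ℝ V)
    (hf : IsFacet τ.1 σ.1) (hf' : IsFacet τ.1 σ'.1) (hne : σ ≠ σ') :
    vol.facetForm hf' = -vol.facetForm hf := by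
  have top : ∀ {σ : Δ.Cone}, dim σ = finrank ℝ V → ∀ x, x ∈ span σ := fun {σ} h x => by
    have : span σ = ⊤ := Submodule.eq_top_of_finrank_eq h
    rw [this]; trivial
  obtain ⟨p, hp, hpτ⟩ := hf.exists_notMem
  have hpos := vol.facetForm_pos hf hp hpτ
  -- Positivity at `p` would put `σ` and `σ'` on the same side of `τ`.
  have hneg : vol.facetForm hf' p < 0 := by
    by_contra hc
    have h1 : vol.facetForm hf' p ≠ 0 := fun h0 => hpτ (mem_of_mem_span (le_of_isFacet hf) hp
      ((vol.facetForm_eq_zero_iff hf' (top hσ' p)).1 h0))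
    have h2 : 0 < vol.facetForm hf' p := lt_of_le_of_ne (not_lt.1 hc) h1.symm
    rw [facetForm_apply] at h2
    exact hne (eq_of_same_side hσ' hf' hf hp (pos_of_mul_pos_right h2 (vol.factor_pos hf').le)).symm
  let x := finBasis ℝ (span τ)
  have d1 : finrank ℝ V = dim τ + 1 := hσ.symm.trans hf.dim_eq
  -- The left-hand side involves only the common volume form of `V`, so both normalised forms have
  -- the same absolute value at `p`.
  have key : ∀ {σ : Δ.Cone} (hσ : dim σ = finrank ℝ V) (hf : IsFacet τ.1 σ.1),
      |vol.top.domDomCongr (finCongr d1) (Fin.cons p ((span τ).subtype ∘ x))| =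
        |vol.facetForm hf p| * |(vol.form τ).domDomCongr (finCongr rfl) x| := by
    intro σ hσ hf
    rw [← vol.abs_form_cons hf rfl hf.dim_eq ⟨p, top hσ p⟩ x, ← vol.detCongr_form ⟨σ, hσ⟩]
    congr 1
    simp only [detCongr, LinearEquiv.trans_apply, AlternatingMap.domDomCongr_apply]
    change vol.form σ _ = vol.form σ _
    congr 1
    funext j
    apply Subtype.ext
    change Fin.cons (α := fun _ => V) p ((span τ).subtype ∘ x) _ =
      (span σ).subtype (Fin.cons (α := fun _ => span σ) _ _ _)
    have : ∀ j : Fin (dim τ + 1), Fin.cons (α := fun _ => V) p ((span τ).subtype ∘ x) j =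
        (span σ).subtype (Fin.cons (α := fun _ => span σ) ⟨p, top hσ p⟩
          (Submodule.inclusion (span_mono (le_of_isFacet hf)) ∘ x) j) := fun j => by
      refine Fin.cases rfl (fun j => rfl) j
    exact this _
  have hx : |(vol.form τ).domDomCongr (finCongr rfl) x| ≠ 0 :=
    abs_ne_zero.2 (((vol.form τ).map_basis_ne_zero_iff x).2 (vol.ne_zero τ))
  have e := mul_right_cancel₀ hx ((key hσ hf).symm.trans (key hσ' hf'))
  rw [abs_of_pos hpos, abs_of_neg hneg] at e
  ext y
  have hm : y - (vol.facetForm hf y / vol.facetForm hf p) • p ∈ span τ := by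
    refine (vol.facetForm_eq_zero_iff hf (top hσ _)).1 ?_
    simp [div_mul_cancel₀ _ hpos.ne']
  have h0 := vol.facetForm_eq_zero hf' hm
  rw [map_sub, map_smul, smul_eq_mul, sub_eq_zero, ← neg_eq_iff_eq_neg.2 e] at h0
  rw [h0, LinearMap.neg_apply]
  field_simp

end VolumeForms

end Volume

/-! ### The restriction maps of the dual sheaf in terms of volume forms -/

namespace PureSheaf

variable {V : Type u} [AddCommGroup V] [Module ℝ V] [FiniteDimensional ℝ V] {Δ : Fan V}
  (F : PureSheaf.{u, w} Δ) {o : Δ.Oriented} (vol : VolumeForms o)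

theorem algebraMap_linForm_eq {τ : Δ.Cone} {h h' : Dual ℝ V} (hh : ∀ x ∈ span τ, h x = h' x) :
    algebraMap (PolyAlg V) (Alg τ) (linForm h) = algebraMap (PolyAlg V) (Alg τ) (linForm h') := by
  rw [Fan.algebraMap_apply, Fan.algebraMap_apply, pull_linForm, pull_linForm]
  congr 1
  ext x
  exact hh x x.2

theorem algebraMap_linForm_eq_zero {τ : Δ.Cone} {h : Dual ℝ V} (hh : ∀ x ∈ span τ, h x = 0) :
    algebraMap (PolyAlg V) (Alg τ) (linForm h) = 0 := by
  rw [algebraMap_linForm_eq (h' := 0) hh, map_zero, map_zero]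

theorem linForm_smul_mem_rel {τ σ : Δ.Cone} {hle : τ ≤ σ} {s : F.rel τ} {t : F.stalk σ}
    (ht : F.IsExtension hle s t) {h : Dual ℝ V} (hh : ∀ x ∈ span τ, h x = 0) :
    linForm h • t ∈ F.rel σ := by
  intro ρ hρ
  rw [F.res_smul]
  by_cases he : ρ = τ
  · subst he
    rw [F.smul_def, algebraMap_linForm_eq_zero hh, zero_smul]
  · rw [ht.2 ρ hρ he, smul_zero]

/-- The restriction `Hom(F_(σ,∂σ), A_σ) → Hom(F_(τ,∂τ), A_τ)` given by the normalised form
of a facet. -/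
def redRes {τ σ : Δ.Cone} (hf : IsFacet τ.1 σ.1) :
    (F.rel σ →ₗ[PolyAlg V] Alg σ) →ₗ[PolyAlg V] (F.rel τ →ₗ[PolyAlg V] Alg τ) :=
  algebraMap ℝ (PolyAlg V) (vol.factor hf) • F.facetHom hf

/-- The extension is arbitrary, which allows choices adapted to the situation: homogeneous ones, or
restrictions of global sections. -/
theorem redRes_apply {τ σ : Δ.Cone} (hf : IsFacet τ.1 σ.1) (f : F.rel σ →ₗ[PolyAlg V] Alg σ)
    {s : F.rel τ} {t : F.stalk σ} (ht : F.IsExtension (le_of_isFacet hf) s t)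
    (hm : linForm (vol.facetForm hf) • t ∈ F.rel σ) :
    F.redRes vol hf f s = resAlg (le_of_isFacet hf) (f ⟨_, hm⟩) := by
  have h1 : F.facetHom hf f s = resAlg (le_of_isFacet hf) (f ⟨_, F.smul_mem_rel hf ht⟩) :=
    F.extension_unique hf f (F.isExtension_ext hf s) ht
  have h2 : (⟨_, hm⟩ : F.rel σ) =
      algebraMap ℝ (PolyAlg V) (vol.factor hf) • ⟨_, F.smul_mem_rel hf ht⟩ := by
    apply Subtype.ext
    change linForm (vol.facetForm hf) • t =
      algebraMap ℝ (PolyAlg V) (vol.factor hf) • linForm (facetForm hf) • t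
    rw [VolumeForms.facetForm, map_smul, Algebra.smul_def, mul_smul]
  rw [h2, map_smul, Algebra.smul_def, map_mul, resAlg_algebraMap, ← Algebra.smul_def, ← h1]
  rfl

/-- The transition sign and the factor between the volume forms are absorbed by the normalised facet
form. From here on, no determinants occur in the restriction maps. -/
theorem dualRes_tmul {τ σ : Δ.Cone} (hf : IsFacet τ.1 σ.1) (f : F.rel σ →ₗ[PolyAlg V] Alg σ) :
    F.dualRes o hf (f ⊗ₜ vol.form σ) = F.redRes vol hf f ⊗ₜ vol.form τ := by
  rw [dualRes, LinearMap.smul_apply, AlgebraTensorModule.map_tmul, ← TensorProduct.tmul_smul,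
    vol.transition_smul_facetDet, TensorProduct.tmul_smul, TensorProduct.smul_tmul']
  congr 1
  refine LinearMap.ext fun s => ?_
  simp only [redRes, LinearMap.smul_apply]
  rw [algebraMap_smul]

/-- The restriction maps of the dual sheaf to a face of codimension two do not depend on the
intermediate facet. -/
theorem redRes_redRes {ρ τ₁ τ₂ γ : Δ.Cone} (h₁ : IsFacet ρ.1 τ₁.1) (h₂ : IsFacet ρ.1 τ₂.1)
    (h₁' : IsFacet τ₁.1 γ.1) (h₂' : IsFacet τ₂.1 γ.1) (f : F.rel γ →ₗ[PolyAlg V] Alg γ) :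
    F.redRes vol h₁ (F.redRes vol h₁' f) = F.redRes vol h₂ (F.redRes vol h₂' f) := by
  classical
  by_cases hne : τ₁ = τ₂
  · subst hne
    rfl
  refine LinearMap.ext fun s => ?_
  have l₁ := le_of_isFacet h₁
  have l₂ := le_of_isFacet h₂
  have l₁' := lt_of_isFacet h₁'
  have l₂' := lt_of_isFacet h₂'
  have e₁ := F.isExtension_ext h₁ s
  have e₂ := F.isExtension_ext h₂ s
  set s₁ := F.ext h₁ s
  set s₂ := F.ext h₂ s
  have d1 : dim τ₁ = dim ρ + 1 := h₁.dim_eq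
  have d2 : dim τ₂ = dim ρ + 1 := h₂.dim_eq
  have d3 : dim γ = dim τ₁ + 1 := h₁'.dim_eq
  have h21 : ¬ τ₂ ≤ τ₁ := fun h => hne (eq_of_le_of_dim_le h (by omega)).symm
  have hint : inter τ₁ τ₂ = ρ := by
    refine (eq_of_le_of_dim_le (le_inter l₁ l₂) ?_).symm
    have hlt : inter τ₁ τ₂ < τ₁ := lt_of_le_of_ne (inter_le_left _ _) fun h =>
      hne (eq_of_le_of_dim_le (h ▸ inter_le_right τ₁ τ₂) (by omega))
    have := dim_lt hlt
    omega
  -- Only `τ₁` and `τ₂` lie strictly between `ρ` and `γ`, so a proper face of `γ` in neither of them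
  -- has none of `ρ`, `τ₁`, `τ₂` as a face.
  have hcov : ∀ δ δ' : Δ.Cone, δ < γ → ¬ δ ≤ τ₁ → ¬ δ ≤ τ₂ → δ' ≤ δ → δ' ≠ ρ ∧ δ' ≠ τ₁ ∧ δ' ≠ τ₂ := by
    intro δ δ' hδ n1 n2 hle
    have top : ∀ τ : Δ.Cone, dim γ = dim τ + 1 → ¬ δ ≤ τ → ¬ τ ≤ δ := fun τ hd hn h => by
      have := dim_lt (lt_of_le_of_ne h fun he => hn he.ge)
      have := dim_lt hδ
      omega
    refine ⟨fun h => ?_, fun h => top τ₁ d3 n1 (h ▸ hle), fun h => top τ₂ (by omega) n2 (h ▸ hle)⟩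
    subst h
    rcases eq_or_eq_of_between h₁ h₂ h₁' h₂' hne
      (lt_of_le_of_ne hle fun he => n1 (he ▸ l₁)) hδ with rfl | rfl
    · exact n1 le_rfl
    · exact n2 le_rfl
  have z₁ : ∀ (δ : Δ.Cone) (h : δ ≤ τ₁), δ ≠ ρ → δ ≠ τ₁ → F.res h s₁ = 0 := fun δ h n1 n2 =>
    e₁.2 δ (lt_of_le_of_ne h n2) n1
  have z₂ : ∀ (δ : Δ.Cone) (h : δ ≤ τ₂), δ ≠ ρ → δ ≠ τ₂ → F.res h s₂ = 0 := fun δ h n1 n2 =>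
    e₂.2 δ (lt_of_le_of_ne h n2) n1
  -- The two extensions of `s` agree on `τ₁ ∩ τ₂ = ρ`. Glued, and extended by zero to the rest of
  -- `∂γ`, they lift by flabbiness to one germ `t` on `γ`.
  let s' : ∀ δ, F.stalk δ := fun δ =>
    if h : δ ≤ τ₁ then F.res h s₁ else if h : δ ≤ τ₂ then F.res h s₂ else 0
  have hs' : F.IsSection {δ | δ < γ} s' := by
    intro δ' δ h hδ hδ'
    by_cases n1 : δ ≤ τ₁
    · simp only [s', dif_pos n1, dif_pos (h.trans n1), F.res_res]
    by_cases n2 : δ ≤ τ₂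
    · by_cases m1 : δ' ≤ τ₁
      · have hle : δ' ≤ ρ := hint ▸ le_inter m1 (h.trans n2)
        simp only [s', dif_neg n1, dif_pos n2, dif_pos m1, F.res_res]
        rw [← F.res_res hle l₁, ← F.res_res hle l₂, e₁.1, e₂.1]
      · simp only [s', dif_neg n1, dif_pos n2, dif_neg m1, dif_pos (h.trans n2), F.res_res]
    · obtain ⟨c1, c2, c3⟩ := hcov δ δ' hδ n1 n2 h
      simp only [s', dif_neg n1, dif_neg n2, map_zero]
      split_ifs with m1 m2
      · exact (z₁ δ' m1 c1 c2).symm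
      · exact (z₂ δ' m2 c1 c3).symm
      · rfl
  obtain ⟨T, hT, hT'⟩ := F.flabby {δ | δ < γ} (fun a b hba ha => lt_of_le_of_lt hba ha) s' hs'
  set t := T γ
  have r : ∀ (δ : Δ.Cone) (h : δ < γ), F.res h.le t = s' δ := fun δ h =>
    (hT h.le trivial trivial).trans (hT' δ h)
  have r₁ : F.res l₁'.le t = s₁ := by
    rw [r τ₁ l₁']
    simp only [s', dif_pos le_rfl, F.res_self]
  have r₂ : F.res l₂'.le t = s₂ := by
    rw [r τ₂ l₂']
    simp only [s', dif_neg h21, dif_pos le_rfl, F.res_self]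
  have r₀ : ∀ (δ : Δ.Cone) (h : δ < γ), δ ≠ ρ → δ ≠ τ₁ → δ ≠ τ₂ → F.res h.le t = 0 := by
    intro δ h n0 n1 n2
    rw [r δ h]
    simp only [s']
    split_ifs with m1 m2
    · exact z₁ δ m1 n0 n1
    · exact z₂ δ m2 n0 n2
    · rfl
  obtain ⟨a, ha₁, ha₂⟩ := vol.exists_facetForm_eq h₁ h₂ h₁' h₂' hne
  have hm₁ := F.linForm_smul_mem_rel e₁ (h := vol.facetForm h₁)
    fun x hx => vol.facetForm_eq_zero h₁ hx
  have hm₂ := F.linForm_smul_mem_rel e₂ (h := vol.facetForm h₂)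
    fun x hx => vol.facetForm_eq_zero h₂ hx
  -- On `τ₁` the form `a h₂'` equals `h₁`, and on `τ₂` it vanishes; thus `a h₂' t` extends `h₁ s₁`
  -- by zero.
  have E₁ : F.IsExtension l₁'.le ⟨_, hm₁⟩ (linForm (a • vol.facetForm h₂') • t) := by
    constructor
    · rw [F.res_smul, r₁, F.smul_def,
        algebraMap_linForm_eq (h' := vol.facetForm h₁) fun x hx => (ha₁ x hx).symm]
      rfl
    · intro δ hδ hn
      rw [F.res_smul]
      by_cases c : δ = ρ ∨ δ = τ₂
      · have hle : δ ≤ τ₂ := by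
          rcases c with rfl | rfl
          · exact l₂
          · exact le_rfl
        rw [F.smul_def, algebraMap_linForm_eq_zero, zero_smul]
        intro x hx
        rw [LinearMap.smul_apply, vol.facetForm_eq_zero h₂' (span_mono hle hx), smul_zero]
      · push Not at c
        rw [r₀ δ hδ c.1 hn c.2, smul_zero]
  have E₂ : F.IsExtension l₂'.le ⟨_, hm₂⟩ (linForm (a • vol.facetForm h₁') • t) := by
    constructor
    · rw [F.res_smul, r₂, F.smul_def,
        algebraMap_linForm_eq (h' := vol.facetForm h₂) fun x hx => (ha₂ x hx).symm]
      rfl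
    · intro δ hδ hn
      rw [F.res_smul]
      by_cases c : δ = ρ ∨ δ = τ₁
      · have hle : δ ≤ τ₁ := by
          rcases c with rfl | rfl
          · exact l₁
          · exact le_rfl
        rw [F.smul_def, algebraMap_linForm_eq_zero, zero_smul]
        intro x hx
        rw [LinearMap.smul_apply, vol.facetForm_eq_zero h₁' (span_mono hle hx), smul_zero]
      · push Not at c
        rw [r₀ δ hδ c.1 c.2 hn, smul_zero]
  have M₁ := F.linForm_smul_mem_rel E₁ (h := vol.facetForm h₁')
    fun x hx => vol.facetForm_eq_zero h₁' hx
  have M₂ := F.linForm_smul_mem_rel E₂ (h := vol.facetForm h₂')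
    fun x hx => vol.facetForm_eq_zero h₂' hx
  rw [F.redRes_apply vol h₁ _ e₁ hm₁, F.redRes_apply vol h₁' _ E₁ M₁,
    F.redRes_apply vol h₂ _ e₂ hm₂, F.redRes_apply vol h₂' _ E₂ M₂]
  -- Both orders of restriction evaluate `f` at the same element `a h₁' h₂' t`.
  have hel : (⟨_, M₁⟩ : F.rel γ) = ⟨_, M₂⟩ := by
    apply Subtype.ext
    change linForm (vol.facetForm h₁') • linForm (a • vol.facetForm h₂') • t =
      linForm (vol.facetForm h₂') • linForm (a • vol.facetForm h₁') • t
    rw [smul_smul, smul_smul, map_smul, map_smul, Algebra.mul_smul_comm, Algebra.mul_smul_comm,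
      mul_comm]
  rw [hel]
  have rr : ∀ {τ : Δ.Cone} (l : ρ ≤ τ) (l' : τ ≤ γ) (b : Alg γ),
      resAlg l (resAlg l' b) = resAlg (l.trans l') b := fun l l' b => pull_pull _ _ b
  rw [rr, rr]

/-- On a normal fan, a family on the full-dimensional cones that is compatible on the cones of
codimension one extends to all cones. -/
theorem exists_extension_of_top (hΔ : Δ.IsNormal) (f : ∀ σ, F.rel σ →ₗ[PolyAlg V] Alg σ)
    (hf : ∀ (τ σ σ' : Δ.Cone) (h : IsFacet τ.1 σ.1) (h' : IsFacet τ.1 σ'.1),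
      dim σ = finrank ℝ V → dim σ' = finrank ℝ V →
      F.redRes vol h (f σ) = F.redRes vol h' (f σ')) :
    ∃ g : ∀ σ, F.rel σ →ₗ[PolyAlg V] Alg σ, (∀ σ, dim σ = finrank ℝ V → g σ = f σ) ∧
      ∀ (τ σ : Δ.Cone) (h : IsFacet τ.1 σ.1), F.redRes vol h (g σ) = g τ := by
  classical
  -- Induction on the codimension up to which the family is compatible. For `j = 0` the condition is
  -- vacuous.
  have key : ∀ j : ℕ, ∃ g : ∀ σ, F.rel σ →ₗ[PolyAlg V] Alg σ,
      (∀ σ, dim σ = finrank ℝ V → g σ = f σ) ∧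
      ∀ (τ σ : Δ.Cone) (h : IsFacet τ.1 σ.1), finrank ℝ V ≤ dim τ + j →
        F.redRes vol h (g σ) = g τ := by
    intro j
    induction j with
    | zero =>
      refine ⟨f, fun _ _ => rfl, fun τ σ h hd => ?_⟩
      have h1 : dim σ = dim τ + 1 := h.dim_eq
      have h2 : dim σ ≤ finrank ℝ V := Submodule.finrank_le _
      omega
    | succ j ih =>
      obtain ⟨g, hg, hg'⟩ := ih
      have indep : ∀ (τ σ σ' : Δ.Cone) (h : IsFacet τ.1 σ.1) (h' : IsFacet τ.1 σ'.1),
          dim τ + (j + 1) = finrank ℝ V → F.redRes vol h (g σ) = F.redRes vol h' (g σ') := by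
        intro τ σ σ' h h' hd
        have d1 : dim σ = dim τ + 1 := h.dim_eq
        have d2 : dim σ' = dim τ + 1 := h'.dim_eq
        rcases Nat.eq_zero_or_pos j with rfl | hj
        · rw [hg σ (by omega), hg σ' (by omega)]
          exact hf τ σ σ' h h' (by omega) (by omega)
        -- Two covers of `τ` in a common cone `γ` get their values from `γ` by the induction
        -- hypothesis, so restriction through either gives the same result on `τ`.
        · refine (cover_connected hΔ (ρ := τ) (by omega)
            (P := fun c => ∀ hc : IsFacet τ.1 c.1, F.redRes vol h (g σ) = F.redRes vol hc (g c))
            (fun τ₁ τ₂ γ h₁ h₂ h₁' h₂' hP _ => ?_) h h' fun _ => rfl) h'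
          have d3 : dim τ₁ = dim τ + 1 := h₁.dim_eq
          have d4 : dim τ₂ = dim τ + 1 := h₂.dim_eq
          rw [hP h₁, ← hg' τ₁ γ h₁' (by omega), ← hg' τ₂ γ h₂' (by omega)]
          exact F.redRes_redRes vol h₁ h₂ h₁' h₂' (g γ)
      -- Only the values in codimension `j + 1` are redefined, through an arbitrary cover; values in
      -- smaller codimension, to which the compatibility refers, are kept.
      refine ⟨fun τ => if hτ : dim τ + (j + 1) = finrank ℝ V ∧ ∃ σ : Δ.Cone, IsFacet τ.1 σ.1 then
        F.redRes vol hτ.2.choose_spec (g hτ.2.choose) else g τ, fun σ hσ => ?_, fun τ σ h hd => ?_⟩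
      · beta_reduce
        rw [dif_neg fun hc => by have := hc.1; omega]
        exact hg σ hσ
      · have d1 : dim σ = dim τ + 1 := h.dim_eq
        beta_reduce
        rw [dif_neg (c := dim σ + (j + 1) = finrank ℝ V ∧ _) fun hc => by have := hc.1; omega]
        by_cases hτ : dim τ + (j + 1) = finrank ℝ V
        · rw [dif_pos ⟨hτ, σ, h⟩]
          exact indep τ σ _ h _ hτ
        · rw [dif_neg fun hc => hτ hc.1]
          exact hg' τ σ h (by omega)
  obtain ⟨g, hg, hg'⟩ := key (finrank ℝ V)
  exact ⟨g, hg, fun τ σ h => hg' τ σ h (by omega)⟩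

end PureSheaf

/-! ### Homogeneous homomorphisms -/

namespace FanSheaf

variable {V : Type u} [AddCommGroup V] [Module ℝ V] {Δ : Fan V} (F : FanSheaf.{u, w} Δ)

/-- The homogeneous component of degree `i` of a germ. -/
def component (σ : Δ.Cone) (i : ℤ) (s : F.stalk σ) : F.stalk σ :=
  let _ := (F.deg_internal σ).chooseDecomposition
  DirectSum.decompose (F.deg σ) s i

theorem component_mem (σ : Δ.Cone) (i : ℤ) (s : F.stalk σ) : F.component σ i s ∈ F.deg σ i := by
  let _ := (F.deg_internal σ).chooseDecomposition
  exact (DirectSum.decompose (F.deg σ) s i).2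

theorem component_of_mem {σ : Δ.Cone} {i : ℤ} {s : F.stalk σ} (hs : s ∈ F.deg σ i) :
    F.component σ i s = s := by
  let _ := (F.deg_internal σ).chooseDecomposition
  exact DirectSum.decompose_of_mem_same _ hs

theorem component_of_mem_ne {σ : Δ.Cone} {i j : ℤ} {s : F.stalk σ} (hs : s ∈ F.deg σ j)
    (hij : j ≠ i) : F.component σ i s = 0 := by
  let _ := (F.deg_internal σ).chooseDecomposition
  exact DirectSum.decompose_of_mem_ne _ hs hij

theorem component_zero (σ : Δ.Cone) (i : ℤ) : F.component σ i 0 = 0 :=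
  F.component_of_mem (zero_mem _)

theorem component_add (σ : Δ.Cone) (i : ℤ) (s t : F.stalk σ) :
    F.component σ i (s + t) = F.component σ i s + F.component σ i t := by
  let _ := (F.deg_internal σ).chooseDecomposition
  change ((DirectSum.decompose (F.deg σ) (s + t) i : F.deg σ i) : F.stalk σ) = _
  rw [DirectSum.decompose_add]
  rfl

/-- Consequently a homogeneous component of an extension of a homogeneous section is again an
extension. -/
theorem res_component {τ σ : Δ.Cone} (h : τ ≤ σ) (i : ℤ) (s : F.stalk σ) :
    F.res h (F.component σ i s) = F.component τ i (F.res h s) := by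
  let _ := (F.deg_internal σ).chooseDecomposition
  induction s using DirectSum.Decomposition.inductionOn (F.deg σ) with
  | zero => rw [component_zero, map_zero, component_zero]
  | @homogeneous j m =>
    by_cases hij : j = i
    · subst hij
      rw [F.component_of_mem m.2, F.component_of_mem (F.res_mem_deg h _ _ m.2)]
    · rw [F.component_of_mem_ne m.2 hij, F.component_of_mem_ne (F.res_mem_deg h _ _ m.2) hij,
        map_zero]
  | add s t hs ht => rw [component_add, map_add, hs, ht, map_add, component_add]

/-- The homomorphisms `F_(σ,∂σ) → A_σ` that raise degrees by `d`. -/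
def relHomDeg (σ : Δ.Cone) (d : ℤ) : Submodule ℝ (F.rel σ →ₗ[PolyAlg V] Alg σ) where
  carrier := {f | ∀ i : ℤ, ∀ s ∈ F.relDeg σ i, f s ∈ polyDeg (span σ) (i + d)}
  add_mem' := fun hf hg i s hs => Submodule.add_mem _ (hf i s hs) (hg i s hs)
  zero_mem' := fun _ _ _ => Submodule.zero_mem _
  smul_mem' := fun c _ hf i s hs => Submodule.smul_mem _ c (hf i s hs)

/-- The homomorphisms `F_(Δ,Λ) → A` that raise degrees by `d`. -/
def sectionsHomDeg (Λ : Set Δ.Cone) (d : ℤ) :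
    Submodule ℝ (F.sections Λ →ₗ[PolyAlg V] PolyAlg V) where
  carrier := {f | ∀ i : ℤ, ∀ s ∈ F.sectionsDeg Λ i, f s ∈ polyDeg V (i + d)}
  add_mem' := fun hf hg i s hs => Submodule.add_mem _ (hf i s hs) (hg i s hs)
  zero_mem' := fun _ _ _ => Submodule.zero_mem _
  smul_mem' := fun c _ hf i s hs => Submodule.smul_mem _ c (hf i s hs)

theorem tmul_mem_dualStalkDeg_iff [FiniteDimensional ℝ V] {σ : Δ.Cone} {ω : DetDual (span σ)}
    (hω : ω ≠ 0) {f : F.rel σ →ₗ[PolyAlg V] Alg σ} {k : ℤ} :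
    f ⊗ₜ ω ∈ F.dualStalkDeg σ k ↔ f ∈ F.relHomDeg σ (k - 2 * dim σ) :=
  tmul_mem_span_iff hω (F.relHomDeg σ (k - 2 * dim σ))

theorem tmul_mem_homDetDeg_iff [FiniteDimensional ℝ V] {Λ : Set Δ.Cone} {ω : DetDual V}
    (hω : ω ≠ 0) {f : F.sections Λ →ₗ[PolyAlg V] PolyAlg V} {k : ℤ} :
    f ⊗ₜ ω ∈ F.homDetDeg Λ k ↔ f ∈ F.sectionsHomDeg Λ (k - 2 * finrank ℝ V) :=
  tmul_mem_span_iff hω (F.sectionsHomDeg Λ (k - 2 * finrank ℝ V))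

theorem linForm_smul_mem_deg {σ : Δ.Cone} (h : Dual ℝ V) {i : ℤ} {s : F.stalk σ}
    (hs : s ∈ F.deg σ i) : linForm h • s ∈ F.deg σ (2 + i) := by
  rw [F.smul_def]
  refine F.smul_mem_deg σ 2 i _ _ ?_ hs
  rw [Fan.algebraMap_apply]
  exact pull_mem_polyDeg _ (linForm_mem_polyDeg h)

end FanSheaf

namespace PureSheaf

variable {V : Type u} [AddCommGroup V] [Module ℝ V] [FiniteDimensional ℝ V] {Δ : Fan V}
  (F : PureSheaf.{u, w} Δ) {o : Δ.Oriented} (vol : VolumeForms o)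

/-- The facet form has degree `2`, which compensates the difference between the degrees of `det
V_σ^*` and `det V_τ^*`. -/
theorem redRes_mem_relHomDeg {τ σ : Δ.Cone} (hf : IsFacet τ.1 σ.1) {d : ℤ}
    {f : F.rel σ →ₗ[PolyAlg V] Alg σ} (h : f ∈ F.relHomDeg σ d) :
    F.redRes vol hf f ∈ F.relHomDeg τ (d + 2) := by
  intro i s hs
  obtain ⟨t, ht⟩ := F.exists_extension hf s
  have ht' : F.IsExtension (le_of_isFacet hf) s (F.component σ i t) :=
    ⟨by rw [F.res_component, ht.1, F.component_of_mem hs], fun ρ hρ hne => by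
      rw [F.res_component, ht.2 ρ hρ hne, F.component_zero]⟩
  have hm := F.linForm_smul_mem_rel ht' (h := vol.facetForm hf)
    fun x hx => vol.facetForm_eq_zero hf hx
  rw [F.redRes_apply vol hf f ht' hm]
  have h1 := h (2 + i) ⟨_, hm⟩ (F.linForm_smul_mem_deg _ (F.component_mem σ i t))
  have h2 := pull_mem_polyDeg (Submodule.inclusion (span_mono (le_of_isFacet hf))) h1
  have : i + (d + 2) = 2 + i + d := by ring
  rw [this]
  exact h2

end PureSheaf

/-! ### Full-dimensional cones -/

namespace Fan

variable {V : Type u} [AddCommGroup V] [Module ℝ V] [FiniteDimensional ℝ V] {Δ : Fan V}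

theorem mem_span_of_top {σ : Δ.Cone} (h : dim σ = finrank ℝ V) (x : V) : x ∈ span σ := by
  have : span σ = ⊤ := Submodule.eq_top_of_finrank_eq h
  rw [this]
  trivial

theorem eq_of_top_le {σ ρ : Δ.Cone} (h : dim σ = finrank ℝ V) (hle : σ ≤ ρ) : σ = ρ :=
  eq_of_le_of_dim_le hle (h ▸ Submodule.finrank_le _)

theorem top_or_mem_lowerSkeleton (ρ : Δ.Cone) : dim ρ = finrank ℝ V ∨ ρ ∈ Δ.lowerSkeleton :=
  (Submodule.finrank_le (span ρ)).eq_or_lt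

theorem exists_top_ge (hΔ : Δ.IsPure) (ρ : Δ.Cone) : ∃ σ : Δ.Cone, ρ ≤ σ ∧ dim σ = finrank ℝ V := by
  obtain ⟨σ, h1, h2⟩ := Finite.exists_le_maximal (p := fun _ : Δ.Cone => True) (a := ρ) trivial
  exact ⟨σ, h1, hΔ σ fun b hb => h2.2 trivial hb⟩

/-- In a purely `n`-dimensional fan, each cone of dimension less than `n` lies in an
`(n-1)`-cone. -/
theorem exists_wall_ge (hΔ : Δ.IsPure) {ρ : Δ.Cone} (hρ : ρ ∈ Δ.lowerSkeleton) :
    ∃ τ : Δ.Cone, ρ ≤ τ ∧ dim τ + 1 = finrank ℝ V := by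
  obtain ⟨σ, h1, h2⟩ := exists_top_ge hΔ ρ
  have hlt : ρ < σ := lt_of_le_of_ne h1 fun h => by
    have h3 : dim ρ < finrank ℝ V := hρ
    rw [h, h2] at h3
    exact lt_irrefl _ h3
  obtain ⟨τ, h3, h4⟩ := exists_facet_of_lt hlt
  exact ⟨τ, h4, by rw [← h2]; exact h3.dim_eq.symm⟩

theorem topAlg_algebraMap (σ : Δ.TopCone) (a : PolyAlg V) :
    topAlg σ (algebraMap (PolyAlg V) (Alg σ.1) a) = a := by
  change pull _ (algebraMap (PolyAlg V) (Alg σ.1) a) = a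
  rw [Fan.algebraMap_apply, pull_pull, subtype_topEquiv, pull_id]

theorem algebraMap_topAlg_eq_resAlg (σ : Δ.TopCone) {τ : Δ.Cone} (h : τ ≤ σ.1) (b : Alg σ.1) :
    algebraMap (PolyAlg V) (Alg τ) (topAlg σ b) = resAlg h b := by
  change algebraMap (PolyAlg V) (Alg τ) (pull _ b) = resAlg h b
  rw [Fan.algebraMap_apply, pull_pull]
  rfl

theorem algebraMap_topAlg (σ : Δ.TopCone) (b : Alg σ.1) :
    algebraMap (PolyAlg V) (Alg σ.1) (topAlg σ b) = b := by
  rw [algebraMap_topAlg_eq_resAlg σ le_rfl]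
  exact pull_id b

theorem topAlg_mem_polyDeg (σ : Δ.TopCone) {b : Alg σ.1} {k : ℤ} (hb : b ∈ polyDeg (span σ.1) k) :
    topAlg σ b ∈ polyDeg V k :=
  pull_mem_polyDeg _ hb

/-! ### The product of the equations of the walls -/

variable (Δ)

/-- The hyperplanes spanned by the `(n-1)`-cones. -/
def hyperplanes : Finset (Submodule ℝ V) :=
  open Classical in
  (Finset.univ.filter fun τ : Δ.Cone => dim τ + 1 = finrank ℝ V).image span

variable {Δ}

theorem mem_hyperplanes {H : Submodule ℝ V} :
    H ∈ Δ.hyperplanes ↔ ∃ τ : Δ.Cone, dim τ + 1 = finrank ℝ V ∧ span τ = H := by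
  simp [hyperplanes]

theorem finrank_of_mem_hyperplanes {H : Submodule ℝ V} (hH : H ∈ Δ.hyperplanes) :
    finrank ℝ H + 1 = finrank ℝ V := by
  obtain ⟨τ, h1, rfl⟩ := mem_hyperplanes.1 hH
  exact h1

variable (Δ)

/-- The product of linear forms defining the hyperplanes spanned by the `(n-1)`-cones. -/
def wallPoly : PolyAlg V := ∏ H ∈ Δ.hyperplanes, linForm (hyperForm H)

theorem wallPoly_ne_zero : Δ.wallPoly ≠ 0 :=
  Finset.prod_ne_zero_iff.2 fun _ hH =>
    linForm_ne_zero (hyperForm_ne_zero (finrank_of_mem_hyperplanes hH))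

variable {Δ}

theorem wallPoly_mem_polyDeg : Δ.wallPoly ∈ polyDeg V (2 * Δ.hyperplanes.card) :=
  prod_linForm_mem_polyDeg _ _

theorem algebraMap_hyperForm {ρ : Δ.Cone} {H : Submodule ℝ V} (hH : H ∈ Δ.hyperplanes)
    (h : span ρ ≤ H) : algebraMap (PolyAlg V) (Alg ρ) (linForm (hyperForm H)) = 0 :=
  PureSheaf.algebraMap_linForm_eq_zero fun x hx =>
    (hyperForm_eq_zero_iff (finrank_of_mem_hyperplanes hH) x).2 (h hx)

theorem algebraMap_wallPoly (hΔ : Δ.IsPure) {ρ : Δ.Cone} (hρ : ρ ∈ Δ.lowerSkeleton) :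
    algebraMap (PolyAlg V) (Alg ρ) Δ.wallPoly = 0 := by
  obtain ⟨τ, h1, h2⟩ := exists_wall_ge hΔ hρ
  have hH : span τ ∈ Δ.hyperplanes := mem_hyperplanes.2 ⟨τ, h2, rfl⟩
  rw [wallPoly, map_prod]
  exact Finset.prod_eq_zero hH (algebraMap_hyperForm hH (span_mono h1))

/-- There is one prime factor per hyperplane, even if several walls span it; this makes the test
factor by factor sufficient. -/
theorem wallPoly_dvd {a : PolyAlg V} (h : ∀ H ∈ Δ.hyperplanes, linForm (hyperForm H) ∣ a) :
    Δ.wallPoly ∣ a :=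
  prod_dvd_of_prime _ _ (fun _ hH => linForm_prime (hyperForm_ne_zero (finrank_of_mem_hyperplanes hH)))
    (fun _ hH _ hH' => eq_of_linForm_hyperForm_dvd (finrank_of_mem_hyperplanes hH)
      (finrank_of_mem_hyperplanes hH')) h

end Fan

/-! ### Sections that vanish on the cones of positive codimension -/

namespace FanSheaf

variable {V : Type u} [AddCommGroup V] [Module ℝ V] [FiniteDimensional ℝ V] {Δ : Fan V}
  (F : FanSheaf.{u, w} Δ)

open Classical in
/-- Extension by zero of an element of `F_(σ,∂σ)` for a full-dimensional cone `σ`. -/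
def ofRel (σ : Δ.TopCone) : F.rel σ.1 →ₗ[PolyAlg V] F.sections Δ.lowerSkeleton where
  toFun s := ⟨Pi.single σ.1 s.1, by
    refine ⟨fun τ ρ h _ _ => ?_, fun ρ hρ => ?_⟩
    · by_cases hρ : ρ = σ.1
      · subst hρ
        rw [Pi.single_eq_same]
        by_cases hτ : τ = σ.1
        · subst hτ
          rw [Pi.single_eq_same, F.res_self]
        · rw [Pi.single_eq_of_ne hτ, s.2 τ (lt_of_le_of_ne h hτ)]
      · have hτ : τ ≠ σ.1 := fun he => hρ (eq_of_top_le σ.2 (he ▸ h)).symm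
        rw [Pi.single_eq_of_ne hρ, Pi.single_eq_of_ne hτ, map_zero]
    · refine Pi.single_eq_of_ne (fun he => ?_) _
      have h1 : dim ρ < finrank ℝ V := hρ
      rw [he, σ.2] at h1
      exact lt_irrefl _ h1⟩
  map_add' s t := Subtype.ext (Pi.single_add _ _ _)
  map_smul' a s := Subtype.ext (Pi.single_smul _ _ _)

theorem toRel_ofRel_same (σ : Δ.TopCone) (s : F.rel σ.1) : F.toRel σ (F.ofRel σ s) = s := by
  classical
  exact Subtype.ext (Pi.single_eq_same _ _)

theorem toRel_ofRel_ne {σ σ' : Δ.TopCone} (h : σ' ≠ σ) (s : F.rel σ.1) :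
    F.toRel σ' (F.ofRel σ s) = 0 := by
  classical
  exact Subtype.ext (Pi.single_eq_of_ne (fun he => h (Subtype.ext he)) _)

theorem sections_lower_ext {s t : F.sections Δ.lowerSkeleton}
    (h : ∀ σ : Δ.TopCone, F.toRel σ s = F.toRel σ t) : s = t := by
  refine Subtype.ext (funext fun ρ => ?_)
  rcases top_or_mem_lowerSkeleton ρ with hρ | hρ
  · exact congrArg Subtype.val (h ⟨ρ, hρ⟩)
  · rw [s.2.2 ρ hρ, t.2.2 ρ hρ]

theorem sum_ofRel_toRel (s : F.sections Δ.lowerSkeleton) :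
    ∑ σ : Δ.TopCone, F.ofRel σ (F.toRel σ s) = s := by
  refine F.sections_lower_ext fun σ => ?_
  rw [map_sum, Finset.sum_eq_single σ (fun σ' _ h => F.toRel_ofRel_ne h.symm _)
    (fun h => absurd (Finset.mem_univ σ) h), F.toRel_ofRel_same]

/-- The homomorphism `F_(Δ,Δ^{≤n-1}) → A` given by homomorphisms `F_(σ,∂σ) → A_σ` for the
full-dimensional cones. -/
def homOfTop (f : ∀ σ : Δ.TopCone, F.rel σ.1 →ₗ[PolyAlg V] Alg σ.1) :
    F.sections Δ.lowerSkeleton →ₗ[PolyAlg V] PolyAlg V :=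
  ∑ σ, (topAlg σ).comp ((f σ).comp (F.toRel σ))

theorem homOfTop_apply (f : ∀ σ : Δ.TopCone, F.rel σ.1 →ₗ[PolyAlg V] Alg σ.1)
    (s : F.sections Δ.lowerSkeleton) :
    F.homOfTop f s = ∑ σ, topAlg σ (f σ (F.toRel σ s)) := by
  simp [homOfTop]

theorem homOfTop_ofRel (f : ∀ σ : Δ.TopCone, F.rel σ.1 →ₗ[PolyAlg V] Alg σ.1) (σ : Δ.TopCone)
    (s : F.rel σ.1) : F.homOfTop f (F.ofRel σ s) = topAlg σ (f σ s) := by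
  rw [homOfTop_apply, Finset.sum_eq_single σ (fun σ' _ h => by
    rw [F.toRel_ofRel_ne h, map_zero, map_zero]) (fun h => absurd (Finset.mem_univ σ) h),
    F.toRel_ofRel_same]

/-- The homomorphisms `F_(σ,∂σ) → A_σ` given by a homomorphism `F_(Δ,Δ^{≤n-1}) → A`. -/
def topOfHom (φ : F.sections Δ.lowerSkeleton →ₗ[PolyAlg V] PolyAlg V) (σ : Δ.TopCone) :
    F.rel σ.1 →ₗ[PolyAlg V] Alg σ.1 :=
  (Algebra.linearMap (PolyAlg V) (Alg σ.1)).comp (φ.comp (F.ofRel σ))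

theorem homOfTop_topOfHom (φ : F.sections Δ.lowerSkeleton →ₗ[PolyAlg V] PolyAlg V) :
    F.homOfTop (F.topOfHom φ) = φ := by
  refine LinearMap.ext fun s => ?_
  rw [homOfTop_apply]
  conv_rhs => rw [← F.sum_ofRel_toRel s, map_sum]
  exact Finset.sum_congr rfl fun σ _ => topAlg_algebraMap σ _

theorem topOfHom_homOfTop (f : ∀ σ : Δ.TopCone, F.rel σ.1 →ₗ[PolyAlg V] Alg σ.1) :
    F.topOfHom (F.homOfTop f) = f := by
  funext σ
  refine LinearMap.ext fun s => ?_
  change algebraMap (PolyAlg V) (Alg σ.1) (F.homOfTop f (F.ofRel σ s)) = f σ s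
  rw [F.homOfTop_ofRel, algebraMap_topAlg]

theorem theta_tmul {o : Δ.Oriented} (vol : VolumeForms o)
    (f : ∀ σ : Δ.TopCone, F.rel σ.1 →ₗ[PolyAlg V] Alg σ.1) :
    (F.theta fun σ => f σ ⊗ₜ vol.form σ.1) = F.homOfTop f ⊗ₜ vol.top := by
  rw [theta, LinearMap.sum_apply, homOfTop, TensorProduct.sum_tmul]
  refine Finset.sum_congr rfl fun σ _ => ?_
  rw [LinearMap.comp_apply, LinearMap.proj_apply, AlgebraTensorModule.map_tmul]
  congr 1
  exact vol.detCongr_form σ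

/-- Once volume forms are fixed, `homOfTop` and `topOfHom` are mutually inverse. -/
theorem theta_bijective {o : Δ.Oriented} (vol : VolumeForms o) : Function.Bijective F.theta := by
  constructor
  · rw [injective_iff_map_eq_zero]
    intro x hx
    choose f hf using fun σ : Δ.TopCone => exists_eq_tmul (vol.ne_zero σ.1) (x σ)
    have hxf : x = fun σ => f σ ⊗ₜ vol.form σ.1 := funext hf
    rw [hxf, F.theta_tmul vol, tmul_eq_zero_iff vol.top_ne_zero] at hx
    have h0 : f = 0 := by
      rw [← F.topOfHom_homOfTop f, hx]
      funext σ
      refine LinearMap.ext fun s => ?_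
      exact map_zero (algebraMap (PolyAlg V) (Alg σ.1))
    rw [hxf, h0]
    funext σ
    exact TensorProduct.zero_tmul _ _
  · intro y
    obtain ⟨φ, rfl⟩ := exists_eq_tmul vol.top_ne_zero y
    exact ⟨fun σ => F.topOfHom φ σ ⊗ₜ vol.form σ.1, by
      rw [F.theta_tmul vol, F.homOfTop_topOfHom]⟩

theorem wallPoly_smul_mem (hΔ : Δ.IsPure) {Λ : Set Δ.Cone} {s : ∀ σ, F.stalk σ}
    (hs : s ∈ F.sections Λ) : Δ.wallPoly • s ∈ F.sections Δ.lowerSkeleton := by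
  refine ⟨((F.sections Λ).smul_mem _ hs).1, fun ρ hρ => ?_⟩
  rw [Pi.smul_apply, F.smul_def, algebraMap_wallPoly hΔ hρ, zero_smul]

/-- Restriction of homomorphisms to the sections that vanish on a larger set of cones. -/
abbrev restrictHom {Λ Λ' : Set Δ.Cone} (h : Λ ⊆ Λ') (φ : F.sections Λ →ₗ[PolyAlg V] PolyAlg V) :
    F.sections Λ' →ₗ[PolyAlg V] PolyAlg V :=
  φ.comp (Submodule.inclusion (F.sections_anti h))

theorem homRestrict_tmul {Λ Λ' : Set Δ.Cone} (h : Λ ⊆ Λ')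
    (φ : F.sections Λ →ₗ[PolyAlg V] PolyAlg V) (ω : DetDual V) :
    F.homRestrict h (φ ⊗ₜ ω) = F.restrictHom h φ ⊗ₜ ω := rfl

/-- As `A` is a domain, this recovers `φ` from its restriction. It underlies injectivity, the
construction of homomorphisms and the comparison of degrees. -/
theorem wallPoly_mul_apply (hΔ : Δ.IsPure) {Λ : Set Δ.Cone} (h : Λ ⊆ Δ.lowerSkeleton)
    (φ : F.sections Λ →ₗ[PolyAlg V] PolyAlg V) (s : F.sections Λ) :
    Δ.wallPoly * φ s = F.restrictHom h φ ⟨_, F.wallPoly_smul_mem hΔ s.2⟩ := by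
  rw [← smul_eq_mul, ← map_smul]
  rfl

theorem restrictHom_injective (hΔ : Δ.IsPure) {Λ : Set Δ.Cone} (h : Λ ⊆ Δ.lowerSkeleton) :
    Function.Injective (F.restrictHom h) := by
  intro φ φ' he
  refine LinearMap.ext fun s => mul_left_cancel₀ Δ.wallPoly_ne_zero ?_
  rw [F.wallPoly_mul_apply hΔ h, F.wallPoly_mul_apply hΔ h, he]

theorem homRestrict_injective (hΔ : Δ.IsPure) {Λ : Set Δ.Cone} (h : Λ ⊆ Δ.lowerSkeleton) :
    Function.Injective (F.homRestrict h) := by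
  obtain ⟨ω, hω⟩ := exists_detDual_ne_zero V
  intro x y hxy
  obtain ⟨φ, rfl⟩ := exists_eq_tmul hω x
  obtain ⟨φ', rfl⟩ := exists_eq_tmul hω y
  rw [F.homRestrict_tmul, F.homRestrict_tmul] at hxy
  rw [F.restrictHom_injective hΔ h (tmul_injective hω hxy)]

end FanSheaf

/-! ### The walls of a fan -/

namespace Fan

variable {V : Type u} [AddCommGroup V] [Module ℝ V] [FiniteDimensional ℝ V] {Δ : Fan V}

/-- A cone that is a facet of exactly one full-dimensional cone. -/
def IsBoundaryWall (τ : Δ.Cone) : Prop :=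
  ∃! σ : Δ.Cone, dim σ = finrank ℝ V ∧ IsFacet τ.1 σ.1

/-- A wall lies in at most two `n`-cones, since the normalised forms of three would be pairwise
opposite. -/
theorem boundaryWall_or_exists {o : Δ.Oriented} (vol : VolumeForms o) {τ σ : Δ.Cone}
    (hσ : dim σ = finrank ℝ V) (hf : IsFacet τ.1 σ.1) :
    IsBoundaryWall τ ∨ ∃ σ' : Δ.Cone, σ' ≠ σ ∧ dim σ' = finrank ℝ V ∧ IsFacet τ.1 σ'.1 ∧
      ∀ σ'' : Δ.Cone, dim σ'' = finrank ℝ V → IsFacet τ.1 σ''.1 → σ'' = σ ∨ σ'' = σ' := by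
  by_cases h : ∃ σ' : Δ.Cone, σ' ≠ σ ∧ dim σ' = finrank ℝ V ∧ IsFacet τ.1 σ'.1
  · obtain ⟨σ', hne, hσ', hf'⟩ := h
    refine Or.inr ⟨σ', hne, hσ', hf', fun σ'' hσ'' hf'' => ?_⟩
    by_contra! hc
    have e1 := vol.facetForm_eq_neg hσ hσ' hf hf' hne.symm
    have e2 := vol.facetForm_eq_neg hσ hσ'' hf hf'' hc.1.symm
    have e3 := vol.facetForm_eq_neg hσ' hσ'' hf' hf'' hc.2.symm
    obtain ⟨p, hp, hpτ⟩ := hf'.exists_notMem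
    have hpos := vol.facetForm_pos hf' hp hpτ
    have e4 := LinearMap.congr_fun (e2.symm.trans e3) p
    rw [← e1, LinearMap.neg_apply] at e4
    linarith
  · push Not at h
    exact Or.inl ⟨σ, ⟨hσ, hf⟩, fun σ' hσ' => by
      by_contra hne
      exact h σ' hne hσ'.1 hσ'.2⟩

theorem sum_eq_add_of_facets {M : Type*} [AddCommMonoid M] {τ : Δ.Cone} {σ σ' : Δ.TopCone}
    (hne : σ ≠ σ') (h : ∀ σ'' : Δ.Cone, dim σ'' = finrank ℝ V → IsFacet τ.1 σ''.1 →
      σ'' = σ.1 ∨ σ'' = σ'.1) (a : Δ.TopCone → M) (ha : ∀ σ'', ¬ IsFacet τ.1 σ''.1.1 → a σ'' = 0) :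
    ∑ σ'', a σ'' = a σ + a σ' := by
  refine Fintype.sum_eq_add σ σ' hne fun σ'' hσ'' => ha σ'' fun hf => ?_
  rcases h σ''.1 σ''.2 hf with he | he
  · exact hσ''.1 (Subtype.ext he)
  · exact hσ''.2 (Subtype.ext he)

theorem sum_eq_of_boundaryWall {M : Type*} [AddCommMonoid M] {τ : Δ.Cone} {σ : Δ.TopCone}
    (hf : IsFacet τ.1 σ.1.1) (h : IsBoundaryWall τ) (a : Δ.TopCone → M)
    (ha : ∀ σ'', ¬ IsFacet τ.1 σ''.1.1 → a σ'' = 0) : ∑ σ'', a σ'' = a σ := by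
  refine Fintype.sum_eq_single σ fun σ'' hσ'' => ha σ'' fun hf'' => hσ'' ?_
  exact Subtype.ext (h.unique ⟨σ''.2, hf''⟩ ⟨σ.2, hf⟩)

end Fan

theorem VolumeForms.exists_eq_smul_facetForm {V : Type u} [AddCommGroup V] [Module ℝ V]
    [FiniteDimensional ℝ V] {Δ : Fan V} {o : Δ.Oriented} (vol : VolumeForms o)
    {τ σ : Δ.Cone}
    (hσ : dim σ = finrank ℝ V) (hf : IsFacet τ.1 σ.1) {h : Dual ℝ V}
    (hh : ∀ x ∈ span τ, h x = 0) : ∃ c : ℝ, h = c • vol.facetForm hf := by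
  obtain ⟨p, hp, hpτ⟩ := hf.exists_notMem
  have hpos := vol.facetForm_pos hf hp hpτ
  refine ⟨h p / vol.facetForm hf p, LinearMap.ext fun y => ?_⟩
  have hm : y - (vol.facetForm hf y / vol.facetForm hf p) • p ∈ span τ := by
    refine (vol.facetForm_eq_zero_iff hf (mem_span_of_top hσ _)).1 ?_
    simp [div_mul_cancel₀ _ hpos.ne']
  have h0 := hh _ hm
  rw [map_sub, map_smul, smul_eq_mul, sub_eq_zero] at h0
  rw [h0, LinearMap.smul_apply, smul_eq_mul]
  ring

/-! ### Homomorphisms and compatible families -/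

namespace PureSheaf

variable {V : Type u} [AddCommGroup V] [Module ℝ V] [FiniteDimensional ℝ V] {Δ : Fan V}
  (F : PureSheaf.{u, w} Δ) {o : Δ.Oriented} (vol : VolumeForms o)

theorem redRes_apply_smul {τ σ : Δ.Cone} (hf : IsFacet τ.1 σ.1)
    (f : F.rel σ →ₗ[PolyAlg V] Alg σ) {s : F.rel τ} {t : F.stalk σ}
    (ht : F.IsExtension (le_of_isFacet hf) s t) (c : ℝ)
    (hm : linForm (c • vol.facetForm hf) • t ∈ F.rel σ) :
    resAlg (le_of_isFacet hf) (f ⟨_, hm⟩) = c • F.redRes vol hf f s := by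
  have hm' := F.linForm_smul_mem_rel ht (h := vol.facetForm hf)
    fun x hx => vol.facetForm_eq_zero hf hx
  have he : (⟨_, hm⟩ : F.rel σ) = algebraMap ℝ (PolyAlg V) c • ⟨_, hm'⟩ := by
    apply Subtype.ext
    change linForm (c • vol.facetForm hf) • t =
      algebraMap ℝ (PolyAlg V) c • linForm (vol.facetForm hf) • t
    rw [map_smul, Algebra.smul_def, mul_smul]
  rw [he, map_smul, algebraMap_smul, map_smul, F.redRes_apply vol hf f ht hm']

/-- A family of homomorphisms `F_(σ,∂σ) → A_σ` that is compatible with the restriction maps. -/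
def IsCompatible (g : ∀ σ : Δ.Cone, F.rel σ →ₗ[PolyAlg V] Alg σ) : Prop :=
  ∀ (τ σ : Δ.Cone) (h : IsFacet τ.1 σ.1), F.redRes vol h (g σ) = g τ

variable {F vol}

/-- The value at `τ` descends to `ρ` along a chain of covers. -/
theorem IsCompatible.eq_of_le {g g' : ∀ σ : Δ.Cone, F.rel σ →ₗ[PolyAlg V] Alg σ}
    (hg : F.IsCompatible vol g) (hg' : F.IsCompatible vol g') {ρ τ : Δ.Cone} (h : ρ ≤ τ)
    (hτ : g τ = g' τ) : g ρ = g' ρ := by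
  induction hd : dim τ - dim ρ using Nat.strong_induction_on generalizing ρ with
  | _ d ih =>
    rcases eq_or_lt_of_le h with rfl | hlt
    · exact hτ
    · obtain ⟨c, hc, hcτ⟩ := exists_cover_le hlt
      have d1 : dim c = dim ρ + 1 := hc.dim_eq
      have d2 := dim_lt hlt
      rw [← hg ρ c hc, ← hg' ρ c hc, ih (dim τ - dim c) (by omega) hcτ rfl]

theorem IsCompatible.eq_zero_of_le {g : ∀ σ : Δ.Cone, F.rel σ →ₗ[PolyAlg V] Alg σ}
    (hg : F.IsCompatible vol g) {ρ τ : Δ.Cone} (h : ρ ≤ τ) (h0 : g τ = 0) : g ρ = 0 :=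
  hg.eq_of_le (g' := fun _ => 0) (fun _ _ _ => map_zero _) h h0

theorem IsCompatible.eq_of_homOfTop_eq (hΔ : Δ.IsPure)
    {g g' : ∀ σ : Δ.Cone, F.rel σ →ₗ[PolyAlg V] Alg σ} (hg : F.IsCompatible vol g)
    (hg' : F.IsCompatible vol g')
    (h : F.homOfTop (fun σ => g σ.1) = F.homOfTop fun σ => g' σ.1) : g = g' := by
  have htop : ∀ σ : Δ.TopCone, g σ.1 = g' σ.1 := congrFun <| by
    rw [← F.topOfHom_homOfTop fun σ => g σ.1, h, F.topOfHom_homOfTop]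
  funext ρ
  obtain ⟨σ, h1, h2⟩ := exists_top_ge hΔ ρ
  exact hg.eq_of_le hg' h1 (htop ⟨σ, h2⟩)

theorem IsCompatible.mem_relHomDeg (hΔ : Δ.IsPure)
    {g : ∀ σ : Δ.Cone, F.rel σ →ₗ[PolyAlg V] Alg σ} (hg : F.IsCompatible vol g) {k : ℤ}
    (htop : ∀ σ : Δ.TopCone, g σ.1 ∈ F.relHomDeg σ.1 (k - 2 * dim σ.1)) (ρ : Δ.Cone) :
    g ρ ∈ F.relHomDeg ρ (k - 2 * dim ρ) := by
  induction hd : finrank ℝ V - dim ρ using Nat.strong_induction_on generalizing ρ with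
  | _ d ih =>
    rcases top_or_mem_lowerSkeleton ρ with h | h
    · exact htop ⟨ρ, h⟩
    · have h' : dim ρ < finrank ℝ V := h
      obtain ⟨σ, h1, h2⟩ := exists_top_ge hΔ ρ
      obtain ⟨c, hc, -⟩ := exists_cover_le (lt_of_le_of_ne h1 fun he => by
        rw [he, h2] at h'
        exact lt_irrefl _ h')
      have d1 : dim c = dim ρ + 1 := hc.dim_eq
      have h3 := F.redRes_mem_relHomDeg vol hc (ih (finrank ℝ V - dim c) (by omega) c rfl)
      rw [hg ρ c hc] at h3
      convert h3 using 2
      rw [d1]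
      push_cast
      ring

/-- Multiplication by `wallPoly` moves a section to where `φ` is a sum of the `g σ`, and the
homogeneous factor can be cancelled afterwards. Conversely, extension by zero exhibits `g` on the
`n`-cones as values of `φ`, and compatibility passes homogeneity down to all faces. -/
theorem IsCompatible.homogeneous_iff (hΔ : Δ.IsPure) {Λ : Set Δ.Cone} (hΛ : Λ ⊆ Δ.lowerSkeleton)
    {g : ∀ σ : Δ.Cone, F.rel σ →ₗ[PolyAlg V] Alg σ} (hg : F.IsCompatible vol g)
    {φ : F.sections Λ →ₗ[PolyAlg V] PolyAlg V}
    (hφ : F.restrictHom hΛ φ = F.homOfTop fun σ => g σ.1) (k : ℤ) :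
    (∀ σ, g σ ∈ F.relHomDeg σ (k - 2 * dim σ)) ↔
      φ ∈ F.sectionsHomDeg Λ (k - 2 * finrank ℝ V) := by
  constructor
  · intro h i s hs
    refine mem_polyDeg_of_mul_mem wallPoly_mem_polyDeg Δ.wallPoly_ne_zero ?_
    rw [F.wallPoly_mul_apply hΔ hΛ, hφ, F.homOfTop_apply]
    refine Submodule.sum_mem _ fun σ _ => topAlg_mem_polyDeg σ ?_
    rw [← add_assoc]
    have h1 := h σ.1 (2 * Δ.hyperplanes.card + i)
      (F.toRel σ ⟨_, F.wallPoly_smul_mem hΔ s.2⟩) (by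
        change Δ.wallPoly • s.1 σ.1 ∈ F.deg σ.1 (2 * Δ.hyperplanes.card + i)
        rw [F.smul_def]
        refine F.smul_mem_deg σ.1 _ i _ _ ?_ (hs σ.1)
        rw [Fan.algebraMap_apply]
        exact pull_mem_polyDeg _ wallPoly_mem_polyDeg)
    rwa [σ.2] at h1
  · intro h
    refine hg.mem_relHomDeg hΔ fun σ i s hs => ?_
    have h1 : g σ.1 s = algebraMap (PolyAlg V) (Alg σ.1) (F.homOfTop (fun σ => g σ.1)
        (F.ofRel σ s)) := by
      rw [F.homOfTop_ofRel, algebraMap_topAlg]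
    rw [h1, ← hφ, Fan.algebraMap_apply, σ.2]
    refine pull_mem_polyDeg _ (h i _ fun ρ => ?_)
    classical
    change Pi.single (M := F.stalk) σ.1 s.1 ρ ∈ F.deg ρ i
    by_cases hρ : ρ = σ.1
    · subst hρ
      rw [Pi.single_eq_same]
      exact hs
    · rw [Pi.single_eq_of_ne hρ]
      exact zero_mem _

variable (F vol)

/-- A section of `F_(τ,∂τ)` for an `(n-1)`-cone `τ` extends to a section over `Δ` that vanishes on
the other cones of dimension less than `n`. -/
theorem exists_section_of_wall {τ : Δ.Cone} (hτ : dim τ + 1 = finrank ℝ V) (s : F.rel τ) :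
    ∃ T, F.IsSection Set.univ T ∧ T τ = s ∧ ∀ ρ ∈ Δ.lowerSkeleton, ρ ≠ τ → T ρ = 0 := by
  classical
  let s' : ∀ ρ, F.stalk ρ := fun ρ => if h : ρ ≤ τ then F.res h s.1 else 0
  have hs' : F.IsSection Δ.lowerSkeleton s' := by
    intro ρ' ρ h hρ hρ'
    by_cases h1 : ρ ≤ τ
    · simp only [s', dif_pos h1, dif_pos (h.trans h1), F.res_res]
    · by_cases h2 : ρ' ≤ τ
      · have h3 : ρ' < τ := lt_of_le_of_ne h2 fun he => by
          subst he
          have h4 := dim_lt (lt_of_le_of_ne h fun he => h1 he.ge)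
          have h5 : dim ρ < finrank ℝ V := hρ
          omega
        simp only [s', dif_neg h1, dif_pos h2, map_zero, s.2 ρ' h3]
      · simp only [s', dif_neg h1, dif_neg h2, map_zero]
  obtain ⟨T, hT, hT'⟩ := F.flabby Δ.lowerSkeleton
    (fun a b hba ha => lt_of_le_of_lt (dim_mono hba) ha) s' hs'
  refine ⟨T, hT, ?_, fun ρ hρ hne => ?_⟩
  · rw [hT' τ (show dim τ < finrank ℝ V by omega)]
    simp only [s', dif_pos le_rfl, F.res_self]
  · rw [hT' ρ hρ]
    simp only [s']
    split_ifs with h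
    · exact s.2 ρ (lt_of_le_of_ne h hne)
    · rfl

open Classical in
/-- The residue formula: the sum of the restrictions to an `(n-1)`-cone `τ` given by a homomorphism
`F_(Δ,Λ) → A`, `τ ∉ Λ`, is zero. -/
theorem sum_resAlg_eq_zero {Λ : Set Δ.Cone} (hΛ : Λ ⊆ Δ.lowerSkeleton)
    (φ : F.sections Λ →ₗ[PolyAlg V] PolyAlg V) {τ : Δ.Cone} (hτ : dim τ + 1 = finrank ℝ V)
    (hτΛ : τ ∉ Λ) (s : F.rel τ) (c : Δ.TopCone → ℝ) {h : Dual ℝ V}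
    (hc : ∀ (σ : Δ.TopCone) (hf : IsFacet τ.1 σ.1.1), h = c σ • vol.facetForm hf)
    (hh : ∀ x ∈ span τ, h x = 0) :
    ∑ σ : Δ.TopCone, (if hf : IsFacet τ.1 σ.1.1 then
      c σ • F.redRes vol hf (F.topOfHom (F.restrictHom hΛ φ) σ) s else 0) = 0 := by
  obtain ⟨T, hT, hTτ, hT0⟩ := F.exists_section_of_wall hτ s
  have hTΛ : T ∈ F.sections Λ := ⟨hT, fun ρ hρ => hT0 ρ (hΛ hρ) fun he => hτΛ (he ▸ hρ)⟩
  have hlow : linForm h • T ∈ F.sections Δ.lowerSkeleton := by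
    refine ⟨((F.sections Λ).smul_mem _ hTΛ).1, fun ρ hρ => ?_⟩
    rw [Pi.smul_apply]
    by_cases he : ρ = τ
    · subst he
      rw [F.smul_def, algebraMap_linForm_eq_zero hh, zero_smul]
    · rw [hT0 ρ hρ he, smul_zero]
  set f := F.topOfHom (F.restrictHom hΛ φ) with hf
  -- The left-hand side is a sum over `n`-cones; the right-hand side is a multiple of `h`, hence
  -- zero on `τ`.
  have h1 : F.homOfTop f ⟨_, hlow⟩ = linForm h * φ ⟨T, hTΛ⟩ := by
    rw [hf, F.homOfTop_topOfHom, ← smul_eq_mul, ← map_smul]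
    rfl
  have h2 := congrArg (algebraMap (PolyAlg V) (Alg τ)) h1
  rw [map_mul, algebraMap_linForm_eq_zero hh, zero_mul, F.homOfTop_apply, map_sum] at h2
  refine Eq.trans (Finset.sum_congr rfl fun σ _ => ?_) h2
  have hvan : ∀ (ρ : Δ.Cone) (hρ : ρ < σ.1), ρ ≠ τ → F.res hρ.le (T σ.1) = 0 := fun ρ hρ hne => by
    rw [hT hρ.le trivial trivial]
    exact hT0 ρ ((dim_lt hρ).trans_eq σ.2) hne
  split_ifs with hfσ
  · have hext : F.IsExtension (le_of_isFacet hfσ) s (T σ.1) :=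
      ⟨by rw [hT (le_of_isFacet hfσ) trivial trivial, hTτ], hvan⟩
    have hcσ := hc σ hfσ
    have hm : linForm (c σ • vol.facetForm hfσ) • T σ.1 ∈ F.rel σ.1 := by
      rw [← hcσ]
      exact F.linForm_smul_mem_rel hext hh
    rw [algebraMap_topAlg_eq_resAlg σ (le_of_isFacet hfσ),
      ← F.redRes_apply_smul vol hfσ (f σ) hext (c σ) hm]
    congr 2
    apply Subtype.ext
    exact congrArg (fun ℓ => linForm ℓ • T σ.1) hcσ.symm
  -- If `τ` is not a facet of `σ`, then `T` already vanishes on `∂σ`, so the summand is itself a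
  -- multiple of `h`.
  · have hrel : T σ.1 ∈ F.rel σ.1 := fun ρ hρ => hvan ρ hρ fun he => by
      subst he
      exact hfσ (isFacet_of_le hρ.le (σ.2.trans hτ.symm))
    have he : F.toRel σ ⟨_, hlow⟩ = linForm h • ⟨_, hrel⟩ := rfl
    rw [he, map_smul, map_smul, smul_eq_mul, map_mul, algebraMap_linForm_eq_zero hh, zero_mul]

/-- A homomorphism `F_(Δ,Λ) → A` defines a compatible family, which vanishes on the boundary walls
outside of `Λ`. -/
theorem exists_isCompatible_of_hom (hΔ : Δ.IsNormal) {Λ : Set Δ.Cone} (hΛ : Λ ⊆ Δ.lowerSkeleton)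
    (hΛ' : ∀ τ ∈ Λ, dim τ + 1 = finrank ℝ V → IsBoundaryWall τ)
    (φ : F.sections Λ →ₗ[PolyAlg V] PolyAlg V) :
    ∃ g : ∀ σ : Δ.Cone, F.rel σ →ₗ[PolyAlg V] Alg σ, F.IsCompatible vol g ∧
      F.homOfTop (fun σ => g σ.1) = F.restrictHom hΛ φ ∧
      ∀ τ : Δ.Cone, dim τ + 1 = finrank ℝ V → IsBoundaryWall τ → τ ∉ Λ → g τ = 0 := by
  classical
  set f := F.topOfHom (F.restrictHom hΛ φ) with hfdef
  have wall : ∀ {τ σ : Δ.Cone}, IsFacet τ.1 σ.1 → dim σ = finrank ℝ V → dim τ + 1 = finrank ℝ V :=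
    fun hf hd => hd ▸ hf.dim_eq.symm
  have hunique : ∀ (τ : Δ.Cone) (σ : Δ.TopCone) (hf : IsFacet τ.1 σ.1.1), IsBoundaryWall τ →
      τ ∉ Λ → F.redRes vol hf (f σ) = 0 := by
    intro τ σ hf hb hτΛ
    refine LinearMap.ext fun s => ?_
    have h1 := F.sum_resAlg_eq_zero vol hΛ φ (wall hf σ.2) hτΛ s (fun _ => 1)
      (h := vol.facetForm hf) (fun σ' hf' => by
        have : σ' = σ := Subtype.ext (hb.unique ⟨σ'.2, hf'⟩ ⟨σ.2, hf⟩)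
        subst this
        rw [one_smul]) fun x hx => vol.facetForm_eq_zero hf hx
    rw [sum_eq_of_boundaryWall hf hb _ (fun σ'' h => dif_neg h), dif_pos hf, one_smul] at h1
    exact h1
  obtain ⟨g, hg, hg'⟩ := F.exists_extension_of_top vol hΔ
    (fun σ => if h : dim σ = finrank ℝ V then f ⟨σ, h⟩ else 0) (fun τ σ σ' h h' hσ hσ' => by
      rw [dif_pos hσ, dif_pos hσ']
      by_cases hne : σ = σ'
      · subst hne
        rfl
      have hnb : ¬ IsBoundaryWall τ := fun hb => hne (hb.unique ⟨hσ, h⟩ ⟨hσ', h'⟩)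
      have hτΛ : τ ∉ Λ := fun hτ => hnb (hΛ' τ hτ (wall h hσ))
      obtain ⟨σ₁, -, -, -, hall⟩ := (boundaryWall_or_exists vol hσ h).resolve_left hnb
      have hσ₁ : σ' = σ₁ := (hall σ' hσ' h').resolve_left (Ne.symm hne)
      subst hσ₁
      have hneg := vol.facetForm_eq_neg hσ hσ' h h' hne
      refine LinearMap.ext fun s => ?_
      -- The normalised forms are opposite, so the coefficients are `1` and `-1`, and the residue
      -- formula is the equality of the two restrictions.
      have h1 := F.sum_resAlg_eq_zero vol hΛ φ (wall h hσ) hτΛ s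
        (fun σ'' => if σ''.1 = σ then 1 else -1) (h := vol.facetForm h) (fun σ'' hf'' => by
          rcases hall σ''.1 σ''.2 hf'' with he | he
          · subst he
            rw [if_pos rfl, one_smul]
          · subst he
            rw [if_neg (Ne.symm hne), hneg]
            module)
        fun x hx => vol.facetForm_eq_zero h hx
      rw [sum_eq_add_of_facets (σ := ⟨σ, hσ⟩) (σ' := ⟨σ', hσ'⟩)
        (fun he => hne (congrArg Subtype.val he)) hall _ (fun σ'' h => dif_neg h), dif_pos h,
        dif_pos h', if_pos rfl, if_neg (Ne.symm hne), one_smul, neg_smul, one_smul,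
        ← sub_eq_add_neg, sub_eq_zero] at h1
      exact h1)
  have hgf : ∀ σ : Δ.TopCone, g σ.1 = f σ := fun σ => by rw [hg σ.1 σ.2, dif_pos σ.2]
  refine ⟨g, hg', ?_, fun τ hτ hb hτΛ => ?_⟩
  · have : (fun σ : Δ.TopCone => g σ.1) = f := funext hgf
    rw [this, hfdef, F.homOfTop_topOfHom]
  · obtain ⟨σ, hσ, -⟩ := id hb
    rw [← hg' τ σ hσ.2, hgf ⟨σ, hσ.1⟩]
    exact hunique τ ⟨σ, hσ.1⟩ hσ.2 hb hτΛ

variable {F vol}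

/-- The homomorphism `F_(Δ,Δ^{≤n-1}) → A` given by a compatible family takes values divisible by the
form of a hyperplane on sections that come from `F_(Δ,Λ)`. -/
theorem IsCompatible.linForm_dvd {Λ : Set Δ.Cone}
    {g : ∀ σ : Δ.Cone, F.rel σ →ₗ[PolyAlg V] Alg σ} (hg : F.IsCompatible vol g)
    (hgΛ : ∀ τ : Δ.Cone, dim τ + 1 = finrank ℝ V → IsBoundaryWall τ → τ ∈ Λ ∨ g τ = 0)
    {H : Submodule ℝ V} (hH : H ∈ Δ.hyperplanes) {s : ∀ σ, F.stalk σ} (hs : s ∈ F.sections Λ)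
    (hsH : ∀ ρ τ : Δ.Cone, ρ ≤ τ → dim τ + 1 = finrank ℝ V → span τ ≠ H → s ρ = 0)
    (hlow : linForm (hyperForm H) • s ∈ F.sections Δ.lowerSkeleton) :
    linForm (hyperForm H) ∣ F.homOfTop (fun σ => g σ.1) ⟨_, hlow⟩ := by
  classical
  have hform := hyperForm_eq_zero_iff (finrank_of_mem_hyperplanes hH)
  have wall : ∀ {τ : Δ.Cone} (σ : Δ.TopCone), IsFacet τ.1 σ.1.1 → dim τ + 1 = finrank ℝ V :=
    fun σ hf => σ.2 ▸ hf.dim_eq.symm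
  have hvan : ∀ (σ : Δ.TopCone) (ρ : Δ.Cone) (hρ : ρ < σ.1) (τ : Δ.Cone), IsFacet τ.1 σ.1.1 →
      span τ ≠ H → ρ ≤ τ → F.res hρ.le (s σ.1) = 0 := fun σ ρ hρ τ hf hne hle => by
    rw [hs.1 hρ.le trivial trivial]
    exact hsH ρ τ hle (wall σ hf) hne
  -- Each `n`-cone has at most one facet in `H`; the sum is grouped according to it.
  let κ : Δ.TopCone → Option Δ.Cone := fun σ =>
    if h : ∃ τ : Δ.Cone, IsFacet τ.1 σ.1.1 ∧ span τ = H then some h.choose else none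
  have hκ : ∀ (σ : Δ.TopCone) (τ : Δ.Cone), κ σ = some τ ↔ IsFacet τ.1 σ.1.1 ∧ span τ = H := by
    intro σ τ
    by_cases h : ∃ τ : Δ.Cone, IsFacet τ.1 σ.1.1 ∧ span τ = H
    · simp only [κ, dif_pos h, Option.some.injEq]
      refine ⟨fun he => he ▸ h.choose_spec, fun h' => ?_⟩
      exact eq_of_span_eq (le_of_isFacet h.choose_spec.1) (le_of_isFacet h'.1)
        (h.choose_spec.2.trans h'.2.symm)
    · simp only [κ, dif_neg h, reduceCtorEq, false_iff]
      exact fun h' => h ⟨τ, h'⟩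
  rw [F.homOfTop_apply, ← Finset.sum_fiberwise Finset.univ κ]
  refine Finset.dvd_sum fun x _ => ?_
  rcases x with _ | τ
  · refine Finset.dvd_sum fun σ hσ => ?_
    have hno : ∀ τ : Δ.Cone, IsFacet τ.1 σ.1.1 → span τ ≠ H := fun τ hf he => by
      have h1 := (hκ σ τ).2 ⟨hf, he⟩
      rw [(Finset.mem_filter.1 hσ).2] at h1
      exact absurd h1 (by simp)
    have hrel : s σ.1 ∈ F.rel σ.1 := fun ρ hρ => by
      obtain ⟨τ, hf, hle⟩ := exists_facet_of_lt hρ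
      exact hvan σ ρ hρ τ hf (hno τ hf) hle
    have he : F.toRel σ ⟨_, hlow⟩ = linForm (hyperForm H) • ⟨_, hrel⟩ := rfl
    rw [he, map_smul, map_smul, smul_eq_mul]
    exact dvd_mul_right _ _
  by_cases hex : ∃ σ : Δ.TopCone, κ σ = some τ
  swap
  · rw [Finset.filter_eq_empty_iff.2 fun σ _ h => hex ⟨σ, h⟩, Finset.sum_empty]
    exact dvd_zero _
  obtain ⟨σ, hσ⟩ := hex
  obtain ⟨hfσ, hτH⟩ := (hκ σ τ).1 hσ
  have hh : ∀ x ∈ span τ, hyperForm H x = 0 := fun x hx => (hform x).2 (hτH ▸ hx)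
  rw [linForm_dvd_iff (U := span τ) (fun x => by rw [hτH]; exact hform x),
    ← Fan.algebraMap_apply, map_sum]
  -- Every proper face of `σ` other than `τ` lies in a facet that does not span `H`, where `s`
  -- vanishes. So `s` on `σ` is an extension by zero of its restriction to `τ`.
  have hext : ∀ (σ : Δ.TopCone) (ρ : Δ.Cone) (hρ : ρ < σ.1), IsFacet τ.1 σ.1.1 → ρ ≠ τ →
      F.res hρ.le (s σ.1) = 0 := by
    intro σ ρ hρ hf hne
    have hother : ∃ τ' : Δ.Cone, IsFacet τ'.1 σ.1.1 ∧ ρ ≤ τ' ∧ τ' ≠ τ := by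
      by_cases hle : ρ ≤ τ
      · exact exists_other_facet (lt_of_le_of_ne hle hne) hf
      · obtain ⟨τ', h1, h2⟩ := exists_facet_of_lt hρ
        exact ⟨τ', h1, h2, fun he => hle (he ▸ h2)⟩
    obtain ⟨τ', h1, h2, h3⟩ := hother
    exact hvan σ ρ hρ τ' h1 (fun he => h3 (eq_of_span_eq (le_of_isFacet h1) (le_of_isFacet hf)
      (he.trans hτH.symm))) h2
  have hsτ : s τ ∈ F.rel τ := fun ρ hρ => by
    rw [hs.1 hρ.le trivial trivial, ← hs.1 (hρ.le.trans (le_of_isFacet hfσ)) trivial trivial]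
    exact hext σ ρ (hρ.trans_le (le_of_isFacet hfσ)) hfσ hρ.ne
  -- the restriction to `τ` of each summand is a multiple of the same element
  have hval : ∀ (σ : Δ.TopCone) (hf : IsFacet τ.1 σ.1.1) (c : ℝ),
      hyperForm H = c • vol.facetForm hf →
      algebraMap (PolyAlg V) (Alg τ) (topAlg σ (g σ.1 (F.toRel σ ⟨_, hlow⟩))) =
        c • g τ ⟨s τ, hsτ⟩ := by
    intro σ hf c hc
    have hE : F.IsExtension (le_of_isFacet hf) ⟨s τ, hsτ⟩ (s σ.1) :=
      ⟨hs.1 (le_of_isFacet hf) trivial trivial, fun ρ hρ hne => hext σ ρ hρ hf hne⟩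
    have hm : linForm (c • vol.facetForm hf) • s σ.1 ∈ F.rel σ.1 := by
      rw [← hc]
      exact F.linForm_smul_mem_rel hE hh
    rw [algebraMap_topAlg_eq_resAlg σ (le_of_isFacet hf), ← hg τ σ.1 hf,
      ← F.redRes_apply_smul vol hf (g σ.1) hE c hm]
    congr 2
    apply Subtype.ext
    exact congrArg (fun ℓ => linForm ℓ • s σ.1) hc
  obtain ⟨c, hc⟩ := vol.exists_eq_smul_facetForm σ.2 hfσ hh
  rw [Finset.sum_filter]
  have hzero : ∀ σ'' : Δ.TopCone, ¬ IsFacet τ.1 σ''.1.1 →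
      (if κ σ'' = some τ then algebraMap (PolyAlg V) (Alg τ)
        (topAlg σ'' (g σ''.1 (F.toRel σ'' ⟨_, hlow⟩))) else 0) = 0 := fun σ'' h =>
    if_neg fun h' => h ((hκ σ'' τ).1 h').1
  -- At a boundary wall the single residue vanishes since `s τ = 0` or `g τ = 0`; at an interior
  -- wall the two residues are `c • g τ` and `-c • g τ` at the same element.
  rcases boundaryWall_or_exists vol σ.2 hfσ with hb | ⟨σ', hne, hσ', hf', hall⟩
  · rw [sum_eq_of_boundaryWall hfσ hb _ hzero, if_pos hσ, hval σ hfσ c hc]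
    rcases hgΛ τ (wall σ hfσ) hb with h | h
    · have : (⟨s τ, hsτ⟩ : F.rel τ) = 0 := Subtype.ext (hs.2 τ h)
      rw [this, map_zero, smul_zero]
    · rw [h, LinearMap.zero_apply, smul_zero]
  · have hneg := vol.facetForm_eq_neg σ.2 hσ' hfσ hf' hne.symm
    rw [sum_eq_add_of_facets (σ := σ) (σ' := ⟨σ', hσ'⟩)
      (fun he => hne (congrArg Subtype.val he).symm) hall _ hzero, if_pos hσ,
      if_pos ((hκ ⟨σ', hσ'⟩ τ).2 ⟨hf', hτH⟩), hval σ hfσ c hc,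
      hval ⟨σ', hσ'⟩ hf' (-c) (by rw [hneg, smul_neg, neg_smul, neg_neg]; exact hc), neg_smul,
      add_neg_cancel]

/-- A compatible family that vanishes on the boundary walls outside of `Λ` defines a homomorphism
`F_(Δ,Λ) → A`. -/
theorem IsCompatible.exists_hom (hΔ : Δ.IsPure) {Λ : Set Δ.Cone} (hΛ : Λ ⊆ Δ.lowerSkeleton)
    {g : ∀ σ : Δ.Cone, F.rel σ →ₗ[PolyAlg V] Alg σ} (hg : F.IsCompatible vol g)
    (hgΛ : ∀ τ : Δ.Cone, dim τ + 1 = finrank ℝ V → IsBoundaryWall τ → τ ∈ Λ ∨ g τ = 0) :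
    ∃ φ : F.sections Λ →ₗ[PolyAlg V] PolyAlg V,
      F.restrictHom hΛ φ = F.homOfTop fun σ => g σ.1 := by
  classical
  set f := F.homOfTop fun σ => g σ.1 with hf
  have hdvd : ∀ s : F.sections Λ, Δ.wallPoly ∣ f ⟨_, F.wallPoly_smul_mem hΔ s.2⟩ := by
    intro s
    refine wallPoly_dvd fun H hH => ?_
    have hprod : Δ.wallPoly = linForm (hyperForm H) *
        ∏ H' ∈ Δ.hyperplanes.erase H, linForm (hyperForm H') :=
      (Finset.mul_prod_erase _ _ hH).symm
    -- The factor `q` makes `s` vanish on all walls that do not span `H`, leaving only residues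
    -- along `H`.
    set q := ∏ H' ∈ Δ.hyperplanes.erase H, linForm (hyperForm H') with hq
    have hlow := F.wallPoly_smul_mem hΔ s.2
    have he : Δ.wallPoly • s.1 = linForm (hyperForm H) • q • s.1 := by rw [hprod, mul_smul]
    have hlow' : linForm (hyperForm H) • q • s.1 ∈ F.sections Δ.lowerSkeleton := he ▸ hlow
    have := hg.linForm_dvd hgΛ hH ((F.sections Λ).smul_mem q s.2) (fun ρ τ hle hτ hne => by
      have hτH : span τ ∈ Δ.hyperplanes := mem_hyperplanes.2 ⟨τ, hτ, rfl⟩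
      rw [Pi.smul_apply, F.smul_def, hq, map_prod,
        Finset.prod_eq_zero (Finset.mem_erase.2 ⟨hne, hτH⟩)
          (algebraMap_hyperForm hτH (span_mono hle)), zero_smul]) hlow'
    have he' : (⟨_, hlow⟩ : F.sections Δ.lowerSkeleton) = ⟨_, hlow'⟩ := Subtype.ext he
    rw [he']
    exact this
  -- The homomorphism is `s ↦ f(w s) / w`; its linearity follows by cancelling `w`.
  choose φ hφ using hdvd
  have hw := Δ.wallPoly_ne_zero
  refine ⟨{ toFun := φ, map_add' := fun s t => ?_, map_smul' := fun a s => ?_ }, ?_⟩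
  · refine mul_left_cancel₀ hw ?_
    rw [mul_add, ← hφ, ← hφ, ← hφ, ← map_add]
    congr 1
    exact Subtype.ext (smul_add _ _ _)
  · refine mul_left_cancel₀ hw ?_
    rw [RingHom.id_apply, smul_eq_mul, mul_left_comm, ← hφ, ← hφ, ← smul_eq_mul, ← map_smul]
    congr 1
    exact Subtype.ext (smul_comm _ _ _)
  · refine LinearMap.ext fun s => mul_left_cancel₀ hw ?_
    change Δ.wallPoly * φ _ = _
    rw [← hφ, ← smul_eq_mul, ← map_smul]
    rfl

/-! ### The duality theorem -/

theorem exists_isCompatible_of_mem_dualSections {Λ : Set Δ.Cone} {ψ : ∀ σ, F.DualStalk σ}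
    (hψ : ψ ∈ F.dualSections o Λ) : ∃ g : ∀ σ : Δ.Cone, F.rel σ →ₗ[PolyAlg V] Alg σ,
      F.IsCompatible vol g ∧ (∀ σ, ψ σ = g σ ⊗ₜ vol.form σ) ∧ ∀ σ ∈ Λ, g σ = 0 := by
  choose g hg using fun σ : Δ.Cone => exists_eq_tmul (vol.ne_zero σ) (ψ σ)
  refine ⟨g, fun τ σ hf => tmul_injective (vol.ne_zero τ) ?_, hg, fun σ hσ => ?_⟩
  · rw [← F.dualRes_tmul vol hf, ← hg, ← hg]
    exact hψ.1 τ σ hf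
  · rw [← tmul_eq_zero_iff (vol.ne_zero σ), ← hg]
    exact hψ.2 σ hσ

variable (F) (o)

/-- The duality isomorphism between the sections of the dual sheaf that vanish on `Λ'` and the
homomorphisms on the sections that vanish on `Λ`, where `Λ` and `Λ'` are complementary parts of
the boundary. -/
theorem exists_duality_equiv (hΔ : Δ.IsNormal) {Λ Λ' : Set Δ.Cone} (hΛ : Λ ⊆ Δ.lowerSkeleton)
    (h₁ : ∀ τ : Δ.Cone, dim τ + 1 = finrank ℝ V → IsBoundaryWall τ → τ ∈ Λ ∨ τ ∈ Λ')
    (h₂ : ∀ τ ∈ Λ, dim τ + 1 = finrank ℝ V → IsBoundaryWall τ)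
    (h₃ : ∀ γ ∈ Λ', ∃ τ : Δ.Cone, γ ≤ τ ∧ dim τ + 1 = finrank ℝ V ∧ IsBoundaryWall τ ∧ τ ∉ Λ) :
    ∃ e : F.dualSections o Λ' ≃ₗ[PolyAlg V] F.HomDet Λ,
      (∀ ψ, F.homRestrict hΛ (e ψ) = F.theta fun σ => ψ.1 σ.1) ∧
      ∀ (k : ℤ) (ψ : F.dualSections o Λ'),
        (∀ σ, ψ.1 σ ∈ F.dualStalkDeg σ k) ↔ e ψ ∈ F.homDetDeg Λ k := by
  obtain ⟨vol⟩ := VolumeForms.exists o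
  let T : F.dualSections o Λ' →ₗ[PolyAlg V] F.HomDet Δ.lowerSkeleton :=
    F.theta.comp (LinearMap.pi fun σ : Δ.TopCone =>
      (LinearMap.proj σ.1).comp (F.dualSections o Λ').subtype)
  let R : F.HomDet Λ →ₗ[PolyAlg V] F.HomDet Δ.lowerSkeleton := F.homRestrict hΛ
  have hT : ∀ (ψ : F.dualSections o Λ') (g : ∀ σ : Δ.Cone, F.rel σ →ₗ[PolyAlg V] Alg σ),
      (∀ σ, ψ.1 σ = g σ ⊗ₜ vol.form σ) → T ψ = F.homOfTop (fun σ => g σ.1) ⊗ₜ vol.top := by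
    intro ψ g hg
    rw [← F.theta_tmul vol]
    exact congrArg F.theta (funext fun σ => hg σ.1)
  have hTinj : Function.Injective T := by
    intro ψ₁ ψ₂ h
    obtain ⟨g₁, hg₁, hψ₁, -⟩ := exists_isCompatible_of_mem_dualSections (vol := vol) ψ₁.2
    obtain ⟨g₂, hg₂, hψ₂, -⟩ := exists_isCompatible_of_mem_dualSections (vol := vol) ψ₂.2
    rw [hT ψ₁ g₁ hψ₁, hT ψ₂ g₂ hψ₂] at h
    refine Subtype.ext (funext fun σ => ?_)
    rw [hψ₁, hψ₂, hg₁.eq_of_homOfTop_eq hΔ.1 hg₂ (tmul_injective vol.top_ne_zero h)]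
  have hRinj : Function.Injective R := F.homRestrict_injective hΔ.1 hΛ
  -- With both maps injective, equality of their images gives the isomorphism as `R⁻¹ ∘ T`.
  have hrange : LinearMap.range T = LinearMap.range R := by
    refine le_antisymm ?_ ?_
    · rintro _ ⟨ψ, rfl⟩
      obtain ⟨g, hg, hψ, h0⟩ := exists_isCompatible_of_mem_dualSections (vol := vol) ψ.2
      obtain ⟨φ, hφ⟩ := hg.exists_hom hΔ.1 hΛ fun τ hτ hb => (h₁ τ hτ hb).imp_right (h0 τ)
      refine ⟨φ ⊗ₜ vol.top, ?_⟩
      rw [hT ψ g hψ, ← hφ]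
      exact F.homRestrict_tmul hΛ φ vol.top
    · rintro _ ⟨x, rfl⟩
      obtain ⟨φ, rfl⟩ := exists_eq_tmul vol.top_ne_zero x
      obtain ⟨g, hg, hφ, h0⟩ := F.exists_isCompatible_of_hom vol hΔ hΛ h₂ φ
      refine ⟨⟨fun σ => g σ ⊗ₜ vol.form σ, fun τ σ hf => ?_, fun γ hγ => ?_⟩, ?_⟩
      · rw [F.dualRes_tmul vol hf, hg τ σ hf]
      · obtain ⟨τ, hle, hτ, hb, hτΛ⟩ := h₃ γ hγ
        exact (tmul_eq_zero_iff (vol.ne_zero γ)).2 (hg.eq_zero_of_le hle (h0 τ hτ hb hτΛ))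
      · rw [hT _ g fun _ => rfl, hφ]
        exact (F.homRestrict_tmul hΛ φ vol.top).symm
  let e : F.dualSections o Λ' ≃ₗ[PolyAlg V] F.HomDet Λ :=
    (LinearEquiv.ofInjective T hTinj).trans
      ((LinearEquiv.ofEq _ _ hrange).trans (LinearEquiv.ofInjective R hRinj).symm)
  have he : ∀ ψ, R (e ψ) = T ψ := fun ψ =>
    congrArg Subtype.val ((LinearEquiv.ofInjective R hRinj).apply_symm_apply
      (LinearEquiv.ofEq _ _ hrange (LinearEquiv.ofInjective T hTinj ψ)))
  refine ⟨e, he, fun k ψ => ?_⟩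
  obtain ⟨g, hg, hψ, -⟩ := exists_isCompatible_of_mem_dualSections (vol := vol) ψ.2
  obtain ⟨φ, hφ⟩ := exists_eq_tmul vol.top_ne_zero (e ψ)
  have h4 := he ψ
  rw [hφ, hT ψ g hψ] at h4
  have h5 : F.restrictHom hΛ φ = F.homOfTop fun σ => g σ.1 := tmul_injective vol.top_ne_zero h4
  rw [hφ, F.tmul_mem_homDetDeg_iff vol.top_ne_zero, ← hg.homogeneous_iff hΔ.1 hΛ h5 k]
  refine forall_congr' fun σ => ?_
  rw [hψ σ, F.tmul_mem_dualStalkDeg_iff (vol.ne_zero σ)]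

end PureSheaf

end FanDuality

end

/-- Let `F` be a pure sheaf on a normal oriented fan `Δ` in `V`. Then `Θ` is an isomorphism, and it
induces isomorphisms of graded `A`-modules `(DF)_Δ ≅ Hom(F_(Δ,∂Δ), A) ⊗ det V^*` and
`(DF)_(Δ,∂Δ) ≅ Hom(F_Δ, A) ⊗ det V^*`, where the right-hand sides are regarded as submodules of
`Hom(F_(Δ,Δ^{≤n-1}), A) ⊗ det V^*` by the (injective) restriction of homomorphisms. -/
theorem theorem2p3 {V : Type u} [AddCommGroup V] [Module ℝ V] [FiniteDimensional ℝ V]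
    (Δ : FanDuality.Fan V) (hΔ : Δ.IsNormal) (o : Δ.Oriented)
    (F : FanDuality.PureSheaf.{u, w} Δ) :
    Function.Bijective F.theta ∧
    (Function.Injective (F.homRestrict Δ.boundary_subset) ∧
      ∃ e : F.dualSections o ∅ ≃ₗ[FanDuality.PolyAlg V] F.HomDet Δ.boundary,
        (∀ ψ, F.homRestrict Δ.boundary_subset (e ψ) = F.theta fun σ => ψ.1 σ.1) ∧
        ∀ (k : ℤ) (ψ : F.dualSections o ∅),
          (∀ σ, ψ.1 σ ∈ F.dualStalkDeg σ k) ↔ e ψ ∈ F.homDetDeg Δ.boundary k) ∧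
    (Function.Injective (F.homRestrict (Set.empty_subset Δ.lowerSkeleton)) ∧
      ∃ e : F.dualSections o Δ.boundary ≃ₗ[FanDuality.PolyAlg V] F.HomDet ∅,
        (∀ ψ, F.homRestrict (Set.empty_subset Δ.lowerSkeleton) (e ψ) =
          F.theta fun σ => ψ.1 σ.1) ∧
        ∀ (k : ℤ) (ψ : F.dualSections o Δ.boundary),
          (∀ σ, ψ.1 σ ∈ F.dualStalkDeg σ k) ↔ e ψ ∈ F.homDetDeg ∅ k) := by
  obtain ⟨vol⟩ := FanDuality.VolumeForms.exists o
  refine ⟨F.theta_bijective vol, ⟨F.homRestrict_injective hΔ.1 _, ?_⟩,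
    ⟨F.homRestrict_injective hΔ.1 _, ?_⟩⟩
  · refine F.exists_duality_equiv o hΔ Δ.boundary_subset
      (fun τ hτ hb => Or.inl ⟨τ, le_rfl, hτ, hb⟩) ?_ fun γ hγ => hγ.elim
    rintro τ ⟨τ', hle, hd, hb⟩ hτ
    -- A wall in the boundary is a face of a generating wall of the same dimension, so it is that
    -- wall.
    have : τ = τ' := FanDuality.Fan.eq_of_le_of_dim_le hle (by omega)
    exact this ▸ hb
  · exact F.exists_duality_equiv o hΔ (Set.empty_subset _)
      (fun τ hτ hb => Or.inr ⟨τ, le_rfl, hτ, hb⟩) (fun τ hτ => hτ.elim)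
      fun γ ⟨τ, hle, hd, hb⟩ => ⟨τ, hle, hd, hb, Set.notMem_empty τ⟩
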